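/- **Setting.** Consider a POMDP with measurable state space $\mathcal X$, finite action space $\mathcal A$, measurable measurement space $\mathcal Z$, Markov transition kernel $p(x'|x,a)$, measurement likelihood $p(z|x)$ (a jointly measurable probability density with respect to a $\sigma$-finite measure on $\mathcal Z$), measurable reward $|r(x,a,x')|\le r_{\max}$, initial belief $b_0$ and discount factor $\gamma\in(0,1)$; the measurement $z_t$ is generated by the state $x_{t+1}$ reached with action $a_t$. For a history $h=(a_0,z_0,\dots,a_{t-1},z_{t-1})$ let $b_h$ be the Bayesian posterior of the current state and $p(z|h,a)$ the conditional law of the next measurement. Let $\pi(a|h)$ be a fixed measurable stochastic policy with $\pi(a|h)\ge \epsilon_a/|\mathcal A|$, where $0<\epsilon_a<1$ (e.g. an $\epsilon_a$-greedy policy), and let $-1\le\epsilon_z<0$. For a number $T$ of steps let $p_\pi(S)$ be the law of the episode $S=(x_t,a_t,z_t,x_{t+1},\dots,a_{t+T-1},z_{t+T-1},x_{t+T})$ that starts with $x_t\sim b_h$ and uses $\pi$, let $R(S)=\sum_{k<T}\gamma^k r(x_{t+k},a_{t+k},x_{t+k+1})$ and $V_\pi^T(h)=\int R\,dp_\pi$,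 and let $p_\pi(A,Z)$ be the marginal law of the actions and measurements. **Search tree.** The tree is grown by successive episodes, starting from a root. At a belief node with history $h$ an episode draws an action $a\sim\pi(\cdot|h)$. At the belief-action node $ha$, with $c$ children so far, it creates with probability $(c+1)^{\epsilon_z}$ a new child with measurement $z\sim p(\cdot|h,a)$, and then it leaves the tree, the remaining actions being drawn from a rollout policy (a measurable distribution over open-loop action sequences, given the history) and no more measurements being taken; otherwise it moves to one of the $c$ existing children, chosen uniformly. All random choices are independent, given the histories on which they depend. Random numbers are turned into actions and measurements by sampling procedures that are measurable in the history and a uniform random number. Let $\mathcal T_N$ be the tree after $N$ episodes, and for a belief node $h$ let $p_{\mathcal T_N}(A,Z)$ be the law of the next $T$ steps (actions and measurements, with no measurement in the rollout steps) of an episode that is run on $\mathcal T_N$ from $h$. **Estimate.** For an action-measurement sequence $(A,Z)$ and $K$ state trajectories $X^1,\dots,X^K$ put $$\tilde V_K(h|A,Z)=\frac{\sum_{i=1}^K p(Z|X^i,A)\,R(X^i,A)}{\sum_{i=1}^K p(Z|X^i,A)},$$ where $p(Z|X,A)$ is the product of the likelihoods of the measurements in $Z$ (and $0/0=0$). The $X^i$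 are obtained by independent forward simulation of the actions $A$, with initial states sampled from $b_h$. **Lemma.** For every $T$, almost surely (with respect to the growth of the tree), at every belief node $h$ of the tree: 1. $\ \mathbb E_{p_{\mathcal T_N}(A,Z)}\,\mathbb E_{X}\big[\tilde V_K(h|A,Z)\big]\to V^T_\pi(h)$ as $N\to\infty$ and $K\to\infty$ (jointly): although the actions and measurements follow the distribution induced by the tree and not the true one, the self-normalised importance-weighted return of an episode is an asymptotically unbiased estimate of the value of $h$. 2. The limit can also be taken successively. For every $K$ and every fixed choice of the trajectories $X^i$ (for each action sequence), almost surely, $\mathbb E_{p_{\mathcal T_N}(A,Z)}[\tilde V_K(h|A,Z)]\to\mathbb E_{p_\pi(A,Z)}[\tilde V_K(h|A,Z)]$ as $N\to\infty$ at every belief node $h$; and, for almost every realisation of the forward-simulated trajectories, $\mathbb E_{p_\pi(A,Z)}[\tilde V_K(h|A,Z)]\to V^T_\pi(h)$ as $K\to\infty$. Moreover, for every history $h$, the infinite-horizon value $V_\pi(h)=\lim_{T\to\infty}V_\pi^T(h)$ exists and $|V^T_\pi(h)-V_\pi(h)|\le r_{\max}\gamma^T/(1-\gamma)$. -/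

import Mathlib

open MeasureTheory ProbabilityTheory Filter Topology
open scoped ENNReal NNReal

noncomputable section

namespace POMCPpp

/-- A POMDP with state space `X`, action space `A`, measurement space `Z`: transition probability
`trans`, measurement likelihood `obs x z = p(z | x)` (a density with respect to the σ-finite
reference measure `ref` on `Z`), bounded reward, initial belief `b0` and discount factor `disc`.
The measurement belonging to an action is produced by the state reached through that action. -/
structure POMDP (X A Z : Type*) [MeasurableSpace X] [MeasurableSpace A] [MeasurableSpace Z] where
  trans : Kernel (X × A) X
  trans_markov : IsMarkovKernel trans
  ref : Measure Z
  ref_sigmaFinite : SigmaFinite ref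
  obs : X → Z → ℝ≥0
  obs_measurable : Measurable (Function.uncurry obs)
  obs_density : ∀ x, ∫⁻ z, (obs x z : ℝ≥0∞) ∂ref = 1
  reward : X → A → X → ℝ
  reward_measurable : Measurable fun p : X × A × X => reward p.1 p.2.1 p.2.2
  rmax : ℝ
  reward_bounded : ∀ x a x', |reward x a x'| ≤ rmax
  b0 : Measure X
  b0_prob : IsProbabilityMeasure b0
  disc : ℝ
  disc_pos : 0 < disc
  disc_lt_one : disc < 1

/-- A history of action-measurement pairs, with the most recent pair at the head of the list. -/
abbrev Hist (A Z : Type*) := List (A × Z)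

/-- A stochastic policy: in history `h` the action `a` is taken with probability `prob h a`. -/
structure Policy (A Z : Type*) [Fintype A] [MeasurableSpace A] [MeasurableSpace Z] where
  prob : Hist A Z → A → ℝ≥0
  sum_one : ∀ h, ∑ a, prob h a = 1
  prob_measurable : ∀ (n : ℕ) (a : A), Measurable fun s : Fin n → A × Z => prob (List.ofFn s) a

/-- A rollout policy: at a new leaf with history `h` and `T` steps to go, the open-loop action
sequence `u` is followed with probability `prob h T u`. -/
structure Rollout (A Z : Type*) [Fintype A] [MeasurableSpace A] [MeasurableSpace Z] where
  prob : Hist A Z → (T : ℕ) → (Fin T → A) → ℝ≥0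
  sum_one : ∀ h T, ∑ u, prob h T u = 1
  prob_measurable : ∀ (n T : ℕ) (u : Fin T → A),
    Measurable fun s : Fin n → A × Z => prob (List.ofFn s) T u

/-- A node of the search tree that represents a belief is addressed by the actions and the
numbers of the measurement branches on the way to it, most recent first; `[]` is the root and
`(a, j) :: w` is the `j`-th child that was spawned by the belief-action node `(w, a)`. -/
abbrev Node (A : Type*) := List (A × ℕ)

/-- The calls of the random number generator during the search. -/
inductive Call (A : Type*)
  /-- action selection at the `k`-th visit of the belief node `w` -/
  | action (w : Node A) (k : ℕ)
  /-- the decision, at the `k`-th visit of the belief-action node `(w, a)`, on a new branch -/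
  | spawn (w : Node A) (a : A) (k : ℕ)
  /-- the choice of an existing branch at the `k`-th visit of the belief-action node `(w, a)` -/
  | pick (w : Node A) (a : A) (k : ℕ)
  /-- sampling the measurement on the `j`-th branch of the belief-action node `(w, a)` -/
  | meas (w : Node A) (a : A) (j : ℕ)

/-- The uniform distribution on the unit interval. -/
def unif : Measure ℝ := volume.restrict (Set.Ico 0 1)

section Model

variable {X A Z : Type*} [MeasurableSpace X] [MeasurableSpace A] [MeasurableSpace Z]

/-- Bayes filter: the belief after action `a` and measurement `z`. -/
def POMDP.update (M : POMDP X A Z) (b : Measure X) (a : A) (z : Z) : Measure X :=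
  let μ := (b.bind fun x => M.trans (x, a)).withDensity fun x' => (M.obs x' z : ℝ≥0∞)
  (μ Set.univ)⁻¹ • μ

/-- The belief at a history: the posterior distribution of the current state. -/
def POMDP.belief (M : POMDP X A Z) : Hist A Z → Measure X
  | [] => M.b0
  | (a, z) :: h => M.update (M.belief h) a z

/-- `p(z | x)` as a probability measure on `Z`. -/
def POMDP.measLaw (M : POMDP X A Z) (x : X) : Measure Z :=
  M.ref.withDensity fun z => (M.obs x z : ℝ≥0∞)

/-- `p(z | h, a)`: the law of the next measurement, given the history `h` and the action `a`. -/
def POMDP.predict (M : POMDP X A Z) (h : Hist A Z) (a : A) : Measure Z :=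
  ((M.belief h).bind fun x => M.trans (x, a)).bind M.measLaw

/-- Discounted summation of rewards along the states `x` and the actions `u`. -/
def POMDP.ret (M : POMDP X A Z) {T : ℕ} (x : Fin (T + 1) → X) (u : Fin T → A) : ℝ :=
  ∑ i : Fin T, M.disc ^ (i : ℕ) * M.reward (x i.castSucc) (u i) (x i.succ)

/-- The law of the state trajectory that starts in `x` and follows the action sequence `u`. -/
def POMDP.trajLaw (M : POMDP X A Z) :
    (T : ℕ) → (Fin T → A) → X → Measure (Fin (T + 1) → X)
  | 0, _, x => Measure.dirac fun _ => x
  | T + 1, u, x => (M.trans (x, u 0)).bind fun x' =>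
      (M.trajLaw T (Fin.tail u) x').map
        fun s : Fin (T + 1) → X => (Fin.cons x s : Fin (T + 2) → X)

/-- `p(X_t | A_t)`: forward simulation of the actions `u` from a state sampled from the belief. -/
def POMDP.forwardLaw (M : POMDP X A Z) (h : Hist A Z) {T : ℕ} (u : Fin T → A) :
    Measure (Fin (T + 1) → X) :=
  (M.belief h).bind (M.trajLaw T u)

/-- A sequence of actions, each with its measurement, or with `Sum.inr ()` for a step of the
rollout phase, in which no measurement is taken. -/
abbrev Steps (A Z : Type*) (T : ℕ) := Fin T → A × (Z ⊕ Unit)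

/-- The actions of a sequence of steps. -/
def acts {T : ℕ} (e : Steps A Z T) : Fin T → A := fun i => (e i).1

/-- `p(Z_t | X_t, A_t)`: the likelihood of the measurements in `e` along the states `x`. -/
def POMDP.likelihood (M : POMDP X A Z) {T : ℕ} (x : Fin (T + 1) → X) (e : Steps A Z T) : ℝ :=
  ∏ i : Fin T, Sum.elim (fun z => (M.obs (x i.succ) z : ℝ)) (fun _ => 1) (e i).2

/-- The self-normalised importance-weighted return of `K` state trajectories. -/
def POMDP.estimate (M : POMDP X A Z) {T K : ℕ} (e : Steps A Z T)
    (x : Fin K → Fin (T + 1) → X) : ℝ :=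
  (∑ i, M.likelihood (x i) e * M.ret (x i) (acts e)) / ∑ i, M.likelihood (x i) e

/-- The expectation of the estimate over `K` independent forward-simulated trajectories whose
initial states are sampled from the belief at `h`. -/
def POMDP.meanEstimate (M : POMDP X A Z) (h : Hist A Z) {T : ℕ} (K : ℕ) (e : Steps A Z T) : ℝ :=
  ∫ x, M.estimate e x ∂(Measure.pi fun _ : Fin K => M.forwardLaw h (acts e))

end Model

section PolicyLaws

variable {X A Z : Type*} [MeasurableSpace X] [Fintype A] [MeasurableSpace A] [MeasurableSpace Z]

/-- The law of the next `T` steps (action, next state, measurement) of the POMDP under the policy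
`π`, from the state `x` and the history `h`. -/
def POMDP.stepsLaw (M : POMDP X A Z) (π : Policy A Z) :
    (T : ℕ) → Hist A Z → X → Measure (Fin T → A × X × Z)
  | 0, _, _ => Measure.dirac Fin.elim0
  | T + 1, h, x => ∑ a, (π.prob h a : ℝ≥0∞) •
      (M.trans (x, a)).bind fun x' => (M.measLaw x').bind fun z =>
        (M.stepsLaw π T ((a, z) :: h) x').map
          fun s : Fin T → A × X × Z => (Fin.cons (a, x', z) s : Fin (T + 1) → A × X × Z)

/-- `p_π(S_t)`: the law of an episode of `T` steps from the belief at `h`, as a pair of the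
initial state and the steps. -/
def POMDP.episodeLaw (M : POMDP X A Z) (π : Policy A Z) (T : ℕ) (h : Hist A Z) :
    Measure (X × (Fin T → A × X × Z)) :=
  (M.belief h).bind fun x => (M.stepsLaw π T h x).map (Prod.mk x)

/-- `V_π(h)`: the expected discounted summation of rewards over the next `T` steps. -/
def POMDP.value (M : POMDP X A Z) (π : Policy A Z) (T : ℕ) (h : Hist A Z) : ℝ :=
  ∫ S, M.ret (Fin.cons S.1 fun i => (S.2 i).2.1 : Fin (T + 1) → X) (fun i => (S.2 i).1)
    ∂(M.episodeLaw π T h)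

/-- `p_π(A_t, Z_t)`: the law of the actions and measurements of an episode from `h`. -/
def POMDP.policyLaw (M : POMDP X A Z) (π : Policy A Z) (T : ℕ) (h : Hist A Z) :
    Measure (Steps A Z T) :=
  (M.episodeLaw π T h).map fun S i => ((S.2 i).1, Sum.inl (S.2 i).2.2)

/-- The two sampling procedures used by the search, as functions of a uniform random number:
`selectAction h` draws an action according to the policy, and `sampleMeas h a` draws a
measurement according to `p(z | h, a)`. -/
structure Sampler (M : POMDP X A Z) (π : Policy A Z) where
  selectAction : Hist A Z → ℝ → A
  selectAction_measurable : ∀ n : ℕ,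
    Measurable fun p : (Fin n → A × Z) × ℝ => selectAction (List.ofFn p.1) p.2
  selectAction_law : ∀ h a, unif {r | selectAction h r = a} = π.prob h a
  sampleMeas : Hist A Z → A → ℝ → Z
  sampleMeas_measurable : ∀ (n : ℕ) (a : A),
    Measurable fun p : (Fin n → A × Z) × ℝ => sampleMeas (List.ofFn p.1) a p.2
  sampleMeas_law : ∀ h a, IsProbabilityMeasure (M.predict h a) →
    unif.map (sampleMeas h a) = M.predict h a

end PolicyLaws

section Tree

/-- The probability of creating a new measurement branch at a belief-action node that has `c`
branches. -/
def spawnProb (εz : ℝ) (c : ℕ) : ℝ := ((c : ℝ) + 1) ^ εz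

variable {A : Type*}

/-- The number of measurement branches of the belief-action node `(w, a)` after `m` visits of it,
when the random number generator returns `u`. -/
def branches (εz : ℝ) (u : Call A → ℝ) (w : Node A) (a : A) : ℕ → ℕ
  | 0 => 0
  | m + 1 =>
    if u (.spawn w a m) < spawnProb εz (branches εz u w a m) then branches εz u w a m + 1
    else branches εz u w a m

/-- The existing branch that is followed at the `m`-th visit of the belief-action node `(w, a)`:
uniformly chosen among the existing ones; `none` if a new branch is created at this visit. -/
def picked (εz : ℝ) (u : Call A → ℝ) (w : Node A) (a : A) (m : ℕ) : Option ℕ :=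
  if u (.spawn w a m) < spawnProb εz (branches εz u w a m) then none
  else some ⌊u (.pick w a m) * (branches εz u w a m : ℝ)⌋₊

variable {X Z : Type*} [MeasurableSpace X] [Fintype A] [DecidableEq A] [MeasurableSpace A]
  [MeasurableSpace Z] {M : POMDP X A Z} {π : Policy A Z}

/-- The history of actions and measurements that leads to the belief node `w`. -/
def Sampler.hist (S : Sampler M π) (u : Call A → ℝ) : Node A → Hist A Z
  | [] => []
  | (a, j) :: w => (a, S.sampleMeas (S.hist u w) a (u (.meas w a j))) :: S.hist u w

/-- How often the action `a` is selected during the first `v` visits of the belief node `w`. -/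
def Sampler.actionVisits (S : Sampler M π) (u : Call A → ℝ) (w : Node A) (a : A) (v : ℕ) : ℕ :=
  ((Finset.range v).filter fun k => S.selectAction (S.hist u w) (u (.action w k)) = a).card

/-- The number of simulation episodes, among the first `N`, that passed through the belief node
`w` and went on below it (the episode that creates a node ends there with a rollout). -/
def Sampler.visits (S : Sampler M π) (εz : ℝ) (u : Call A → ℝ) : Node A → ℕ → ℕ
  | [], N => N
  | (a, j) :: w, N =>
    ((Finset.range (S.actionVisits u w a (S.visits εz u w N))).filter
      fun k => picked εz u w a k = some j).card

/-- `|C(ha)|` after `N` simulation episodes. -/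
def Sampler.children (S : Sampler M π) (εz : ℝ) (u : Call A → ℝ) (N : ℕ) (w : Node A) (a : A) :
    ℕ :=
  branches εz u w a (S.actionVisits u w a (S.visits εz u w N))

/-- The law of the remaining `T` steps of an episode that enters its rollout phase at `h`. -/
def Rollout.law (ρ : Rollout A Z) (h : Hist A Z) (T : ℕ) : Measure (Steps A Z T) :=
  ∑ v : Fin T → A, (ρ.prob h T v : ℝ≥0∞) • Measure.dirac fun i => (v i, Sum.inr ())

/-- `p_𝒯(A_t, Z_t)`: the law of the actions and measurements over the `T` steps below the belief
node `w` of an episode that is run on the search tree `𝒯` produced by the first `N` episodes.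
Actions follow the policy; at a belief-action node with `c` branches a new measurement is sampled
with probability `(c + 1) ^ εz`, after which the rollout policy takes over, and otherwise one of
the `c` existing branches is followed, each with the same probability. -/
def Sampler.treeLaw (S : Sampler M π) (ρ : Rollout A Z) (εz : ℝ) (u : Call A → ℝ) (N : ℕ) :
    (T : ℕ) → Node A → Measure (Steps A Z T)
  | 0, _ => Measure.dirac Fin.elim0
  | T + 1, w => ∑ a, (π.prob (S.hist u w) a : ℝ≥0∞) •
      (ENNReal.ofReal (spawnProb εz (S.children εz u N w a)) •
          ((M.predict (S.hist u w) a).bind fun z =>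
            (ρ.law ((a, z) :: S.hist u w) T).map
              fun e : Steps A Z T => (Fin.cons (a, Sum.inl z) e : Steps A Z (T + 1)))
        + ENNReal.ofReal ((1 - spawnProb εz (S.children εz u N w a)) / S.children εz u N w a) •
          ∑ j ∈ Finset.range (S.children εz u N w a),
            (S.treeLaw ρ εz u N T ((a, j) :: w)).map
              fun e : Steps A Z T =>
                (Fin.cons (a, Sum.inl (S.sampleMeas (S.hist u w) a (u (.meas w a j)))) e :
                  Steps A Z (T + 1)))

end Tree

end POMCPpp

end

/-! Two questions are separated: what the tree does to the law of an episode, and what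
self-normalised importance sampling does for a given action-measurement sequence.

Tree. Actions have positive probability, so a node that is visited infinitely often tries each
action infinitely often, and its branch counts then grow without bound. With `c` branches and spawn
probability `p = (c+1)^εz`, a given branch is missed until the next spawn with probability
`pc/(pc+1-p)`, which is at most `1 - const * c^(-(1+εz))`. Over a window of branch counts of length
proportional to `c` the missing probability is at most `exp(-const * c^(-εz))`, which is summable.
Borel-Cantelli then shows that every branch is picked infinitely often and that, for each `V`, the
fraction of branches picked fewer than `V` times tends to zero (`ae_tendsto_pickCount`,
`ae_tendsto_rarely_picked`).

For a fixed bounded measurable `f`, convergence of its expectation under the tree follows by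
induction on the horizon (`Sampler.ae_tendsto_treeInt`). Rollouts disappear because the spawn
probability tends to zero. What remains is an average over branches; each branch carries an
independent measurement from the true predictive law and an independent copy of the whole random
tree. Replacing the error of a subtree by its supremum over all visit counts from `V` on gives
i.i.d. bounded quantities, whose averages converge by the strong law, with a limit that vanishes as
`V` grows. Rarely picked branches are negligible, so no independence between visit counts and
subtrees is needed. The history at a node is independent of the random numbers below it, which
carries the result from the root to every node (`Sampler.ae_of_forall_hist`).

Estimate. The law of actions and measurements under the policy has density (policy weight) times
(evidence), so for almost every sequence the evidence is positive and finite. There the ratio of two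
strong laws gives the posterior mean of the return, and the average of posterior means is the value
(`POMDP.value_eq_integral_postMean`).

Joint limit. The supremum over `K ≥ K₀` of the estimation error is one bounded measurable function,
to which the tree theorem applies; its integral under the policy law is small for large `K₀`. This
makes the error uniform in `K`. The infinite-horizon claim is a geometric series. -/

noncomputable section

namespace POMCPpp

/-! ### Measurable families of measures of mass at most one. -/

section MeasureTools

variable {Y W V : Type*} [MeasurableSpace Y] [MeasurableSpace W] [MeasurableSpace V]

/-- A measurable family of measures of total mass at most one. -/
structure SubMarkov (κ : Y → Measure W) : Prop where
  measurable : Measurable κ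
  mass_le : ∀ y, κ y Set.univ ≤ 1

namespace SubMarkov

variable {κ : Y → Measure W}

lemma isFinite (h : SubMarkov κ) (y : Y) : IsFiniteMeasure (κ y) :=
  ⟨(h.mass_le y).trans_lt ENNReal.one_lt_top⟩

/-- The corresponding finite kernel. -/
def toKernel (h : SubMarkov κ) : Kernel Y W := ⟨κ, h.measurable⟩

lemma isFiniteKernel (h : SubMarkov κ) : IsFiniteKernel h.toKernel :=
  ⟨1, ENNReal.one_lt_top, h.mass_le⟩

lemma comp (h : SubMarkov κ) {g : V → Y} (hg : Measurable g) : SubMarkov fun v => κ (g v) :=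
  ⟨h.measurable.comp hg, fun v => h.mass_le (g v)⟩

lemma measurable_lintegral (h : SubMarkov κ) {f : Y → W → ℝ≥0∞}
    (hf : Measurable (Function.uncurry f)) : Measurable fun y => ∫⁻ w, f y w ∂κ y := by
  have := h.isFiniteKernel
  exact Measurable.lintegral_kernel_prod_right (κ := h.toKernel) hf

lemma measurable_integral (h : SubMarkov κ) {f : Y → W → ℝ}
    (hf : Measurable (Function.uncurry f)) : Measurable fun y => ∫ w, f y w ∂κ y := by
  have := h.isFiniteKernel
  exact (StronglyMeasurable.integral_kernel_prod_right (κ := h.toKernel)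
    hf.stronglyMeasurable).measurable

lemma of_kernel (κ : Kernel Y W) [IsMarkovKernel κ] : SubMarkov fun y => κ y :=
  ⟨κ.measurable, fun _ => prob_le_one⟩

lemma dirac {g : Y → W} (hg : Measurable g) : SubMarkov fun y => Measure.dirac (g y) :=
  ⟨Measure.measurable_dirac.comp hg, fun _ => prob_le_one⟩

lemma bind (h : SubMarkov κ) {η : Y → W → Measure V}
    (hη : SubMarkov fun p : Y × W => η p.1 p.2) : SubMarkov fun y => (κ y).bind (η y) := by
  have hm : ∀ y, Measurable (η y) := fun y => hη.measurable.comp measurable_prodMk_left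
  have key : ∀ y s, MeasurableSet s → (κ y).bind (η y) s = ∫⁻ w, η y w s ∂κ y :=
    fun y s hs => Measure.bind_apply hs (hm y).aemeasurable
  refine ⟨Measure.measurable_of_measurable_coe _ fun s hs => ?_, fun y => ?_⟩
  · simp_rw [key _ s hs]
    exact h.measurable_lintegral ((Measure.measurable_coe hs).comp hη.measurable)
  · rw [key _ _ MeasurableSet.univ]
    calc ∫⁻ w, η y w Set.univ ∂κ y ≤ ∫⁻ _, 1 ∂κ y := lintegral_mono fun w => hη.mass_le (y, w)
      _ ≤ 1 := by simpa using h.mass_le y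

lemma map (h : SubMarkov κ) {g : Y → W → V} (hg : Measurable (Function.uncurry g)) :
    SubMarkov fun y => (κ y).map (g y) := by
  have : ∀ y, (κ y).map (g y) = (κ y).bind fun w => Measure.dirac (g y w) := fun y =>
    (Measure.bind_dirac_eq_map (κ y) (hg.comp measurable_prodMk_left)).symm
  simp_rw [this]
  exact h.bind (dirac hg)

lemma weighted_sum {ι : Type*} [Fintype ι] {κ : ι → Y → Measure W} (h : ∀ i, SubMarkov (κ i))
    {c : ι → Y → ℝ≥0} (hc : ∀ i, Measurable (c i)) (hs : ∀ y, ∑ i, c i y ≤ 1) :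
    SubMarkov fun y => ∑ i, (c i y : ℝ≥0∞) • κ i y := by
  refine ⟨Measure.measurable_of_measurable_coe _ fun s hs => ?_, fun y => ?_⟩
  · simp only [Measure.coe_finsetSum, Finset.sum_apply, Measure.smul_apply, smul_eq_mul]
    exact Finset.measurable_sum _ fun i _ =>
      (hc i).coe_nnreal_ennreal.mul ((Measure.measurable_coe hs).comp (h i).measurable)
  · simp only [Measure.coe_finsetSum, Finset.sum_apply, Measure.smul_apply, smul_eq_mul]
    calc ∑ i, (c i y : ℝ≥0∞) * κ i y Set.univ ≤ ∑ i, (c i y : ℝ≥0∞) * 1 := by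
          gcongr with i
          exact (h i).mass_le y
      _ ≤ 1 := by simpa using mod_cast hs y

/-- On boxes the product measure is a finite product of measurable functions of the parameter, and
boxes form a generating π-system. -/
lemma pi (h : SubMarkov κ) (K : ℕ) : SubMarkov fun y => Measure.pi fun _ : Fin K => κ y := by
  have := h.isFinite
  have hpi : ∀ y (t : Fin K → Set W), Measure.pi (fun _ : Fin K => κ y) (Set.univ.pi t) =
      ∏ i, κ y (t i) := fun y t => Measure.pi_pi _ _
  have huniv : ∀ y, Measure.pi (fun _ : Fin K => κ y) Set.univ = ∏ _i : Fin K, κ y Set.univ := by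
    intro y
    rw [← hpi, Set.pi_univ]
  refine ⟨Measurable.measure_of_isPiSystem generateFrom_pi.symm isPiSystem_pi ?_ ?_, fun y => ?_⟩
  · rintro _ ⟨t, ht, rfl⟩
    simp_rw [hpi]
    exact Finset.measurable_prod _ fun i _ =>
      (Measure.measurable_coe (ht i (Set.mem_univ i))).comp h.measurable
  · simp_rw [huniv]
    exact Finset.measurable_prod _ fun i _ =>
      (Measure.measurable_coe MeasurableSet.univ).comp h.measurable
  · rw [huniv]
    exact Finset.prod_le_one (fun _ _ => zero_le) fun _ _ => h.mass_le y

end SubMarkov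

lemma integrable_of_abs_le {μ : Measure W} [IsFiniteMeasure μ] {f : W → ℝ} (hf : Measurable f)
    {B : ℝ} (hB : ∀ w, |f w| ≤ B) : Integrable f μ :=
  Integrable.of_bound hf.aestronglyMeasurable B (ae_of_all _ fun w => hB w)

lemma abs_integral_le_of_abs_le {μ : Measure W} (hμ : μ Set.univ ≤ 1) {f : W → ℝ}
    {B : ℝ} (hB0 : 0 ≤ B) (hB : ∀ w, |f w| ≤ B) : |∫ w, f w ∂μ| ≤ B := by
  have : IsFiniteMeasure μ := ⟨hμ.trans_lt ENNReal.one_lt_top⟩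
  have h1 := norm_integral_le_of_norm_le_const (μ := μ) (f := f) (C := B) (ae_of_all _ fun w => hB w)
  refine h1.trans (mul_le_of_le_one_right hB0 ?_)
  exact ENNReal.toReal_le_of_le_ofReal zero_le_one (by simpa using hμ)

lemma integral_bind_of_integrable {μ : Measure W} {κ : W → Measure V} (hκ : Measurable κ)
    {f : V → ℝ} (hf : Integrable f (μ.bind κ)) :
    ∫ v, f v ∂(μ.bind κ) = ∫ w, ∫ v, f v ∂κ w ∂μ :=
  Kernel.integral_comp (η := ⟨κ, hκ⟩) (κ := Kernel.const Unit μ) (a := ()) hf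

lemma bind_univ_of_prob {μ : Measure W} [IsProbabilityMeasure μ] {κ : W → Measure V}
    (hκ : Measurable κ) (h : ∀ᵐ w ∂μ, IsProbabilityMeasure (κ w)) :
    IsProbabilityMeasure (μ.bind κ) := by
  refine ⟨?_⟩
  rw [Measure.bind_apply MeasurableSet.univ hκ.aemeasurable]
  have : ∫⁻ w, κ w Set.univ ∂μ = ∫⁻ _, 1 ∂μ := lintegral_congr_ae (h.mono fun w hw => hw.measure_univ)
  simp [this]

end MeasureTools

attribute [instance] POMDP.trans_markov POMDP.ref_sigmaFinite POMDP.b0_prob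

/-! ### Bayes filter: measurability, predictive density and Bayes' rule. -/

section Beliefs

variable {X A Z : Type*} [MeasurableSpace X] [MeasurableSpace A] [MeasurableSpace Z]
variable {Y : Type*} [MeasurableSpace Y] (M : POMDP X A Z)

lemma POMDP.measurable_obs {f : Y → X} {g : Y → Z} (hf : Measurable f) (hg : Measurable g) :
    Measurable fun y => M.obs (f y) (g y) :=
  M.obs_measurable.comp (hf.prodMk hg)

lemma POMDP.measLaw_prob (x : X) : IsProbabilityMeasure (M.measLaw x) :=
  ⟨by simp [POMDP.measLaw, M.obs_density]⟩

lemma POMDP.measLaw_subMarkov : SubMarkov M.measLaw := by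
  refine ⟨Measure.measurable_of_measurable_coe _ fun s hs => ?_, fun x => ?_⟩
  · simp only [POMDP.measLaw, withDensity_apply _ hs]
    exact Measurable.lintegral_prod_right
      (M.measurable_obs measurable_fst measurable_snd).coe_nnreal_ennreal
  · exact (M.measLaw_prob x).measure_univ.le

lemma POMDP.trans_subMarkov : SubMarkov fun p : X × A => M.trans p := SubMarkov.of_kernel _

variable {M}

lemma SubMarkov.bind_trans {κ : Y → Measure X} (h : SubMarkov κ) {a : Y → A}
    (ha : Measurable a) : SubMarkov fun y => (κ y).bind fun x => M.trans (x, a y) :=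
  h.bind (η := fun y x => M.trans (x, a y))
    (M.trans_subMarkov.comp (measurable_snd.prodMk (ha.comp measurable_fst)))

/-- Normalisation by an inverse in `ℝ≥0∞` yields mass 1, or mass 0 when the unnormalised mass is 0
or `∞`. Hence the posterior is a measurable family everywhere, without removing an exceptional set
of measurements. -/
lemma SubMarkov.update {κ : Y → Measure X} (h : SubMarkov κ) {a : Y → A} {z : Y → Z}
    (ha : Measurable a) (hz : Measurable z) : SubMarkov fun y => M.update (κ y) (a y) (z y) := by
  have hν := h.bind_trans (M := M) ha
  have hd : ∀ y, Measurable fun x => (M.obs x (z y) : ℝ≥0∞) := fun y =>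
    (M.measurable_obs measurable_id measurable_const).coe_nnreal_ennreal
  have hm : ∀ s, MeasurableSet s → Measurable fun y =>
      (((κ y).bind fun x => M.trans (x, a y)).withDensity fun x' => (M.obs x' (z y) : ℝ≥0∞)) s := by
    intro s hs
    simp_rw [withDensity_apply _ hs, ← lintegral_indicator hs]
    refine hν.measurable_lintegral
      (f := fun y => s.indicator fun x' => (M.obs x' (z y) : ℝ≥0∞)) ?_
    have : Function.uncurry (fun y => s.indicator fun x' => (M.obs x' (z y) : ℝ≥0∞)) =
        (Prod.snd ⁻¹' s).indicator fun p : Y × X => (M.obs p.2 (z p.1) : ℝ≥0∞) := by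
      rfl
    rw [this]
    exact ((M.measurable_obs measurable_snd (hz.comp measurable_fst)).coe_nnreal_ennreal).indicator
      (measurable_snd hs)
  refine ⟨Measure.measurable_of_measurable_coe _ fun s hs => ?_, fun y => ?_⟩
  · simp only [POMDP.update, Measure.smul_apply, smul_eq_mul]
    exact (hm _ MeasurableSet.univ).inv.mul (hm s hs)
  · simp only [POMDP.update, Measure.smul_apply, smul_eq_mul]
    exact ENNReal.inv_mul_le_one _

variable (M)

/-- Histories are lists, so measurability is formulated separately for each length `n`, on tuples.
All later measurability statements in the history have this form. -/
lemma POMDP.belief_subMarkov (n : ℕ) :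
    SubMarkov fun s : Fin n → A × Z => M.belief (List.ofFn s) := by
  induction n with
  | zero =>
    simp only [List.ofFn_zero, POMDP.belief]
    exact ⟨measurable_const, fun _ => prob_le_one⟩
  | succ n ih =>
    simp only [List.ofFn_succ]
    exact (ih.comp (g := fun (s : Fin (n + 1) → A × Z) i => s i.succ) (by fun_prop)).update
      (a := fun s => (s 0).1) (z := fun s => (s 0).2) (by fun_prop) (by fun_prop)

lemma POMDP.belief_mass_le (h : Hist A Z) : M.belief h Set.univ ≤ 1 := by
  have := (M.belief_subMarkov h.length).mass_le h.get
  rwa [List.ofFn_get] at this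

lemma POMDP.belief_isFinite (h : Hist A Z) : IsFiniteMeasure (M.belief h) :=
  ⟨(M.belief_mass_le h).trans_lt ENNReal.one_lt_top⟩

lemma POMDP.predict_subMarkov (n : ℕ) :
    SubMarkov fun p : (Fin n → A × Z) × A => M.predict (List.ofFn p.1) p.2 :=
  (((M.belief_subMarkov n).comp measurable_fst).bind_trans measurable_snd).bind
    (M.measLaw_subMarkov.comp measurable_snd)

lemma POMDP.predict_mass_le (h : Hist A Z) (a : A) : M.predict h a Set.univ ≤ 1 := by
  have := (M.predict_subMarkov h.length).mass_le (h.get, a)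
  rwa [List.ofFn_get] at this

lemma POMDP.trans_section_measurable (a : A) : Measurable fun x => M.trans (x, a) :=
  M.trans.measurable.comp measurable_prodMk_right

lemma POMDP.predict_prob (h : Hist A Z) (a : A) (hh : IsProbabilityMeasure (M.belief h)) :
    IsProbabilityMeasure (M.predict h a) := by
  have : IsProbabilityMeasure ((M.belief h).bind fun x => M.trans (x, a)) :=
    bind_univ_of_prob (M.trans_section_measurable a) (ae_of_all _ fun _ => inferInstance)
  exact bind_univ_of_prob M.measLaw_subMarkov.measurable (ae_of_all _ M.measLaw_prob)

/-- The density of the law of the next measurement. -/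
def POMDP.predictDensity (h : Hist A Z) (a : A) (z : Z) : ℝ≥0∞ :=
  ∫⁻ x', M.obs x' z ∂((M.belief h).bind fun x => M.trans (x, a))

lemma POMDP.bind_trans_isFinite (h : Hist A Z) (a : A) :
    IsFiniteMeasure ((M.belief h).bind fun x => M.trans (x, a)) :=
  (SubMarkov.bind_trans (M := M) (κ := fun _ : Unit => M.belief h)
      ⟨measurable_const, fun _ => M.belief_mass_le h⟩ (a := fun _ => a) measurable_const).isFinite ()

lemma POMDP.measurable_predictDensity (h : Hist A Z) (a : A) :
    Measurable (M.predictDensity h a) := by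
  have := M.bind_trans_isFinite h a
  exact Measurable.lintegral_prod_right
    (M.measurable_obs measurable_snd measurable_fst).coe_nnreal_ennreal

lemma POMDP.lintegral_measLaw (x : X) {f : Z → ℝ≥0∞} (hf : Measurable f) :
    ∫⁻ z, f z ∂(M.measLaw x) = ∫⁻ z, M.obs x z * f z ∂M.ref := by
  have hm : Measurable fun z => (M.obs x z : ℝ≥0∞) :=
    (M.measurable_obs measurable_const measurable_id).coe_nnreal_ennreal
  rw [POMDP.measLaw, lintegral_withDensity_eq_lintegral_mul _ hm hf]
  rfl

lemma POMDP.lintegral_predict (h : Hist A Z) (a : A) {f : Z → ℝ≥0∞} (hf : Measurable f) :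
    ∫⁻ z, f z ∂(M.predict h a) = ∫⁻ z, M.predictDensity h a z * f z ∂M.ref := by
  have := M.bind_trans_isFinite h a
  rw [POMDP.predict, Measure.lintegral_bind M.measLaw_subMarkov.measurable.aemeasurable
    hf.aemeasurable]
  simp_rw [M.lintegral_measLaw _ hf]
  rw [lintegral_lintegral_swap]
  · refine lintegral_congr fun z => ?_
    rw [POMDP.predictDensity, lintegral_mul_const]
    exact (M.measurable_obs measurable_id measurable_const).coe_nnreal_ennreal
  · exact ((M.measurable_obs measurable_fst measurable_snd).coe_nnreal_ennreal.mul
      (hf.comp measurable_snd)).aemeasurable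

lemma POMDP.predictDensity_ae (h : Hist A Z) (a : A) (hh : IsProbabilityMeasure (M.belief h)) :
    ∀ᵐ z ∂M.ref, M.predictDensity h a z < ∞ := by
  have := M.predict_prob h a hh
  refine ae_lt_top (M.measurable_predictDensity h a) ?_
  have h1 := M.lintegral_predict h a (f := fun _ => 1) measurable_const
  simp only [lintegral_const, measure_univ, mul_one] at h1
  simp [← h1]

lemma POMDP.update_univ (h : Hist A Z) (a : A) (z : Z) :
    M.belief ((a, z) :: h) Set.univ = (M.predictDensity h a z)⁻¹ * M.predictDensity h a z := by
  simp [POMDP.belief, POMDP.update, POMDP.predictDensity]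

/-- After almost every measurement the posterior is a probability measure. -/
lemma POMDP.belief_cons_prob (h : Hist A Z) (a : A) (hh : IsProbabilityMeasure (M.belief h)) :
    ∀ᵐ z ∂(M.predict h a), IsProbabilityMeasure (M.belief ((a, z) :: h)) := by
  have hs : MeasurableSet {z | ¬ (M.predictDensity h a z ≠ 0 ∧ M.predictDensity h a z < ∞)} := by
    have := M.measurable_predictDensity h a
    refine (MeasurableSet.inter ?_ ?_).compl
    · exact (this (measurableSet_singleton 0)).compl
    · exact this measurableSet_Iio
  have : ∀ᵐ z ∂(M.predict h a), M.predictDensity h a z ≠ 0 ∧ M.predictDensity h a z < ∞ := by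
    -- Since `predictDensity` is the density of the measurement law, the set where it vanishes
    -- carries no mass, and the set where it is infinite is already null for the reference measure.
    rw [ae_iff, ← lintegral_indicator_one hs, M.lintegral_predict h a (measurable_one.indicator hs)]
    rw [← lintegral_zero (μ := M.ref)]
    refine lintegral_congr_ae ?_
    filter_upwards [M.predictDensity_ae h a hh] with z hz
    by_cases h0 : M.predictDensity h a z = 0 <;> simp [h0, hz.ne]
  refine this.mono fun z hz => ⟨?_⟩
  rw [M.update_univ]
  exact ENNReal.inv_mul_cancel hz.1 hz.2.ne

/-- Bayes' rule: the next state and measurement can be sampled in the reverse order. -/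
lemma POMDP.lintegral_predict_belief (h : Hist A Z) (a : A)
    (hh : IsProbabilityMeasure (M.belief h)) {F : X → Z → ℝ≥0∞}
    (hF : Measurable (Function.uncurry F)) :
    ∫⁻ z, ∫⁻ x', F x' z ∂(M.belief ((a, z) :: h)) ∂(M.predict h a) =
      ∫⁻ x', ∫⁻ z, F x' z ∂(M.measLaw x') ∂((M.belief h).bind fun x => M.trans (x, a)) := by
  have := M.bind_trans_isFinite h a
  have hobs : Measurable fun p : X × Z => (M.obs p.1 p.2 : ℝ≥0∞) :=
    (M.measurable_obs measurable_fst measurable_snd).coe_nnreal_ennreal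
  have hF1 : ∀ z, Measurable fun x => F x z := fun z => hF.comp measurable_prodMk_right
  have hF2 : ∀ x, Measurable fun z => F x z := fun z => hF.comp measurable_prodMk_left
  have hb : SubMarkov fun z => M.belief ((a, z) :: h) := by
    have := (M.belief_subMarkov (h.length + 1)).comp
      (g := fun z : Z => (Fin.cons (a, z) h.get : Fin (h.length + 1) → A × Z))
      (by
        refine measurable_pi_lambda _ fun i => ?_
        refine Fin.cases ?_ (fun j => ?_) i
        · exact measurable_const.prodMk measurable_id
        · exact measurable_const)
    simpa [List.ofFn_succ] using this
  rw [M.lintegral_predict h a (hb.measurable_lintegral (f := fun z x' => F x' z)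
    (hF.comp measurable_swap))]
  simp_rw [M.lintegral_measLaw _ (hF2 _)]
  rw [lintegral_lintegral_swap (hobs.mul hF).aemeasurable]
  refine lintegral_congr_ae ?_
  filter_upwards [M.predictDensity_ae h a hh] with z hz
  have hoz : Measurable fun x' => (M.obs x' z : ℝ≥0∞) := hobs.comp measurable_prodMk_right
  simp only [POMDP.belief, POMDP.update, lintegral_smul_measure, smul_eq_mul]
  rw [withDensity_apply _ MeasurableSet.univ, Measure.restrict_univ,
    lintegral_withDensity_eq_lintegral_mul _ hoz (hF1 z)]
  simp only [Pi.mul_apply]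
  change M.predictDensity h a z * ((M.predictDensity h a z)⁻¹ * _) = _
  -- The density of the measurement cancels the normalising constant of the posterior. Where the
  -- density is zero the likelihood vanishes almost everywhere, so both sides are zero.
  by_cases h0 : M.predictDensity h a z = 0
  · rw [h0, zero_mul]
    have h1 : (fun x' => (M.obs x' z : ℝ≥0∞)) =ᵐ[(M.belief h).bind fun x => M.trans (x, a)] 0 :=
      (lintegral_eq_zero_iff hoz).1 h0
    rw [← lintegral_zero (μ := (M.belief h).bind fun x => M.trans (x, a))]
    refine lintegral_congr_ae (h1.mono fun x hx => ?_)
    simp only [Pi.zero_apply] at hx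
    simp [hx]
  · rw [← mul_assoc, ENNReal.mul_inv_cancel h0 hz.ne, one_mul]

end Beliefs

/-! ### Uniform random numbers and resampling of one coordinate. -/

section Uniform

instance unif_isProbabilityMeasure : IsProbabilityMeasure unif :=
  ⟨by simp [unif]⟩

lemma unif_real_Iio {p : ℝ} (h0 : 0 ≤ p) (h1 : p ≤ 1) : unif.real (Set.Iio p) = p := by
  have : Set.Iio p ∩ Set.Ico 0 1 = Set.Ico 0 p := by
    ext x
    simp only [Set.mem_inter_iff, Set.mem_Iio, Set.mem_Ico]
    constructor
    · rintro ⟨h, h', -⟩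
      exact ⟨h', h⟩
    · rintro ⟨h, h'⟩
      exact ⟨h', h, h'.trans_le h1⟩
  rw [unif, measureReal_restrict_apply measurableSet_Iio, this]
  simp [h0]

lemma unif_real_floor {c j : ℕ} (hj : j < c) :
    unif.real {t : ℝ | ⌊t * c⌋₊ = j} = (c : ℝ)⁻¹ := by
  have hc : (0 : ℝ) < c := by exact_mod_cast (Nat.zero_le j).trans_lt hj
  have hjc : (j : ℝ) + 1 ≤ c := by exact_mod_cast hj
  have : {t : ℝ | ⌊t * c⌋₊ = j} ∩ Set.Ico 0 1 = Set.Ico ((j : ℝ) / c) ((j + 1) / c) := by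
    ext x
    simp only [Set.mem_inter_iff, Set.mem_ofPred_eq, Set.mem_Ico]
    rw [div_le_iff₀ hc, lt_div_iff₀ hc]
    constructor
    · rintro ⟨h, h', -⟩
      rwa [Nat.floor_eq_iff (by positivity)] at h
    · rintro ⟨h, h'⟩
      have hx : 0 ≤ x := by
        by_contra! hx
        have := mul_neg_of_neg_of_pos hx hc
        have := (Nat.cast_nonneg (α := ℝ) j)
        linarith
      refine ⟨(Nat.floor_eq_iff (by positivity)).2 ⟨h, h'⟩, hx, ?_⟩
      by_contra! h1
      nlinarith
  rw [unif, measureReal_restrict_apply (measurableSet_eq_fun (by fun_prop) measurable_const), this]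
  rw [Real.volume_real_Ico_of_le (by gcongr; linarith)]
  field_simp
  ring

lemma integral_ite_const {α : Type*} [MeasurableSpace α] (μ : Measure α) [IsProbabilityMeasure μ]
    {s : Set α} (hs : MeasurableSet s) [DecidablePred (· ∈ s)] (x y : ℝ) :
    ∫ a, (if a ∈ s then x else y) ∂μ = μ.real s * x + (1 - μ.real s) * y := by
  have : (fun a => if a ∈ s then x else y) = fun a => s.indicator (fun _ => x - y) a + y := by
    ext a
    by_cases h : a ∈ s <;> simp [h]
  rw [this, integral_add ((integrable_const _).indicator hs) (integrable_const _),
    integral_indicator_const _ hs]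
  simp
  ring

/-- Resampling one coordinate does not change a product measure. -/
lemma infinitePi_map_update {ι E : Type*} [DecidableEq ι] [MeasurableSpace E] (μ : Measure E)
    [IsProbabilityMeasure μ] (i : ι) :
    ((Measure.infinitePi fun _ : ι => μ).prod μ).map (fun p => Function.update p.1 i p.2) =
      Measure.infinitePi fun _ : ι => μ := by
  have hm : Measurable fun p : (ι → E) × E => Function.update p.1 i p.2 := by
    refine measurable_pi_lambda _ fun k => ?_
    by_cases hk : k = i
    · subst hk
      simpa using measurable_snd
    · simp only [Function.update_of_ne hk]
      fun_prop
  refine Measure.eq_infinitePi _ fun s t ht => ?_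
  have hpre : (fun p : (ι → E) × E => Function.update p.1 i p.2) ⁻¹' (Set.pi s t) =
      (Set.pi (s.erase i) t) ×ˢ (if i ∈ s then t i else Set.univ) := by
    ext ⟨u, r⟩
    simp only [Set.mem_preimage, Set.mem_pi, Set.mem_prod, Finset.mem_coe, Finset.mem_erase]
    constructor
    · intro h
      refine ⟨fun k hk => by simpa [Function.update_of_ne hk.1] using h k hk.2, ?_⟩
      split_ifs with hi
      · simpa using h i hi
      · trivial
    · rintro ⟨h, hr⟩ k hk
      by_cases hki : k = i
      · subst hki
        simpa [hk] using hr
      · simpa [Function.update_of_ne hki] using h k ⟨hki, hk⟩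
  rw [Measure.map_apply hm (MeasurableSet.pi s.countable_toSet fun k _ => ht k), hpre,
    Measure.prod_prod, Measure.infinitePi_pi _ (fun k _ => ht k)]
  split_ifs with hi
  · rw [mul_comm, Finset.mul_prod_erase s (fun k => μ (t k)) hi]
  · rw [Finset.erase_eq_of_notMem hi]
    simp

/-- Integrating out a single coordinate first takes the place of a conditional expectation given all
the other random numbers. -/
lemma integral_infinitePi_update {ι E : Type*} [DecidableEq ι] [MeasurableSpace E] (μ : Measure E)
    [IsProbabilityMeasure μ] (i : ι) {f : (ι → E) → ℝ} (hf : Measurable f) {B : ℝ}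
    (hB : ∀ u, |f u| ≤ B) :
    ∫ u, f u ∂(Measure.infinitePi fun _ : ι => μ) =
      ∫ u, ∫ r, f (Function.update u i r) ∂μ ∂(Measure.infinitePi fun _ : ι => μ) := by
  have hm : Measurable fun p : (ι → E) × E => Function.update p.1 i p.2 := by
    refine measurable_pi_lambda _ fun k => ?_
    by_cases hk : k = i
    · subst hk
      simpa using measurable_snd
    · simp only [Function.update_of_ne hk]
      fun_prop
  conv_lhs => rw [← infinitePi_map_update μ i]
  rw [integral_map hm.aemeasurable hf.aestronglyMeasurable, integral_prod]
  exact integrable_of_abs_le (hf.comp hm) fun _ => hB _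

end Uniform

/-! ### The probability that a branch is missed while new branches are spawned. -/

section Branching

variable {A : Type*}

/-- The law of the random number generator. -/
abbrev callLaw (A : Type*) : Measure (Call A → ℝ) := Measure.infinitePi fun _ => unif

variable {εz : ℝ}

lemma spawnProb_pos (c : ℕ) : 0 < spawnProb εz c := by
  unfold spawnProb
  positivity

lemma spawnProb_le_one (h : εz < 0) (c : ℕ) : spawnProb εz c ≤ 1 :=
  Real.rpow_le_one_of_one_le_of_nonpos (by simp) h.le

lemma measurable_branches (w : Node A) (a : A) (m : ℕ) :
    Measurable fun u : Call A → ℝ => branches εz u w a m := by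
  induction m with
  | zero => exact measurable_const
  | succ m ih =>
    refine Measurable.ite (measurableSet_lt (measurable_pi_apply _) ?_) (ih.add_const 1) ih
    exact (measurable_from_nat (f := spawnProb εz)).comp ih

lemma measurableSet_picked (w : Node A) (a : A) (m j : ℕ) :
    MeasurableSet {u : Call A → ℝ | picked εz u w a m = some j} := by
  have h1 : MeasurableSet {u : Call A → ℝ |
      u (.spawn w a m) < spawnProb εz (branches εz u w a m)} :=
    measurableSet_lt (measurable_pi_apply _)
      ((measurable_from_nat (f := spawnProb εz)).comp (measurable_branches w a m))
  have h2 : MeasurableSet {u : Call A → ℝ |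
      ⌊u (.pick w a m) * (branches εz u w a m : ℝ)⌋₊ = j} :=
    measurableSet_eq_fun (Nat.measurable_floor.comp ((measurable_pi_apply _).mul
      ((measurable_from_nat (f := fun n : ℕ => (n : ℝ))).comp (measurable_branches w a m))))
      measurable_const
  convert h1.compl.inter h2 using 1
  ext u
  simp only [picked, Set.mem_ofPred_eq, Set.mem_inter_iff, Set.mem_compl_iff]
  split_ifs with h <;> simp [h]

lemma branches_mono (u : Call A → ℝ) (w : Node A) (a : A) : Monotone (branches εz u w a) :=
  monotone_nat_of_le_succ fun m => by
    simp only [branches]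
    split_ifs <;> simp

lemma branches_le_succ (u : Call A → ℝ) (w : Node A) (a : A) (m : ℕ) :
    branches εz u w a (m + 1) ≤ branches εz u w a m + 1 := by
  simp only [branches]
  split_ifs <;> simp

lemma branches_le (u : Call A → ℝ) (w : Node A) (a : A) (m : ℕ) : branches εz u w a m ≤ m := by
  induction m with
  | zero => rfl
  | succ m ih => exact (branches_le_succ u w a m).trans (Nat.succ_le_succ ih)

/-- The branch count is adapted: resampling the numbers of visit `m` leaves the process up to time
`m` unchanged. -/
lemma branches_congr {u u' : Call A → ℝ} {w : Node A} {a : A} {m : ℕ}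
    (h : ∀ k < m, u (.spawn w a k) = u' (.spawn w a k)) :
    branches εz u w a m = branches εz u' w a m := by
  induction m with
  | zero => rfl
  | succ m ih =>
    simp only [branches, ih fun k hk => h k (hk.trans m.lt_succ_self), h m m.lt_succ_self]

/-- The branch `j` is not picked during the first `m` visits while the number of branches is in
`[c₁, c₂)`. -/
def NotPicked (εz : ℝ) (w : Node A) (a : A) (j c₁ c₂ m : ℕ) (u : Call A → ℝ) : Prop :=
  ∀ k < m, c₁ ≤ branches εz u w a k → branches εz u w a k < c₂ → picked εz u w a k ≠ some j

lemma measurableSet_notPicked (w : Node A) (a : A) (j c₁ c₂ m : ℕ) :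
    MeasurableSet {u : Call A → ℝ | NotPicked εz w a j c₁ c₂ m u} := by
  unfold NotPicked
  have : {u : Call A → ℝ | ∀ k < m, c₁ ≤ branches εz u w a k → branches εz u w a k < c₂ →
      picked εz u w a k ≠ some j} = ⋂ k, ⋂ (_ : k < m),
      ({u | c₁ ≤ branches εz u w a k} ∩ {u | branches εz u w a k < c₂} ∩
        {u | picked εz u w a k = some j})ᶜ := by
    ext u
    simp only [Set.mem_ofPred_eq, Set.mem_iInter, Set.mem_compl_iff, Set.mem_inter_iff]
    exact forall₂_congr fun k _ => by tauto
  rw [this]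
  refine MeasurableSet.iInter fun k => MeasurableSet.iInter fun _ => (MeasurableSet.inter
    (MeasurableSet.inter ?_ ?_) (measurableSet_picked w a k j)).compl
  · exact measurableSet_le measurable_const (measurable_branches w a k)
  · exact measurableSet_lt (measurable_branches w a k) measurable_const

/-- The probability that no visit with `c` branches picks a given one of them. -/
def missProb (εz : ℝ) (c : ℕ) : ℝ :=
  spawnProb εz c * c / (spawnProb εz c * c + (1 - spawnProb εz c))

lemma missProb_nonneg (h : εz < 0) (c : ℕ) : 0 ≤ missProb εz c := by
  have := spawnProb_le_one h c
  have := (spawnProb_pos (εz := εz) c).le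
  unfold missProb
  apply div_nonneg
  · positivity
  · have : 0 ≤ spawnProb εz c * c := by positivity
    linarith

lemma missProb_le_one (h : εz < 0) (c : ℕ) : missProb εz c ≤ 1 := by
  have := spawnProb_le_one h c
  have := (spawnProb_pos (εz := εz) c).le
  have : 0 ≤ spawnProb εz c * c := by positivity
  unfold missProb
  apply div_le_one_of_le₀ <;> linarith

/-- The probability, starting with `c` branches, that a given branch is not picked while the
number of branches is in `[c₁, c₂)`. -/
def missBound (εz : ℝ) (c₁ c₂ c : ℕ) : ℝ := ∏ i ∈ Finset.Ico (max c c₁) c₂, missProb εz i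

lemma missBound_nonneg (h : εz < 0) (c₁ c₂ c : ℕ) : 0 ≤ missBound εz c₁ c₂ c :=
  Finset.prod_nonneg fun i _ => missProb_nonneg h i

lemma missBound_le_one (h : εz < 0) (c₁ c₂ c : ℕ) : missBound εz c₁ c₂ c ≤ 1 :=
  Finset.prod_le_one (fun i _ => missProb_nonneg h i) fun i _ => missProb_le_one h i

/-- Harmonicity of the missing probability: a visit with `c` branches spawns with probability `p`,
and otherwise avoids the given branch with probability `1 - 1/c`. Solving `q = p + (1-p)(1-1/c)q`
for `q` gives `missProb`. -/
lemma missBound_balance (h : εz < 0) {c₁ c₂ c : ℕ} (h0 : 1 ≤ c) (h1 : c₁ ≤ c) (h2 : c < c₂) :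
    spawnProb εz c * missBound εz c₁ c₂ (c + 1) +
      (1 - spawnProb εz c) * ((1 - (c : ℝ)⁻¹) * missBound εz c₁ c₂ c) =
      missBound εz c₁ c₂ c := by
  have hr : missBound εz c₁ c₂ c = missProb εz c * missBound εz c₁ c₂ (c + 1) := by
    rw [missBound, missBound, max_eq_left h1, max_eq_left (h1.trans c.le_succ),
      Finset.prod_eq_prod_Ico_succ_bot h2]
  rw [hr, missProb]
  have hp := spawnProb_pos (εz := εz) c
  have hp1 := spawnProb_le_one h c
  have hc : (0 : ℝ) < c := by exact_mod_cast h0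
  have hd : 0 < spawnProb εz c * c + (1 - spawnProb εz c) := by
    have : 0 < spawnProb εz c * c := by positivity
    linarith
  field_simp
  ring

open Classical in
/-- A supermartingale that controls the probability of `NotPicked`. -/
def missPotential (εz : ℝ) (w : Node A) (a : A) (j c₁ c₂ m : ℕ) (u : Call A → ℝ) : ℝ :=
  if NotPicked εz w a j c₁ c₂ m u then missBound εz c₁ c₂ (branches εz u w a m) else 0

lemma missPotential_nonneg (h : εz < 0) (w : Node A) (a : A) (j c₁ c₂ m : ℕ) (u : Call A → ℝ) :
    0 ≤ missPotential εz w a j c₁ c₂ m u := by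
  unfold missPotential
  split_ifs
  exacts [missBound_nonneg h _ _ _, le_rfl]

lemma missPotential_le_one (h : εz < 0) (w : Node A) (a : A) (j c₁ c₂ m : ℕ) (u : Call A → ℝ) :
    missPotential εz w a j c₁ c₂ m u ≤ 1 := by
  unfold missPotential
  split_ifs
  exacts [missBound_le_one h _ _ _, zero_le_one]

lemma measurable_missPotential (w : Node A) (a : A) (j c₁ c₂ m : ℕ) :
    Measurable (missPotential εz w a j c₁ c₂ m) :=
  Measurable.ite (measurableSet_notPicked w a j c₁ c₂ m)
    ((measurable_from_nat (f := missBound εz c₁ c₂)).comp (measurable_branches w a m))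
    measurable_const

-- The supermartingale step: averaging over the spawn and pick numbers of visit `m` does not
-- increase the potential. Within `[c₁, c₂)` this is `missBound_balance`; below `c₁` a spawn leaves
-- `max c c₁` unchanged, and from `c₂` on the product is empty. The assumption `j < c₁` ensures that
-- branch `j` exists whenever its picks are counted, so that it is picked with probability `1/c`.
open Classical in
lemma integral_missPotential_update_le (h : εz < 0) (w : Node A) (a : A) {j c₁ c₂ : ℕ}
    (hj : j < c₁) (m : ℕ) (u : Call A → ℝ) :
    ∫ s, ∫ t, missPotential εz w a j c₁ c₂ (m + 1)
      (Function.update (Function.update u (.spawn w a m) s) (.pick w a m) t) ∂unif ∂unif ≤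
      missPotential εz w a j c₁ c₂ m u := by
  set u' : ℝ → ℝ → Call A → ℝ := fun s t =>
    Function.update (Function.update u (.spawn w a m) s) (.pick w a m) t with hu'
  have hspawn : ∀ s t k, k < m → u' s t (.spawn w a k) = u (.spawn w a k) := by
    intro s t k hk
    simp [u', hk.ne]
  have hpick : ∀ s t k, k < m → u' s t (.pick w a k) = u (.pick w a k) := by
    intro s t k hk
    simp [u', hk.ne]
  have hb : ∀ s t k, k ≤ m → branches εz (u' s t) w a k = branches εz u w a k := fun s t k hk =>
    branches_congr fun i hi => hspawn s t i (hi.trans_le hk)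
  have hp : ∀ s t k, k < m → picked εz (u' s t) w a k = picked εz u w a k := by
    intro s t k hk
    simp only [picked, hspawn s t k hk, hpick s t k hk, hb s t k hk.le]
  have hs : ∀ s t, u' s t (.spawn w a m) = s := by
    intro s t
    simp [u']
  have ht : ∀ s t, u' s t (.pick w a m) = t := by
    intro s t
    simp [u']
  have hnp : ∀ s t, NotPicked εz w a j c₁ c₂ (m + 1) (u' s t) →
      NotPicked εz w a j c₁ c₂ m u := by
    intro s t hn k hk h1 h2
    have := hn k (hk.trans m.lt_succ_self)
    rw [hb s t k hk.le, hp s t k hk] at this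
    exact this h1 h2
  set c := branches εz u w a m with hc
  have hbm : ∀ s t, branches εz (u' s t) w a (m + 1) =
      if s < spawnProb εz c then c + 1 else c := by
    intro s t
    simp only [branches, hs, hb s t m le_rfl]
    rfl
  have hconst : ∀ C : ℝ, 0 ≤ C → (∀ s t, missPotential εz w a j c₁ c₂ (m + 1) (u' s t) ≤ C) →
      ∫ s, ∫ t, missPotential εz w a j c₁ c₂ (m + 1) (u' s t) ∂unif ∂unif ≤ C := by
    intro C hC hle
    refine (le_abs_self _).trans (abs_integral_le_of_abs_le (by simp) hC fun s => ?_)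
    refine abs_integral_le_of_abs_le (by simp) hC fun t => ?_
    rw [abs_of_nonneg (missPotential_nonneg h _ _ _ _ _ _ _)]
    exact hle s t
  by_cases hn : NotPicked εz w a j c₁ c₂ m u
  swap
  · rw [missPotential, if_neg hn]
    refine hconst 0 le_rfl fun s t => ?_
    rw [missPotential, if_neg fun h' => hn (hnp s t h')]
  rw [show missPotential εz w a j c₁ c₂ m u = missBound εz c₁ c₂ c from if_pos hn]
  have hle : ∀ s t, missPotential εz w a j c₁ c₂ (m + 1) (u' s t) ≤
      missBound εz c₁ c₂ (if s < spawnProb εz c then c + 1 else c) := by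
    intro s t
    rw [missPotential, hbm]
    split_ifs
    exacts [le_rfl, le_rfl, missBound_nonneg h _ _ _, missBound_nonneg h _ _ _]
  rcases lt_or_ge c c₁ with hc1 | hc1
  · refine hconst _ (missBound_nonneg h _ _ _) fun s t => (hle s t).trans (le_of_eq ?_)
    unfold missBound
    congr 2
    split_ifs <;> omega
  rcases lt_or_ge c c₂ with hc2 | hc2
  swap
  · refine hconst _ (missBound_nonneg h _ _ _) fun s t => (hle s t).trans (le_of_eq ?_)
    unfold missBound
    rw [Finset.Ico_eq_empty (by split_ifs <;> omega), Finset.Ico_eq_empty (by omega)]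
  have hval : ∀ s t, missPotential εz w a j c₁ c₂ (m + 1) (u' s t) =
      if s ∈ Set.Iio (spawnProb εz c) then missBound εz c₁ c₂ (c + 1) else
        if t ∈ {t : ℝ | ⌊t * c⌋₊ = j} then 0 else missBound εz c₁ c₂ c := by
    intro s t
    have hpm : picked εz (u' s t) w a m =
        if s < spawnProb εz c then none else some ⌊t * c⌋₊ := by
      simp only [picked, hs, ht, hb s t m le_rfl]
      rfl
    have hiff : NotPicked εz w a j c₁ c₂ (m + 1) (u' s t) ↔
        picked εz (u' s t) w a m ≠ some j := by
      constructor
      · intro h'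
        refine h' m m.lt_succ_self ?_ ?_ <;> rw [hb s t m le_rfl] <;> assumption
      · intro h' k hk
        rcases Nat.lt_succ_iff_lt_or_eq.1 hk with hk | rfl
        · rw [hb s t k hk.le, hp s t k hk]
          exact hn k hk
        · exact fun _ _ => h'
    rw [missPotential, hbm]
    simp only [hiff, hpm, Set.mem_Iio, Set.mem_ofPred_eq]
    by_cases h1 : s < spawnProb εz c
    · simp [h1]
    · by_cases h2 : ⌊t * (c : ℝ)⌋₊ = j <;> simp [h1, h2]
  change ∫ s, ∫ t, missPotential εz w a j c₁ c₂ (m + 1) (u' s t) ∂unif ∂unif ≤ _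
  simp_rw [hval]
  have hfl : MeasurableSet {t : ℝ | ⌊t * (c : ℝ)⌋₊ = j} :=
    measurableSet_eq_fun (by fun_prop) measurable_const
  have hinner : ∀ s : ℝ, ∫ t, (if s ∈ Set.Iio (spawnProb εz c) then missBound εz c₁ c₂ (c + 1) else
        if t ∈ {t : ℝ | ⌊t * c⌋₊ = j} then 0 else missBound εz c₁ c₂ c) ∂unif =
      if s ∈ Set.Iio (spawnProb εz c) then missBound εz c₁ c₂ (c + 1) else
        (1 - (c : ℝ)⁻¹) * missBound εz c₁ c₂ c := by
    intro s
    split_ifs with h1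
    · simp
    · rw [integral_ite_const _ hfl, unif_real_floor (hj.trans_le hc1)]
      simp
  simp_rw [hinner]
  rw [integral_ite_const _ measurableSet_Iio,
    unif_real_Iio (spawnProb_pos c).le (spawnProb_le_one h c)]
  exact (missBound_balance h (by omega) hc1 hc2).le

/-- Iterates the supermartingale inequality. At time 0 there are no branches, so the potential is
the product over the full window. -/
lemma integral_missPotential_le (h : εz < 0) (w : Node A) (a : A) {j c₁ : ℕ} (c₂ : ℕ)
    (hj : j < c₁) (m : ℕ) :
    ∫ u, missPotential εz w a j c₁ c₂ m u ∂(callLaw A) ≤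
      ∏ i ∈ Finset.Ico c₁ c₂, missProb εz i := by
  classical
  have habs : ∀ m u, |missPotential εz w a j c₁ c₂ m u| ≤ 1 := fun m u => by
    rw [abs_of_nonneg (missPotential_nonneg h _ _ _ _ _ _ _)]
    exact missPotential_le_one h _ _ _ _ _ _ _
  induction m with
  | zero =>
    refine (le_abs_self _).trans (abs_integral_le_of_abs_le (by simp)
      (Finset.prod_nonneg fun i _ => missProb_nonneg h i) fun u => ?_)
    rw [abs_of_nonneg (missPotential_nonneg h _ _ _ _ _ _ _)]
    rw [missPotential, if_pos (show NotPicked εz w a j c₁ c₂ 0 u from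
      fun k hk => absurd hk (Nat.not_lt_zero k)), missBound]
    simp [branches]
  | succ m ih =>
    refine le_trans ?_ ih
    have hm := measurable_missPotential (εz := εz) w a j c₁ c₂ (m + 1)
    have hupd : ∀ i : Call A, Measurable fun p : (Call A → ℝ) × ℝ => Function.update p.1 i p.2 := by
      intro i
      refine measurable_pi_lambda _ fun k => ?_
      by_cases hk : k = i
      · subst hk
        simpa using measurable_snd
      · simp only [Function.update_of_ne hk]
        fun_prop
    have hm1 : Measurable fun u : Call A → ℝ => ∫ t, missPotential εz w a j c₁ c₂ (m + 1)
        (Function.update u (.pick w a m) t) ∂unif :=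
      (SubMarkov.measurable_integral (κ := fun _ : Call A → ℝ => unif)
        ⟨measurable_const, fun _ => prob_le_one⟩ (hm.comp (hupd _)))
    have hb1 : ∀ u : Call A → ℝ, |∫ t, missPotential εz w a j c₁ c₂ (m + 1)
        (Function.update u (.pick w a m) t) ∂unif| ≤ 1 := fun u =>
      abs_integral_le_of_abs_le (by simp) zero_le_one fun t => habs _ _
    rw [integral_infinitePi_update unif (.pick w a m) hm (habs (m + 1)),
      integral_infinitePi_update unif (.spawn w a m) hm1 hb1]
    refine integral_mono ?_ ?_ fun u => integral_missPotential_update_le h w a hj m u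
    · refine integrable_of_abs_le (B := 1) ?_ fun u =>
        abs_integral_le_of_abs_le (by simp) zero_le_one fun s => hb1 _
      exact (SubMarkov.measurable_integral (κ := fun _ : Call A → ℝ => unif)
        ⟨measurable_const, fun _ => prob_le_one⟩ (hm1.comp (hupd _)))
    · exact integrable_of_abs_le (measurable_missPotential w a j c₁ c₂ m) (habs m)

/-- The branch `j` is never picked while the number of branches passes through `[c₁, c₂)`. -/
def Missed (εz : ℝ) (w : Node A) (a : A) (j c₁ c₂ : ℕ) : Set (Call A → ℝ) :=
  {u | (∀ m, NotPicked εz w a j c₁ c₂ m u) ∧ ∃ m, c₂ ≤ branches εz u w a m}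

/-- Once the branch count has reached `c₂` without a pick in the window, the product in the
potential is empty and the potential equals 1. The indicator of this event is thus below the
potential, whose mean is bounded. -/
lemma measure_missed_le_prod (h : εz < 0) (w : Node A) (a : A) {j c₁ : ℕ} (c₂ : ℕ) (hj : j < c₁) :
    callLaw A (Missed εz w a j c₁ c₂) ≤
      ENNReal.ofReal (∏ i ∈ Finset.Ico c₁ c₂, missProb εz i) := by
  have hU : Missed εz w a j c₁ c₂ = ⋃ n, {u | (∀ m, NotPicked εz w a j c₁ c₂ m u) ∧
      c₂ ≤ branches εz u w a n} := by
    ext u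
    simp [Missed]
  have hmono : Monotone fun n => {u : Call A → ℝ | (∀ m, NotPicked εz w a j c₁ c₂ m u) ∧
      c₂ ≤ branches εz u w a n} := fun n n' hn u hu =>
    ⟨hu.1, hu.2.trans (branches_mono u w a hn)⟩
  -- The potential controls a fixed time only; the event is an increasing union over the time by
  -- which `c₂` branches are present, so a bound uniform in that time is enough.
  rw [hU, hmono.measure_iUnion]
  refine iSup_le fun n => ?_
  have hsub : {u : Call A → ℝ | (∀ m, NotPicked εz w a j c₁ c₂ m u) ∧
      c₂ ≤ branches εz u w a n} ⊆ {u | NotPicked εz w a j c₁ c₂ n u ∧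
      c₂ ≤ branches εz u w a n} := fun u hu => ⟨hu.1 n, hu.2⟩
  have hms : MeasurableSet {u : Call A → ℝ | NotPicked εz w a j c₁ c₂ n u ∧
      c₂ ≤ branches εz u w a n} := (measurableSet_notPicked w a j c₁ c₂ n).inter
    (measurableSet_le measurable_const (measurable_branches w a n))
  refine (measure_mono hsub).trans ?_
  rw [← ofReal_measureReal]
  refine ENNReal.ofReal_le_ofReal (le_trans ?_ (integral_missPotential_le h w a c₂ hj n))
  rw [← integral_indicator_one hms]
  refine integral_mono ((integrable_const _).indicator hms)
    (integrable_of_abs_le (measurable_missPotential w a j c₁ c₂ n) (B := 1) fun u => ?_) fun u => ?_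
  · rw [abs_of_nonneg (missPotential_nonneg h _ _ _ _ _ _ _)]
    exact missPotential_le_one h _ _ _ _ _ _ _
  · refine Set.indicator_le' (s := {u : Call A → ℝ | NotPicked εz w a j c₁ c₂ n u ∧
      c₂ ≤ branches εz u w a n}) (f := 1) (g := missPotential εz w a j c₁ c₂ n)
      (fun u hu => ?_) (fun u _ => ?_) u
    · rw [missPotential, if_pos hu.1, missBound, Finset.Ico_eq_empty (by have := hu.2; omega)]
      simp
    · exact missPotential_nonneg h _ _ _ _ _ _ _

end Branching

lemma tendsto_card_filter_range {p : ℕ → Prop} [DecidablePred p] (h : ∀ n, ∃ k ≥ n, p k) :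
    Tendsto (fun m => ((Finset.range m).filter p).card) atTop atTop := by
  refine tendsto_atTop_atTop_of_monotone (fun m m' hm => Finset.card_le_card
    (Finset.filter_subset_filter _ (Finset.range_mono hm))) fun b => ?_
  induction b with
  | zero => exact ⟨0, Nat.zero_le _⟩
  | succ b ih =>
    obtain ⟨m, hm⟩ := ih
    obtain ⟨k, hk, hpk⟩ := h m
    refine ⟨k + 1, ?_⟩
    rw [Finset.range_add_one, Finset.filter_insert, if_pos hpk, Finset.card_insert_of_notMem (by simp)]
    have := Finset.card_le_card (Finset.filter_subset_filter p (Finset.range_mono hk))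
    omega

/-! ### Borel-Cantelli: branches proliferate, and almost all of them are picked often. -/

section Recurrence

variable {A : Type*} {εz : ℝ}

/-- Second Borel-Cantelli lemma: distinct calls are independent and hit `S` with the same positive
probability. -/
lemma ae_frequently_mem {φ : ℕ → Call A} (hφ : Function.Injective φ) {S : Set ℝ}
    (hS : MeasurableSet S) (h0 : unif S ≠ 0) :
    ∀ᵐ u ∂(callLaw A), ∀ n, ∃ k ≥ n, u (φ k) ∈ S := by
  have hm : ∀ k, MeasurableSet ((fun u : Call A → ℝ => u (φ k)) ⁻¹' S) :=
    fun k => measurable_pi_apply _ hS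
  have hind : iIndepFun (fun (k : ℕ) (u : Call A → ℝ) => u (φ k)) (callLaw A) :=
    (iIndepFun_infinitePi (P := fun _ : Call A => unif) (X := fun _ r => r)
      fun _ => measurable_id).precomp hφ
  have hmeas : ∀ k, callLaw A ((fun u : Call A → ℝ => u (φ k)) ⁻¹' S) = unif S := by
    intro k
    rw [← Measure.map_apply (f := fun u : Call A → ℝ => u (φ k)) (measurable_pi_apply (φ k)) hS]
    congr 1
    exact Measure.infinitePi_map_eval (fun _ : Call A => unif) (φ k)
  have hset : iIndepSet (fun k => (fun u : Call A → ℝ => u (φ k)) ⁻¹' S) (callLaw A) := by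
    rw [iIndepSet_iff_meas_biInter hm]
    intro s
    exact hind.measure_inter_preimage_eq_mul s fun _ _ => hS
  have h1 := measure_limsup_eq_one hm hset (by
    simp_rw [hmeas]
    exact ENNReal.tsum_const_eq_top_of_ne_zero h0)
  have h2 := (prob_compl_eq_zero_iff (MeasurableSet.measurableSet_limsup hm)).2 h1
  have h3 : ∀ᵐ u ∂(callLaw A), u ∈ limsup (fun k => (fun u : Call A → ℝ => u (φ k)) ⁻¹' S) atTop :=
    h2
  filter_upwards [h3] with u hu n
  rw [mem_limsup_iff_frequently_mem] at hu
  obtain ⟨k, hk, hk'⟩ := (frequently_atTop.1 hu) n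
  exact ⟨k, hk, hk'⟩

lemma unif_Iio_ne_zero {p : ℝ} (h0 : 0 < p) (h1 : p ≤ 1) : unif (Set.Iio p) ≠ 0 := by
  intro h
  have := unif_real_Iio h0.le h1
  rw [measureReal_def, h] at this
  simp at this
  exact h0.ne this

/-- The number of branches grows without bound. -/
lemma ae_tendsto_branches (h : εz < 0) (w : Node A) (a : A) :
    ∀ᵐ u ∂(callLaw A), Tendsto (branches εz u w a) atTop atTop := by
  -- The threshold is taken for every fixed `c`, which avoids the randomness of the branch count: a
  -- count stuck at `c` would meet a spawn number below its threshold.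
  have h1 : ∀ᵐ u ∂(callLaw A), ∀ c n, ∃ k ≥ n, u (.spawn w a k) ∈ Set.Iio (spawnProb εz c) := by
    rw [ae_all_iff]
    intro c
    refine ae_frequently_mem (φ := fun k => Call.spawn w a k) (fun k k' hk => ?_)
      measurableSet_Iio (unif_Iio_ne_zero (spawnProb_pos c) (spawnProb_le_one h c))
    simpa using hk
  filter_upwards [h1] with u hu
  refine tendsto_atTop_atTop_of_monotone (branches_mono u w a) fun b => ?_
  induction b with
  | zero => exact ⟨0, Nat.zero_le _⟩
  | succ b ih =>
    obtain ⟨m, hm⟩ := ih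
    obtain ⟨k, hk, hk'⟩ := hu b m
    refine ⟨k + 1, ?_⟩
    rcases (hm.trans (branches_mono u w a hk)).lt_or_eq with h2 | h2
    · exact Nat.succ_le_of_lt (h2.trans_le (branches_mono u w a k.le_succ))
    · simp only [branches, ← h2]
      rw [if_pos (Set.mem_Iio.1 hk')]

/-- Here `1 - missProb = (1-p)/(pi+1-p)` with `p = (i+1)^εz`. Since `i ≥ 1`, `p ≤ 2^εz` stays away
from 1, and `pi ≤ i^(1+εz)`. The condition `-1 ≤ εz` gives `i^(1+εz) ≥ 1`, which absorbs the summand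
`1-p` and produces the factor 2. Passing from `i` to a common upper bound `C` makes the estimate
uniform on a window. -/
lemma missProb_le_exp (h : εz < 0) (h' : -1 ≤ εz) {i C : ℕ} (hi : 1 ≤ i) (hC : i ≤ C) :
    missProb εz i ≤ Real.exp (-((1 - 2 ^ εz) / 2 * (C : ℝ) ^ (-(1 + εz)))) := by
  have hi0 : (0 : ℝ) < i := by exact_mod_cast hi
  have hi1 : (1 : ℝ) ≤ i := by exact_mod_cast hi
  have hiC : (i : ℝ) ≤ C := by exact_mod_cast hC
  set p := spawnProb εz i with hp
  have hp0 : 0 < p := spawnProb_pos i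
  have hp1 : p ≤ 1 := spawnProb_le_one h i
  have hp2 : p ≤ 2 ^ εz := Real.rpow_le_rpow_of_nonpos (by norm_num) (by linarith) h.le
  have hpi : p * i ≤ (i : ℝ) ^ (1 + εz) := by
    have : p ≤ (i : ℝ) ^ εz := Real.rpow_le_rpow_of_nonpos hi0 (by linarith) h.le
    rw [add_comm, Real.rpow_add hi0, Real.rpow_one]
    gcongr
  have h1 : 1 ≤ (i : ℝ) ^ (1 + εz) := Real.one_le_rpow hi1 (by linarith)
  have hd : 0 < p * i + (1 - p) := by
    have : 0 < p * i := by positivity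
    linarith
  have hEq : missProb εz i = -((1 - p) / (p * i + (1 - p))) + 1 := by
    rw [missProb, ← hp]
    field_simp
    ring
  rw [hEq]
  refine (Real.add_one_le_exp _).trans (Real.exp_le_exp.2 (neg_le_neg ?_))
  have hκ : 0 ≤ 1 - p := by linarith
  calc (1 - 2 ^ εz) / 2 * (C : ℝ) ^ (-(1 + εz)) ≤ (1 - p) / 2 * (i : ℝ) ^ (-(1 + εz)) := by
        exact mul_le_mul (by linarith) (Real.rpow_le_rpow_of_nonpos hi0 hiC (by linarith))
          (by positivity) (by linarith)
    _ = (1 - p) / (2 * (i : ℝ) ^ (1 + εz)) := by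
        rw [Real.rpow_neg hi0.le]
        field_simp
    _ ≤ (1 - p) / (p * i + (1 - p)) := by
        gcongr
        linarith

lemma measure_missed_le (h : εz < 0) (h' : -1 ≤ εz) (w : Node A) (a : A) {j c₁ : ℕ} (l : ℕ)
    (hj : j < c₁) :
    callLaw A (Missed εz w a j c₁ (c₁ + l)) ≤
      ENNReal.ofReal (Real.exp (-((1 - 2 ^ εz) / 2 * l * ((c₁ + l : ℕ) : ℝ) ^ (-(1 + εz))))) := by
  refine (measure_missed_le_prod h w a (c₁ + l) hj).trans (ENNReal.ofReal_le_ofReal ?_)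
  calc ∏ i ∈ Finset.Ico c₁ (c₁ + l), missProb εz i
      ≤ ∏ _i ∈ Finset.Ico c₁ (c₁ + l),
          Real.exp (-((1 - 2 ^ εz) / 2 * ((c₁ + l : ℕ) : ℝ) ^ (-(1 + εz)))) := by
        refine Finset.prod_le_prod (fun i _ => missProb_nonneg h i) fun i hi => ?_
        rw [Finset.mem_Ico] at hi
        exact missProb_le_exp h h' (by omega) (by omega)
    _ = _ := by
        rw [Finset.prod_const, Nat.card_Ico, Nat.add_sub_cancel_left, ← Real.exp_nat_mul]
        congr 1
        ring

lemma one_sub_two_rpow_pos (h : εz < 0) : 0 < 1 - (2 : ℝ) ^ εz := by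
  have := Real.rpow_lt_one_of_one_lt_of_neg (x := 2) (by norm_num) h
  linarith

/-- The exponential is eventually dominated by `(j+1)^(-2)`, the power `-2/s` of `(j+1)^s`. -/
lemma summable_exp_neg_rpow {C s : ℝ} (hC : 0 < C) (hs : 0 < s) :
    Summable fun j : ℕ => Real.exp (-(C * ((j : ℝ) + 1) ^ s)) := by
  have h1 : Tendsto (fun j : ℕ => ((j : ℝ) + 1) ^ s) atTop atTop :=
    (tendsto_rpow_atTop hs).comp (tendsto_natCast_atTop_atTop.atTop_add tendsto_const_nhds)
  have h2 := (isLittleO_exp_neg_mul_rpow_atTop hC (-2 / s)).comp_tendsto h1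
  have h3 : Summable fun j : ℕ => (((j : ℝ) + 1) ^ s) ^ (-2 / s) := by
    have h4 : Summable fun j : ℕ => (((j + 1 : ℕ) : ℝ) ^ 2)⁻¹ :=
      (summable_nat_add_iff 1).2 (Real.summable_nat_pow_inv.2 one_lt_two)
    refine h4.congr fun j => ?_
    have hj : (0 : ℝ) ≤ (j : ℝ) + 1 := by positivity
    rw [← Real.rpow_mul hj, mul_div_cancel₀ _ hs.ne', Real.rpow_neg hj]
    norm_num
  refine summable_of_isBigO_nat h3 ?_
  simpa [Function.comp_def] using h2.isBigO

lemma exists_picked_of_not_missed {w : Node A} {a : A} {u : Call A → ℝ}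
    (hb : Tendsto (branches εz u w a) atTop atTop) {j c₁ c₂ : ℕ}
    (hu : u ∉ Missed εz w a j c₁ c₂) :
    ∃ k, c₁ ≤ branches εz u w a k ∧ branches εz u w a k < c₂ ∧ picked εz u w a k = some j := by
  by_contra! hcon
  exact hu ⟨fun m k _ h1 h2 => hcon k h1 h2, (hb.eventually_ge_atTop c₂).exists⟩

/-- How often the branch `j` is picked during the first `m` visits. -/
def pickCount (εz : ℝ) (u : Call A → ℝ) (w : Node A) (a : A) (j m : ℕ) : ℕ :=
  ((Finset.range m).filter fun k => picked εz u w a k = some j).card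

/-- Every branch is picked infinitely often. -/
lemma ae_tendsto_pickCount (h : εz < 0) (h' : -1 ≤ εz) (w : Node A) (a : A) :
    ∀ᵐ u ∂(callLaw A), ∀ j, Tendsto (pickCount εz u w a j) atTop atTop := by
  have h1 : ∀ᵐ u ∂(callLaw A), ∀ j c₁, j < c₁ → ∃ c₂, u ∉ Missed εz w a j c₁ c₂ := by
    rw [ae_all_iff]
    intro j
    rw [ae_all_iff]
    intro c₁
    by_cases hj : j < c₁
    swap
    · exact ae_of_all _ fun u hj' => absurd hj' hj
    have hz : callLaw A (⋂ c₂, Missed εz w a j c₁ c₂) = 0 := by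
      -- The window used below is `[n+1, 2(n+1))`; the second factor of `C` comes from its right
      -- end.
      set C := (1 - (2 : ℝ) ^ εz) / 2 * 2 ^ (-(1 + εz)) with hC
      have hCpos : 0 < C := by
        have := one_sub_two_rpow_pos h
        positivity
      have hle : ∀ᶠ n : ℕ in atTop, callLaw A (⋂ c₂, Missed εz w a j c₁ c₂) ≤
          ENNReal.ofReal (Real.exp (-(C * ((n : ℝ) + 1) ^ (-εz)))) := by
        filter_upwards [eventually_ge_atTop c₁] with n hn
        have hsub : (⋂ c₂, Missed εz w a j c₁ c₂) ⊆ Missed εz w a j (n + 1) (n + 1 + (n + 1)) := by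
          intro u hu
          have := Set.mem_iInter.1 hu (n + 1 + (n + 1))
          exact ⟨fun m k hk h1 h2 => this.1 m k hk (by omega) h2, this.2⟩
        refine (measure_mono hsub).trans ((measure_missed_le h h' w a (n + 1) (by omega)).trans_eq ?_)
        congr 3
        have hn0 : (0 : ℝ) < (n : ℝ) + 1 := by positivity
        have : ((n + 1 + (n + 1) : ℕ) : ℝ) = 2 * ((n : ℝ) + 1) := by push_cast; ring
        rw [this, Real.mul_rpow (by norm_num) hn0.le, hC]
        have h3 : ((n : ℝ) + 1) ^ (-εz) = ((n : ℝ) + 1) * ((n : ℝ) + 1) ^ (-(1 + εz)) := by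
          rw [← Real.rpow_one_add' hn0.le (by linarith)]
          congr 1
          ring
        rw [h3]
        push_cast
        ring
      refine le_antisymm (ge_of_tendsto ?_ hle) zero_le
      have := ENNReal.tendsto_ofReal
        (summable_exp_neg_rpow hCpos (neg_pos.2 h)).tendsto_atTop_zero
      simpa using this
    have h2 : ∀ᵐ u ∂(callLaw A), u ∉ ⋂ c₂, Missed εz w a j c₁ c₂ := measure_eq_zero_iff_ae_notMem.1 hz
    filter_upwards [h2] with u hu _
    simpa using hu
  filter_upwards [h1, ae_tendsto_branches h w a] with u hu hb j
  refine tendsto_card_filter_range fun n => ?_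
  -- There are never more branches than visits, so a pick with at least `n` branches present happens
  -- at a visit with index at least `n`.
  obtain ⟨c₂, hc⟩ := hu j (max n (j + 1)) (by omega)
  obtain ⟨k, hk1, -, hk3⟩ := exists_picked_of_not_missed hb hc
  exact ⟨k, (le_max_left _ _).trans (hk1.trans (branches_le u w a k)), hk3⟩

/-- From the birth of branch `j` on, `V` consecutive windows of length `j/D+1` are laid out. If none
of them misses `j`, the picks in these disjoint windows happen at `V` distinct visits. Exceptions
are the branches before `j₀` and those so recent that their windows do not fit below the current
count; the latter are about a fraction `V/D` of all. -/
lemma card_rarely_picked_le {w : Node A} {a : A} {u : Call A → ℝ}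
    (hb : Tendsto (branches εz u w a) atTop atTop) {V D j₀ : ℕ}
    (hu : ∀ j ≥ j₀, ∀ i < V, u ∉ Missed εz w a j (j + 1 + i * (j / D + 1))
      (j + 1 + i * (j / D + 1) + (j / D + 1))) (m : ℕ) :
    ((Finset.range (branches εz u w a m)).filter fun j => pickCount εz u w a j m < V).card ≤
      j₀ + (V * (branches εz u w a m / D + 1) + 1) := by
  set c := branches εz u w a m with hc
  have hsub : ((Finset.range c).filter fun j => pickCount εz u w a j m < V) ⊆
      Finset.range j₀ ∪ Finset.Ico (c - (V * (c / D + 1) + 1)) c := by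
    intro j hj
    rw [Finset.mem_filter, Finset.mem_range] at hj
    rw [Finset.mem_union, Finset.mem_range, Finset.mem_Ico]
    by_contra! hcon
    obtain ⟨h1, h2⟩ := hcon
    have hjc : ¬ c - (V * (c / D + 1) + 1) ≤ j := fun h3 => absurd (h2 h3) (by omega)
    have hdiv : j / D ≤ c / D := Nat.div_le_div_right hj.1.le
    have hend : j + 1 + V * (j / D + 1) ≤ c := by
      have : V * (j / D + 1) ≤ V * (c / D + 1) := Nat.mul_le_mul_left _ (by omega)
      omega
    have hex : ∀ i : Fin V, ∃ k, j + 1 + i * (j / D + 1) ≤ branches εz u w a k ∧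
        branches εz u w a k < j + 1 + i * (j / D + 1) + (j / D + 1) ∧
        picked εz u w a k = some j := fun i =>
      exists_picked_of_not_missed hb (hu j h1 i i.2)
    choose k hk1 hk2 hk3 using hex
    refine absurd hj.2 (not_lt.2 ?_)
    have hinj : Function.Injective k := by
      intro i i' hii
      by_contra hne
      wlog hlt : i < i' generalizing i i'
      · exact this hii.symm (Ne.symm hne) (lt_of_le_of_ne (not_lt.1 hlt) (Ne.symm hne))
      have h3 := hk2 i
      have h4 := hk1 i'
      rw [hii] at h3
      have : (i : ℕ) + 1 ≤ i' := hlt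
      have : ((i : ℕ) + 1) * (j / D + 1) ≤ i' * (j / D + 1) := Nat.mul_le_mul_right _ this
      rw [Nat.succ_mul] at this
      omega
    calc V = (Finset.univ.image k).card := by
          rw [Finset.card_image_of_injective _ hinj, Finset.card_univ, Fintype.card_fin]
      _ ≤ _ := by
          refine Finset.card_le_card fun x hx => ?_
          obtain ⟨i, -, rfl⟩ := Finset.mem_image.1 hx
          rw [Finset.mem_filter, Finset.mem_range]
          refine ⟨?_, hk3 i⟩
          by_contra! hge
          have h3 := branches_mono (εz := εz) u w a hge
          have h4 := hk2 i
          have : ((i : ℕ) + 1) * (j / D + 1) ≤ V * (j / D + 1) := Nat.mul_le_mul_right _ i.2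
          rw [Nat.succ_mul] at this
          omega
  refine (Finset.card_le_card hsub).trans ((Finset.card_union_le _ _).trans ?_)
  rw [Finset.card_range, Nat.card_Ico]
  omega

/-- All but a vanishing fraction of the branches are picked often. -/
lemma ae_tendsto_rarely_picked (h : εz < 0) (h' : -1 ≤ εz) (w : Node A) (a : A) :
    ∀ᵐ u ∂(callLaw A), ∀ V, Tendsto (fun m =>
      (((Finset.range (branches εz u w a m)).filter fun j => pickCount εz u w a j m < V).card : ℝ) /
        branches εz u w a m) atTop (𝓝 0) := by
  have h1 : ∀ᵐ u ∂(callLaw A), ∀ D i : ℕ, 0 < D → ∀ᶠ j in atTop,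
      u ∉ Missed εz w a j (j + 1 + i * (j / D + 1)) (j + 1 + i * (j / D + 1) + (j / D + 1)) := by
    rw [ae_all_iff]
    intro D
    rw [ae_all_iff]
    intro i
    rcases Nat.eq_zero_or_pos D with hD | hD
    · exact ae_of_all _ fun u hD' => absurd hD hD'.ne'
    -- The window has length at least `(j+1)/D` and ends at most at `(i+2)(j+1)`; the two factors of
    -- `C` reflect these bounds.
    set C := (1 - (2 : ℝ) ^ εz) / 2 / D * ((i : ℝ) + 2) ^ (-(1 + εz)) with hC
    have hκ := one_sub_two_rpow_pos h
    have hD0 : (0 : ℝ) < D := by exact_mod_cast hD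
    have hCpos : 0 < C := by positivity
    have hle : ∀ j, callLaw A (Missed εz w a j (j + 1 + i * (j / D + 1))
        (j + 1 + i * (j / D + 1) + (j / D + 1))) ≤
        ENNReal.ofReal (Real.exp (-(C * ((j : ℝ) + 1) ^ (-εz)))) := by
      intro j
      refine (measure_missed_le h h' w a (j / D + 1) (by omega)).trans (ENNReal.ofReal_le_ofReal
        (Real.exp_le_exp.2 (neg_le_neg ?_)))
      have hj0 : (0 : ℝ) < (j : ℝ) + 1 := by positivity
      have h3 : ((j : ℝ) + 1) ^ (-εz) = ((j : ℝ) + 1) * ((j : ℝ) + 1) ^ (-(1 + εz)) := by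
        rw [← Real.rpow_one_add' hj0.le (by linarith)]
        congr 1
        ring
      have h4 : ((j : ℝ) + 1) / D ≤ ((j / D + 1 : ℕ) : ℝ) := by
        rw [div_le_iff₀ hD0]
        have := Nat.lt_div_mul_add hD (a := j)
        have h5 : j + 1 ≤ (j / D + 1) * D := by
          rw [Nat.succ_mul]
          omega
        exact_mod_cast h5
      have h5 : j / D + 1 ≤ j + 1 := Nat.succ_le_succ (Nat.div_le_self _ _)
      have h6 : j + 1 + i * (j / D + 1) + (j / D + 1) ≤ (i + 2) * (j + 1) := by
        have : i * (j / D + 1) ≤ i * (j + 1) := Nat.mul_le_mul_left _ h5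
        nlinarith
      have h7 : (((i : ℝ) + 2) * ((j : ℝ) + 1)) ^ (-(1 + εz)) ≤
          ((j + 1 + i * (j / D + 1) + (j / D + 1) : ℕ) : ℝ) ^ (-(1 + εz)) := by
        refine Real.rpow_le_rpow_of_nonpos (by positivity) (by exact_mod_cast h6) (by linarith)
      calc C * ((j : ℝ) + 1) ^ (-εz)
          = (1 - (2 : ℝ) ^ εz) / 2 * (((j : ℝ) + 1) / D) *
              (((i : ℝ) + 2) * ((j : ℝ) + 1)) ^ (-(1 + εz)) := by
            rw [h3, hC, Real.mul_rpow (by positivity) hj0.le]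
            ring
        _ ≤ _ := by gcongr
    have hsum : ∑' j, callLaw A (Missed εz w a j (j + 1 + i * (j / D + 1))
        (j + 1 + i * (j / D + 1) + (j / D + 1))) ≠ ∞ := by
      refine ne_top_of_le_ne_top ?_ (ENNReal.tsum_le_tsum hle)
      exact (summable_exp_neg_rpow hCpos (neg_pos.2 h)).tsum_ofReal_ne_top
    filter_upwards [ae_eventually_notMem hsum] with u hu _
    exact hu
  filter_upwards [h1, ae_tendsto_branches h w a] with u hu hb V
  rw [Metric.tendsto_atTop]
  intro ε hε
  -- With this `D` the recent exceptional branches make up less than `ε/2` of all, up to a constant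
  -- number; the lower bound on the count then takes care of the constants.
  obtain ⟨D, hD⟩ := exists_nat_gt (2 * V / ε)
  have hD0 : (0 : ℝ) < D := lt_of_le_of_lt (by positivity) hD
  have hD' : 0 < D := by exact_mod_cast hD0
  have hev : ∀ᶠ j in atTop, ∀ i < V, u ∉ Missed εz w a j (j + 1 + i * (j / D + 1))
      (j + 1 + i * (j / D + 1) + (j / D + 1)) := by
    have := (Finset.eventually_all (Finset.range V)).2 fun i _ => hu D i hD'
    simpa using this
  obtain ⟨j₀, hj₀⟩ := eventually_atTop.1 hev
  have hlarge : ∀ᶠ m in atTop, 2 * (j₀ + V + 1 : ℝ) / ε < branches εz u w a m :=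
    (tendsto_natCast_atTop_atTop.comp hb).eventually_gt_atTop _
  obtain ⟨m₀, hm₀⟩ := eventually_atTop.1 hlarge
  refine ⟨m₀, fun m hm => ?_⟩
  have hc := hm₀ m hm
  have hc0 : (0 : ℝ) < branches εz u w a m := lt_of_le_of_lt (by positivity) hc
  have hcard := card_rarely_picked_le hb hj₀ m
  set c := branches εz u w a m with hcdef
  rw [Real.dist_eq, sub_zero, abs_of_nonneg (by positivity), div_lt_iff₀ hc0]
  have h3 : (((Finset.range c).filter fun j => pickCount εz u w a j m < V).card : ℝ) ≤
      j₀ + (V * ((c / D : ℕ) + 1) + 1) := by exact_mod_cast hcard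
  have h4 : ((c / D : ℕ) : ℝ) ≤ (c : ℝ) / D := Nat.cast_div_le
  have h5 : (V : ℝ) * ((c : ℝ) / D) ≤ ε / 2 * c := by
    rw [div_lt_iff₀ hε] at hD
    rw [mul_div_assoc', div_le_iff₀ hD0]
    nlinarith
  have h6 : (j₀ + V + 1 : ℝ) < ε / 2 * c := by
    rw [div_lt_iff₀ hε] at hc
    linarith
  have h7 : (V : ℝ) * (c / D : ℕ) ≤ V * ((c : ℝ) / D) := by gcongr
  linarith

end Recurrence

/-! ### Measurability in tuples and counters; random numbers relative to a node. -/

lemma measurable_finCons {Y E : Type*} [MeasurableSpace Y] [MeasurableSpace E] {n : ℕ}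
    {f : Y → E} (hf : Measurable f) {g : Y → Fin n → E} (hg : Measurable g) :
    Measurable fun y => (Fin.cons (f y) (g y) : Fin (n + 1) → E) := by
  refine measurable_pi_lambda _ fun i => ?_
  refine Fin.cases ?_ (fun j => ?_) i
  · simpa using hf
  · simpa [Function.comp_def] using (measurable_pi_apply j).comp hg

lemma measurable_nat_param {Y β : Type*} [MeasurableSpace Y] [MeasurableSpace β] {g : ℕ → Y → β}
    (hg : ∀ n, Measurable (g n)) {v : Y → ℕ} (hv : Measurable v) :
    Measurable fun y => g (v y) y :=
  (measurable_from_prod_countable_right (f := fun p : ℕ × Y => g p.1 p.2) hg).comp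
    (hv.prodMk measurable_id)

/-- Prefixing the node of a call. -/
def Call.shift {A : Type*} (w : Node A) : Call A → Call A
  | .action w' k => .action (w' ++ w) k
  | .spawn w' a k => .spawn (w' ++ w) a k
  | .pick w' a k => .pick (w' ++ w) a k
  | .meas w' a j => .meas (w' ++ w) a j

/-- The random numbers used below the node `w`. -/
def below {A : Type*} (w : Node A) (u : Call A → ℝ) : Call A → ℝ := fun c => u (c.shift w)

lemma measurable_below {A : Type*} (w : Node A) : Measurable (below w) :=
  measurable_pi_lambda _ fun _ => measurable_pi_apply _

/-- Relative addresses compose, so the subtree at a child is the subtree at the first branch of a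
re-rooted tree. This self-similarity drives the induction on the horizon. -/
lemma below_below {A : Type*} (w : Node A) (b : A × ℕ) (u : Call A → ℝ) :
    below [b] (below w u) = below (b :: w) u := by
  ext c
  cases c <;> simp [below, Call.shift]

lemma branches_below {A : Type*} (εz : ℝ) (u : Call A → ℝ) (w : Node A) (a : A) (m : ℕ) :
    branches εz (below w u) [] a m = branches εz u w a m := by
  induction m with
  | zero => rfl
  | succ m ih => simp [branches, ih, below, Call.shift]

lemma picked_below {A : Type*} (εz : ℝ) (u : Call A → ℝ) (w : Node A) (a : A) (m : ℕ) :
    picked εz (below w u) [] a m = picked εz u w a m := by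
  unfold picked
  rw [branches_below]
  rfl

/-! ### Expectations under the policy and under the tree as recursions from the root. -/

section Functionals

variable {X A Z : Type*} [MeasurableSpace X] [Fintype A] [MeasurableSpace A] [MeasurableSpace Z]

lemma Policy.sum_coe (π : Policy A Z) (h : Hist A Z) : ∑ a, (π.prob h a : ℝ) = 1 := by
  exact_mod_cast π.sum_one h

lemma Policy.measurable_prob (π : Policy A Z) {Y : Type*} [MeasurableSpace Y] {n : ℕ}
    {s : Y → Fin n → A × Z} (hs : Measurable s) (a : A) :
    Measurable fun y => π.prob (List.ofFn (s y)) a :=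
  (π.prob_measurable n a).comp hs

/-- The expectation of `f` over the next steps if a new leaf is created at once. -/
def POMDP.leafInt (M : POMDP X A Z) (ρ : Rollout A Z) (h : Hist A Z) (a : A) {T : ℕ}
    (f : Steps A Z (T + 1) → ℝ) : ℝ :=
  ∫ e, f e ∂((M.predict h a).bind fun z => (ρ.law ((a, z) :: h) T).map
    fun e : Steps A Z T => (Fin.cons (a, Sum.inl z) e : Steps A Z (T + 1)))

/-- The expectation of `f` over the next `T` steps of the POMDP. -/
def POMDP.polInt (M : POMDP X A Z) (π : Policy A Z) :
    (T : ℕ) → Hist A Z → (Steps A Z T → ℝ) → ℝ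
  | 0, _, f => f Fin.elim0
  | T + 1, h, f => ∑ a, (π.prob h a : ℝ) * ∫ z, M.polInt π T ((a, z) :: h)
      (fun e => f (Fin.cons (a, Sum.inl z) e)) ∂(M.predict h a)

section Laws

variable (M : POMDP X A Z) (π : Policy A Z) (ρ : Rollout A Z)
variable {Y : Type*} [MeasurableSpace Y]

lemma Rollout.law_subMarkov {n : ℕ} {s : Y → Fin n → A × Z} (hs : Measurable s) (T : ℕ) :
    SubMarkov fun y => ρ.law (List.ofFn (s y)) T :=
  SubMarkov.weighted_sum
    (κ := fun (v : Fin T → A) (_ : Y) => Measure.dirac fun i => (v i, (Sum.inr () : Z ⊕ Unit)))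
    (fun _ => SubMarkov.dirac measurable_const) (fun v => (ρ.prob_measurable n T v).comp hs)
    fun _ => (ρ.sum_one _ T).le

lemma POMDP.leaf_subMarkov {n : ℕ} {s : Y → Fin n → A × Z} (hs : Measurable s) (a : A) (T : ℕ) :
    SubMarkov fun y => (M.predict (List.ofFn (s y)) a).bind fun z =>
      (ρ.law ((a, z) :: List.ofFn (s y)) T).map
        fun e : Steps A Z T => (Fin.cons (a, Sum.inl z) e : Steps A Z (T + 1)) := by
  refine ((M.predict_subMarkov n).comp (hs.prodMk measurable_const)).bind
    (η := fun y z => (ρ.law ((a, z) :: List.ofFn (s y)) T).map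
      fun e : Steps A Z T => (Fin.cons (a, Sum.inl z) e : Steps A Z (T + 1))) ?_
  have h1 : SubMarkov fun p : Y × Z => ρ.law ((a, p.2) :: List.ofFn (s p.1)) T := by
    have := ρ.law_subMarkov (Y := Y × Z) (n := n + 1)
      (s := fun p => Fin.cons (a, p.2) (s p.1))
      (measurable_finCons (measurable_const.prodMk measurable_snd) (hs.comp measurable_fst)) T
    simpa [List.ofFn_succ] using this
  refine h1.map (g := fun p e => (Fin.cons (a, Sum.inl p.2) e : Steps A Z (T + 1))) ?_
  exact measurable_finCons (measurable_const.prodMk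
    (measurable_inl.comp (measurable_snd.comp measurable_fst))) measurable_snd

lemma POMDP.measurable_leafInt {n : ℕ} {s : Y → Fin n → A × Z} (hs : Measurable s) (a : A) {T : ℕ}
    {f : Y → Steps A Z (T + 1) → ℝ} (hf : Measurable (Function.uncurry f)) :
    Measurable fun y => M.leafInt ρ (List.ofFn (s y)) a (f y) :=
  (M.leaf_subMarkov ρ hs a T).measurable_integral hf

lemma POMDP.leaf_mass_le (h : Hist A Z) (a : A) (T : ℕ) :
    ((M.predict h a).bind fun z => (ρ.law ((a, z) :: h) T).map
      fun e : Steps A Z T => (Fin.cons (a, Sum.inl z) e : Steps A Z (T + 1))) Set.univ ≤ 1 := by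
  have := (M.leaf_subMarkov ρ (Y := Unit) (n := h.length) (s := fun _ => h.get)
    measurable_const a T).mass_le ()
  rwa [List.ofFn_get] at this

lemma POMDP.abs_leafInt_le (h : Hist A Z) (a : A) {T : ℕ} {f : Steps A Z (T + 1) → ℝ} {B : ℝ}
    (hB0 : 0 ≤ B) (hB : ∀ e, |f e| ≤ B) : |M.leafInt ρ h a f| ≤ B :=
  abs_integral_le_of_abs_le (M.leaf_mass_le ρ h a T) hB0 hB

/-- The integrand is allowed to depend on the history, and the length `n` is universally quantified,
because each step of the recursion lengthens the history and builds the new pair into the integrand.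
-/
lemma POMDP.measurable_polInt (T : ℕ) : ∀ {n : ℕ} {f : (Fin n → A × Z) × Y → Steps A Z T → ℝ},
    Measurable (Function.uncurry f) →
      Measurable fun p : (Fin n → A × Z) × Y => M.polInt π T (List.ofFn p.1) (f p) := by
  induction T with
  | zero =>
    intro n f hf
    exact hf.comp (measurable_id.prodMk measurable_const)
  | succ T ih =>
    intro n f hf
    simp only [POMDP.polInt]
    refine Finset.measurable_sum _ fun a _ => ?_
    refine ((π.measurable_prob measurable_fst a).coe_nnreal_real).mul ?_
    refine ((M.predict_subMarkov n).comp (measurable_fst.prodMk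
      (measurable_const (a := a)))).measurable_integral
      (f := fun p z => M.polInt π T ((a, z) :: List.ofFn p.1)
        (fun e => f p (Fin.cons (a, Sum.inl z) e))) ?_
    have h1 := ih (n := n + 1) (f := fun q e => f (fun i => q.1 i.succ, q.2)
      (Fin.cons ((q.1 0).1, Sum.inl (q.1 0).2) e)) (by
        refine hf.comp (Measurable.prodMk (by fun_prop) (measurable_finCons ?_ measurable_snd))
        exact Measurable.prodMk (by fun_prop) (measurable_inl.comp (by fun_prop)))
    have h2 := h1.comp (f := fun q : ((Fin n → A × Z) × Y) × Z =>
      ((Fin.cons (a, q.2) q.1.1 : Fin (n + 1) → A × Z), q.1.2)) (by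
        refine Measurable.prodMk (measurable_finCons ?_ ?_) ?_
        · exact measurable_const.prodMk measurable_snd
        · fun_prop
        · fun_prop)
    simpa [List.ofFn_succ, Function.comp_def, Function.uncurry_def] using h2

lemma Policy.abs_sum_le (h : Hist A Z) {g : A → ℝ} {B : ℝ} (hg : ∀ a, |g a| ≤ B) :
    |∑ a, (π.prob h a : ℝ) * g a| ≤ B := by
  calc |∑ a, (π.prob h a : ℝ) * g a| ≤ ∑ a, |(π.prob h a : ℝ) * g a| :=
        Finset.abs_sum_le_sum_abs _ _
    _ ≤ ∑ a, (π.prob h a : ℝ) * B := by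
        refine Finset.sum_le_sum fun a _ => ?_
        rw [abs_mul, abs_of_nonneg (NNReal.coe_nonneg _)]
        exact mul_le_mul_of_nonneg_left (hg a) (NNReal.coe_nonneg _)
    _ = B := by rw [← Finset.sum_mul, π.sum_coe, one_mul]

lemma POMDP.abs_polInt_le (T : ℕ) : ∀ (h : Hist A Z) {f : Steps A Z T → ℝ} {B : ℝ}, 0 ≤ B →
    (∀ e, |f e| ≤ B) → |M.polInt π T h f| ≤ B := by
  induction T with
  | zero => exact fun h f B _ hB => hB _
  | succ T ih =>
    intro h f B hB0 hB
    exact π.abs_sum_le h fun a => abs_integral_le_of_abs_le (M.predict_mass_le h a) hB0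
      fun z => ih _ hB0 fun e => hB _

end Laws

variable [DecidableEq A] {M : POMDP X A Z} {π : Policy A Z} (S : Sampler M π) (ρ : Rollout A Z)

/-- How often the action `a` is selected during the first `v` visits of the root, if the history
at the root is `h`. -/
def Sampler.actCount (h : Hist A Z) (u : Call A → ℝ) (a : A) (v : ℕ) : ℕ :=
  ((Finset.range v).filter fun k => S.selectAction h (u (.action [] k)) = a).card

/-- The expectation of `f` over the next `T` steps of an episode that is run on the search tree
after `v` visits of its root, if the history at the root is `h`. -/
def Sampler.treeInt (S : Sampler M π) (ρ : Rollout A Z) (εz : ℝ) :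
    (T : ℕ) → Hist A Z → ℕ → (Call A → ℝ) → (Steps A Z T → ℝ) → ℝ
  | 0, _, _, _, f => f Fin.elim0
  | T + 1, h, v, u, f => ∑ a, (π.prob h a : ℝ) *
      (spawnProb εz (branches εz u [] a (S.actCount h u a v)) * M.leafInt ρ h a f +
        (1 - spawnProb εz (branches εz u [] a (S.actCount h u a v))) /
            branches εz u [] a (S.actCount h u a v) *
          ∑ j ∈ Finset.range (branches εz u [] a (S.actCount h u a v)),
            S.treeInt ρ εz T ((a, S.sampleMeas h a (u (.meas [] a j))) :: h)
              (pickCount εz u [] a j (S.actCount h u a v)) (below [(a, j)] u)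
              (fun e => f (Fin.cons (a, Sum.inl (S.sampleMeas h a (u (.meas [] a j)))) e)))

section Measurability

variable {Y : Type*} [MeasurableSpace Y]

omit [DecidableEq A] in
lemma Sampler.measurable_selectAction [MeasurableSingletonClass A] {n : ℕ}
    {s : Y → Fin n → A × Z} (hs : Measurable s) {r : Y → ℝ} (hr : Measurable r) :
    Measurable fun y => S.selectAction (List.ofFn (s y)) (r y) :=
  (S.selectAction_measurable n).comp (hs.prodMk hr)

omit [DecidableEq A] in
lemma Sampler.measurable_sampleMeas {n : ℕ}
    {s : Y → Fin n → A × Z} (hs : Measurable s) (a : A) {r : Y → ℝ} (hr : Measurable r) :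
    Measurable fun y => S.sampleMeas (List.ofFn (s y)) a (r y) :=
  (S.sampleMeas_measurable n a).comp (hs.prodMk hr)

lemma Sampler.measurable_actCount [MeasurableSingletonClass A] {n : ℕ}
    {s : Y → Fin n → A × Z} (hs : Measurable s) {u : Y → Call A → ℝ} (hu : Measurable u)
    (a : A) {v : Y → ℕ} (hv : Measurable v) :
    Measurable fun y => S.actCount (List.ofFn (s y)) (u y) a (v y) := by
  refine measurable_nat_param (g := fun v y => S.actCount (List.ofFn (s y)) (u y) a v)
    (fun v => ?_) hv
  simp only [Sampler.actCount, Finset.card_filter]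
  refine Finset.measurable_sum _ fun k _ => Measurable.ite ?_ measurable_const measurable_const
  exact S.measurable_selectAction hs ((measurable_pi_apply _).comp hu) (measurableSet_singleton a)

omit [Fintype A] [MeasurableSpace A] [DecidableEq A] in
lemma measurable_pickCount (εz : ℝ) {u : Y → Call A → ℝ} (hu : Measurable u) (w : Node A) (a : A)
    (j : ℕ) {v : Y → ℕ} (hv : Measurable v) :
    Measurable fun y => pickCount εz (u y) w a j (v y) := by
  refine measurable_nat_param (g := fun v y => pickCount εz (u y) w a j v) (fun v => ?_) hv
  simp only [pickCount, Finset.card_filter]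
  refine Finset.measurable_sum _ fun k _ => Measurable.ite ?_ measurable_const measurable_const
  exact hu (measurableSet_picked w a k j)

lemma Sampler.measurable_treeInt [MeasurableSingletonClass A] (εz : ℝ) (T : ℕ) :
    ∀ {n : ℕ} {s : Y → Fin n → A × Z}, Measurable s → ∀ {v : Y → ℕ}, Measurable v →
      ∀ {u : Y → Call A → ℝ}, Measurable u → ∀ {f : Y → Steps A Z T → ℝ},
        Measurable (Function.uncurry f) →
          Measurable fun y => S.treeInt ρ εz T (List.ofFn (s y)) (v y) (u y) (f y) := by
  induction T with
  | zero =>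
    intro n s _ v _ u _ f hf
    exact hf.comp (measurable_id.prodMk measurable_const)
  | succ T ih =>
    intro n s hs v hv u hu f hf
    simp only [Sampler.treeInt]
    refine Finset.measurable_sum _ fun a _ => ?_
    have hact := S.measurable_actCount hs hu a hv
    have hbr : Measurable fun y =>
        branches εz (u y) [] a (S.actCount (List.ofFn (s y)) (u y) a (v y)) :=
      measurable_nat_param (g := fun m y => branches εz (u y) [] a m)
        (fun m => (measurable_branches [] a m).comp hu) hact
    have hsp : Measurable fun y => spawnProb εz
        (branches εz (u y) [] a (S.actCount (List.ofFn (s y)) (u y) a (v y))) :=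
      (measurable_from_nat (f := spawnProb εz)).comp hbr
    have hcast : Measurable fun y =>
        (branches εz (u y) [] a (S.actCount (List.ofFn (s y)) (u y) a (v y)) : ℝ) :=
      (measurable_from_nat (f := fun n : ℕ => (n : ℝ))).comp hbr
    refine ((π.measurable_prob hs a).coe_nnreal_real).mul
      ((hsp.mul (M.measurable_leafInt ρ hs a hf)).add
        (((measurable_const.sub hsp).div hcast).mul ?_))
    refine measurable_nat_param (g := fun c y => ∑ j ∈ Finset.range c,
      S.treeInt ρ εz T ((a, S.sampleMeas (List.ofFn (s y)) a (u y (.meas [] a j))) ::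
        List.ofFn (s y))
        (pickCount εz (u y) [] a j (S.actCount (List.ofFn (s y)) (u y) a (v y)))
        (below [(a, j)] (u y))
        (fun e => f y (Fin.cons (a, Sum.inl (S.sampleMeas (List.ofFn (s y)) a
          (u y (.meas [] a j)))) e))) (fun c => ?_) hbr
    refine Finset.measurable_sum _ fun j _ => ?_
    have hz := S.measurable_sampleMeas hs a ((measurable_pi_apply (Call.meas [] a j)).comp hu)
    have h1 := ih (n := n + 1)
      (s := fun y => Fin.cons (a, S.sampleMeas (List.ofFn (s y)) a (u y (.meas [] a j))) (s y))
      (measurable_finCons (measurable_const.prodMk hz) hs)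
      (measurable_pickCount εz hu [] a j hact) ((measurable_below [(a, j)]).comp hu)
      (f := fun y e => f y (Fin.cons (a, Sum.inl (S.sampleMeas (List.ofFn (s y)) a
          (u y (.meas [] a j)))) e))
      (hf.comp (measurable_fst.prodMk (measurable_finCons
        (measurable_const.prodMk (measurable_inl.comp (hz.comp measurable_fst))) measurable_snd)))
    simpa [List.ofFn_succ] using h1

end Measurability

/-- The weights are nonnegative with sum at most 1. If `c = 0`, the second weight is zero by the
convention for division by zero. -/
lemma abs_mixture_le {εz : ℝ} (h : εz < 0) (c : ℕ) {x B : ℝ} (hx : |x| ≤ B) {g : ℕ → ℝ}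
    (hg : ∀ j, |g j| ≤ B) :
    |spawnProb εz c * x + (1 - spawnProb εz c) / c * ∑ j ∈ Finset.range c, g j| ≤ B := by
  have hp := (spawnProb_pos (εz := εz) c).le
  have hp1 := spawnProb_le_one h c
  have hB : 0 ≤ B := (abs_nonneg x).trans hx
  have h1 : |∑ j ∈ Finset.range c, g j| ≤ c * B := by
    refine (Finset.abs_sum_le_sum_abs _ _).trans ?_
    simpa using Finset.sum_le_card_nsmul (Finset.range c) (fun j => |g j|) B fun j _ => hg j
  have h2 : |(1 - spawnProb εz c) / c * ∑ j ∈ Finset.range c, g j| ≤ (1 - spawnProb εz c) * B := by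
    rw [abs_mul, abs_of_nonneg (div_nonneg (by linarith) (Nat.cast_nonneg c))]
    rcases Nat.eq_zero_or_pos c with rfl | hc
    · simp only [Nat.cast_zero, div_zero, zero_mul]
      exact mul_nonneg (by linarith) hB
    · have hc0 : (0 : ℝ) < c := by exact_mod_cast hc
      calc (1 - spawnProb εz c) / c * |∑ j ∈ Finset.range c, g j|
          ≤ (1 - spawnProb εz c) / c * (c * B) :=
            mul_le_mul_of_nonneg_left h1 (div_nonneg (by linarith) hc0.le)
        _ = (1 - spawnProb εz c) * B := by field_simp
  have h3 : |spawnProb εz c * x| ≤ spawnProb εz c * B := by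
    rw [abs_mul, abs_of_nonneg hp]
    exact mul_le_mul_of_nonneg_left hx hp
  calc _ ≤ _ := abs_add_le _ _
    _ ≤ _ := add_le_add h3 h2
    _ = B := by ring

lemma Sampler.abs_treeInt_le {εz : ℝ} (hε : εz < 0) (T : ℕ) : ∀ (h : Hist A Z) (v : ℕ)
    (u : Call A → ℝ) {f : Steps A Z T → ℝ} {B : ℝ}, 0 ≤ B → (∀ e, |f e| ≤ B) →
      |S.treeInt ρ εz T h v u f| ≤ B := by
  induction T with
  | zero => exact fun h v u f B _ hB => hB _
  | succ T ih =>
    intro h v u f B hB0 hB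
    exact π.abs_sum_le h fun a => abs_mixture_le hε _ (M.abs_leafInt_le ρ h a hB0 hB)
      fun j => ih _ _ _ hB0 fun e => hB _

lemma Sampler.actCount_below (u : Call A → ℝ) (w : Node A) (a : A) (v : ℕ) :
    S.actCount (S.hist u w) (below w u) a v = S.actionVisits u w a v := by
  rfl

lemma Sampler.visits_cons (εz : ℝ) (u : Call A → ℝ) (w : Node A) (a : A) (j N : ℕ) :
    S.visits εz u ((a, j) :: w) N =
      pickCount εz (below w u) [] a j (S.actionVisits u w a (S.visits εz u w N)) := by
  simp [Sampler.visits, pickCount, picked_below]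

omit [Fintype A] [DecidableEq A] in
lemma measurable_cons_step {T : ℕ} (b : A × (Z ⊕ Unit)) :
    Measurable fun e : Steps A Z T => (Fin.cons b e : Steps A Z (T + 1)) :=
  measurable_finCons measurable_const measurable_id

/-- Only an inequality holds for all random numbers, since the belief at an exceptional history may
be the zero measure. -/
lemma Sampler.treeLaw_mass_le {εz : ℝ} (hε : εz < 0) (u : Call A → ℝ) (N T : ℕ) :
    ∀ w : Node A, S.treeLaw ρ εz u N T w Set.univ ≤ 1 := by
  induction T with
  | zero =>
    intro w
    simp only [Sampler.treeLaw]
    exact prob_le_one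
  | succ T ih =>
    intro w
    simp only [Sampler.treeLaw, Measure.coe_finsetSum, Finset.sum_apply, Measure.smul_apply,
      smul_eq_mul, Measure.add_apply]
    calc _ ≤ ∑ a, (π.prob (S.hist u w) a : ℝ≥0∞) * 1 := by
          refine Finset.sum_le_sum fun a _ => mul_le_mul_right ?_ _
          set c := S.children εz u N w a
          have hp := (spawnProb_pos (εz := εz) c).le
          have hp1 := spawnProb_le_one hε c
          have h1 : ∑ j ∈ Finset.range c, (S.treeLaw ρ εz u N T ((a, j) :: w)).map
              (fun e : Steps A Z T => (Fin.cons (a, Sum.inl (S.sampleMeas (S.hist u w) a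
                (u (.meas w a j)))) e : Steps A Z (T + 1))) Set.univ ≤ (c : ℝ≥0∞) := by
            calc _ ≤ ∑ j ∈ Finset.range c, (1 : ℝ≥0∞) := by
                  refine Finset.sum_le_sum fun j _ => ?_
                  rw [Measure.map_apply (measurable_cons_step _) MeasurableSet.univ]
                  exact ih _
              _ = c := by simp
          calc _ ≤ ENNReal.ofReal (spawnProb εz c) * 1 +
                ENNReal.ofReal ((1 - spawnProb εz c) / c) * c :=
                add_le_add (mul_le_mul_right (M.leaf_mass_le ρ _ a T) _) (mul_le_mul_right h1 _)
            _ ≤ ENNReal.ofReal (spawnProb εz c) + ENNReal.ofReal (1 - spawnProb εz c) := by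
                rw [mul_one]
                gcongr
                rcases Nat.eq_zero_or_pos c with hc | hc
                · simp [hc]
                · have hc0 : (0 : ℝ) < c := by exact_mod_cast hc
                  rw [← ENNReal.ofReal_natCast, ← ENNReal.ofReal_mul
                    (div_nonneg (by linarith) hc0.le), div_mul_cancel₀ _ hc0.ne']
            _ = 1 := by
                rw [← ENNReal.ofReal_add hp (by linarith)]
                simp
      _ = 1 := by
          simp only [mul_one]
          exact_mod_cast π.sum_one _

lemma Sampler.treeLaw_isFinite {εz : ℝ} (hε : εz < 0) (u : Call A → ℝ) (N T : ℕ) (w : Node A) :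
    IsFiniteMeasure (S.treeLaw ρ εz u N T w) :=
  ⟨(S.treeLaw_mass_le ρ hε u N T w).trans_lt ENNReal.one_lt_top⟩

/-- Makes the tree law at `w` intrinsic: it depends on the tree only through the history at `w`, the
number of visits of `w` and the random numbers below `w`. After this reduction the convergence can
be studied at a root with a deterministic history and visit count. -/
lemma Sampler.integral_treeLaw {εz : ℝ} (hε : εz < 0) (u : Call A → ℝ) (N T : ℕ) :
    ∀ (w : Node A) {f : Steps A Z T → ℝ}, Measurable f → ∀ {B : ℝ}, (∀ e, |f e| ≤ B) →
      ∫ e, f e ∂(S.treeLaw ρ εz u N T w) =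
        S.treeInt ρ εz T (S.hist u w) (S.visits εz u w N) (below w u) f := by
  induction T with
  | zero =>
    intro w f hf B hB
    simp only [Sampler.treeLaw, Sampler.treeInt]
    exact integral_dirac' _ _ hf.stronglyMeasurable
  | succ T ih =>
    intro w f hf B hB
    have hfin := S.treeLaw_isFinite ρ hε u N T
    have hleaf : ∀ a, Integrable f ((M.predict (S.hist u w) a).bind fun z =>
        (ρ.law ((a, z) :: S.hist u w) T).map
          fun e : Steps A Z T => (Fin.cons (a, Sum.inl z) e : Steps A Z (T + 1))) := fun a =>
      have := IsFiniteMeasure.mk ((M.leaf_mass_le ρ (S.hist u w) a T).trans_lt ENNReal.one_lt_top)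
      integrable_of_abs_le hf hB
    have hbranch : ∀ a j, Integrable f ((S.treeLaw ρ εz u N T ((a, j) :: w)).map
        fun e : Steps A Z T => (Fin.cons (a, Sum.inl (S.sampleMeas (S.hist u w) a
          (u (.meas w a j)))) e : Steps A Z (T + 1))) := fun a j =>
      integrable_of_abs_le hf hB
    have hsum : ∀ a c, Integrable f (∑ j ∈ Finset.range c, (S.treeLaw ρ εz u N T ((a, j) :: w)).map
        fun e : Steps A Z T => (Fin.cons (a, Sum.inl (S.sampleMeas (S.hist u w) a
          (u (.meas w a j)))) e : Steps A Z (T + 1))) := fun a c =>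
      integrable_finsetSum_measure.2 fun j _ => hbranch a j
    have hnn : ∀ c : ℕ, 0 ≤ (1 - spawnProb εz c) / c := fun c =>
      div_nonneg (sub_nonneg.2 (spawnProb_le_one hε c)) (Nat.cast_nonneg c)
    simp only [Sampler.treeLaw, Sampler.treeInt, S.actCount_below, branches_below]
    rw [integral_finsetSum_measure fun a _ => (((hleaf a).smul_measure ENNReal.ofReal_ne_top).add_measure
      ((hsum a _).smul_measure ENNReal.ofReal_ne_top)).smul_measure ENNReal.coe_ne_top]
    refine Finset.sum_congr rfl fun a _ => ?_
    rw [integral_smul_measure, ENNReal.coe_toReal, smul_eq_mul,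
      integral_add_measure ((hleaf a).smul_measure ENNReal.ofReal_ne_top)
        ((hsum a _).smul_measure ENNReal.ofReal_ne_top),
      integral_smul_measure, integral_smul_measure,
      integral_finsetSum_measure fun j _ => hbranch a j,
      ENNReal.toReal_ofReal (spawnProb_pos _).le, ENNReal.toReal_ofReal (hnn _)]
    simp only [smul_eq_mul]
    congr 3
    refine Finset.sum_congr rfl fun j _ => ?_
    rw [integral_map (measurable_cons_step _).aemeasurable hf.aestronglyMeasurable,
      ih _ (f := fun e => f (Fin.cons (a, Sum.inl (S.sampleMeas (S.hist u w) a
        (u (.meas w a j)))) e)) (hf.comp (measurable_cons_step _)) fun e => hB _,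
      S.visits_cons, below_below]
    rfl

end Functionals

/-! ### Independence of the random numbers attached to different branches. -/

section Blocks

lemma comap_coords_le {ι κ E : Type*} [MeasurableSpace E] (φ : κ → ι) :
    MeasurableSpace.comap (fun (u : ι → E) k => u (φ k)) MeasurableSpace.pi ≤
      ⨆ i ∈ Set.range φ, MeasurableSpace.comap (fun u : ι → E => u i) inferInstance := by
  rw [MeasurableSpace.pi, MeasurableSpace.comap_iSup]
  refine iSup_le fun k => ?_
  rw [MeasurableSpace.comap_comp]
  exact le_iSup₂_of_le (φ k) ⟨k, rfl⟩ le_rfl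

/-- Under a product measure, families of coordinates with disjoint index sets generate independent
σ-algebras. -/
lemma indepFun_infinitePi_of_disjoint {ι κ κ' E : Type*} [MeasurableSpace E] (μ : Measure E)
    [IsProbabilityMeasure μ] {φ : κ → ι} {ψ : κ' → ι} (h : ∀ k k', φ k ≠ ψ k') :
    IndepFun (fun (u : ι → E) k => u (φ k)) (fun (u : ι → E) k => u (ψ k))
      (Measure.infinitePi fun _ : ι => μ) := by
  have hind : iIndepFun (fun (i : ι) (u : ι → E) => u i) (Measure.infinitePi fun _ : ι => μ) :=
    iIndepFun_infinitePi (P := fun _ : ι => μ) (X := fun _ r => r) fun _ => measurable_id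
  have hdisj : Disjoint (Set.range φ) (Set.range ψ) := by
    rw [Set.disjoint_left]
    rintro _ ⟨k, rfl⟩ ⟨k', hk⟩
    exact h k k' hk.symm
  have h1 := indep_iSup_of_disjoint
    (m := fun i : ι => MeasurableSpace.comap (fun u : ι → E => u i) inferInstance)
    (fun i => (measurable_pi_apply i).comap_le) hind hdisj
  rw [IndepFun_iff_Indep]
  refine indep_of_indep_of_le_left (indep_of_indep_of_le_right h1 ?_) ?_
  · exact comap_coords_le ψ
  · exact comap_coords_le φ

variable {A : Type*}

lemma Call.shift_injective (w : Node A) : Function.Injective (Call.shift w) := by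
  intro c c' h
  cases c <;> cases c' <;> simp_all [Call.shift]

/-- The number of actions above the node of a call. -/
def Call.depth : Call A → ℕ
  | .action w _ => w.length
  | .spawn w _ _ => w.length
  | .pick w _ _ => w.length
  | .meas w _ _ => w.length

lemma Call.depth_shift (w : Node A) (c : Call A) : (c.shift w).depth = c.depth + w.length := by
  cases c <;> simp [Call.shift, Call.depth]

lemma map_below (w : Node A) : (callLaw A).map (below w) = callLaw A :=
  Measure.map_infinitePi_infinitePi_of_inj (P := fun _ : Call A => unif) (Call.shift_injective w)

lemma ae_below (w : Node A) {p : (Call A → ℝ) → Prop} (h : ∀ᵐ u ∂(callLaw A), p u) :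
    ∀ᵐ u ∂(callLaw A), p (below w u) := by
  rw [← map_below w] at h
  exact ae_of_ae_map (measurable_below w).aemeasurable h

/-- The random numbers that are used at and below the `j`-th branch of the root. -/
def blockCall (a : A) (j : ℕ) : Option (Call A) → Call A
  | none => .meas [] a j
  | some c => c.shift [(a, j)]

/-- The random number for the `j`-th measurement at the root, and those used below it. -/
def block (a : A) (j : ℕ) (u : Call A → ℝ) : ℝ × (Call A → ℝ) :=
  (u (.meas [] a j), below [(a, j)] u)

lemma measurable_block (a : A) (j : ℕ) : Measurable (block a j) :=
  (measurable_pi_apply _).prodMk (measurable_below _)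

lemma blockCall_ne (a : A) {j j' : ℕ} (h : j ≠ j') (c c' : Option (Call A)) :
    blockCall a j c ≠ blockCall a j' c' := by
  rcases c with _ | c <;> rcases c' with _ | c'
  · simp [blockCall, h]
  · cases c' <;> simp [blockCall, Call.shift]
  · cases c <;> simp [blockCall, Call.shift]
  · cases c <;> cases c' <;> simp [blockCall, Call.shift, h]

lemma indepFun_block (a : A) {j j' : ℕ} (h : j ≠ j') :
    IndepFun (block a j) (block a j') (callLaw A) := by
  have hg : Measurable fun x : Option (Call A) → ℝ => (x none, fun c => x (some c)) := by fun_prop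
  exact (indepFun_infinitePi_of_disjoint unif (blockCall_ne a h)).comp hg hg

/-- The measurement number of a branch and the numbers below it use disjoint calls, and the latter
are again distributed like the numbers of a full tree. -/
lemma map_block (a : A) (j : ℕ) : (callLaw A).map (block a j) = unif.prod (callLaw A) := by
  have h1 : IndepFun (fun (u : Call A → ℝ) (_ : Unit) => u (.meas [] a j))
      (fun (u : Call A → ℝ) c => u (Call.shift [(a, j)] c)) (callLaw A) :=
    indepFun_infinitePi_of_disjoint unif fun _ c => by cases c <;> simp [Call.shift]
  have h2 : IndepFun (fun u : Call A → ℝ => u (.meas [] a j)) (below [(a, j)]) (callLaw A) :=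
    h1.comp (φ := fun x : Unit → ℝ => x ()) (measurable_pi_apply _) measurable_id
  have h3 := (indepFun_iff_map_prod_eq_prod_map_map (measurable_pi_apply _).aemeasurable
    (measurable_below _).aemeasurable).1 h2
  rw [map_below, Measure.infinitePi_map_eval (fun _ : Call A => unif)] at h3
  exact h3

/-- The strong law of large numbers over the branches of the root. -/
lemma ae_tendsto_block_average (a : A) {g : ℝ × (Call A → ℝ) → ℝ} (hg : Measurable g) {B : ℝ}
    (hB : ∀ x, |g x| ≤ B) :
    ∀ᵐ u ∂(callLaw A), Tendsto (fun n : ℕ => (∑ j ∈ Finset.range n, g (block a j u)) / n) atTop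
      (𝓝 (∫ x, g x ∂(unif.prod (callLaw A)))) := by
  have h := strong_law_ae_real (μ := callLaw A) (fun j u => g (block a j u))
    (integrable_of_abs_le (hg.comp (measurable_block a 0)) fun u => hB _)
    (fun i j hij => (indepFun_block a hij).comp hg hg)
    (fun j => ⟨(hg.comp (measurable_block a j)).aemeasurable,
      (hg.comp (measurable_block a 0)).aemeasurable, by
        change (callLaw A).map (g ∘ block a j) = (callLaw A).map (g ∘ block a 0)
        rw [← Measure.map_map hg (measurable_block a j), ← Measure.map_map hg (measurable_block a 0),
          map_block, map_block]⟩)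
  rwa [← map_block a 0, integral_map (measurable_block a 0).aemeasurable hg.aestronglyMeasurable]

end Blocks

/-- Deterministic core of the induction. For each `V` the mean deviation is at most the average of
`D V` plus `B` times the fraction of branches with `n j m < V`. The limit `m → ∞` leaves `d V`, and
then `V` is taken large. The counts `n j m` may depend on everything else. -/
lemma tendsto_average_of_rarely {c : ℕ → ℕ} (hc : Tendsto c atTop atTop) {n : ℕ → ℕ → ℕ}
    {y : ℕ → ℕ → ℝ} {g : ℕ → ℝ} {D : ℕ → ℕ → ℝ} {d : ℕ → ℝ} {B γ : ℝ}
    (hB : ∀ j v, |y j v - g j| ≤ B) (hD0 : ∀ V j, 0 ≤ D V j)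
    (hD : ∀ V j, ∀ v ≥ V, |y j v - g j| ≤ D V j)
    (hDd : ∀ V, Tendsto (fun k : ℕ => (∑ j ∈ Finset.range k, D V j) / k) atTop (𝓝 (d V)))
    (hd : Tendsto d atTop (𝓝 0))
    (hg : Tendsto (fun k : ℕ => (∑ j ∈ Finset.range k, g j) / k) atTop (𝓝 γ))
    (hr : ∀ V, Tendsto (fun m => (((Finset.range (c m)).filter fun j => n j m < V).card : ℝ) / c m)
      atTop (𝓝 0)) :
    Tendsto (fun m => (∑ j ∈ Finset.range (c m), y j (n j m)) / c m) atTop (𝓝 γ) := by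
  have hdiff : Tendsto (fun m => (∑ j ∈ Finset.range (c m), (y j (n j m) - g j)) / c m) atTop
      (𝓝 0) := by
    have hbound : ∀ V m, |(∑ j ∈ Finset.range (c m), (y j (n j m) - g j)) / c m| ≤
        (∑ j ∈ Finset.range (c m), D V j) / c m +
          B * ((((Finset.range (c m)).filter fun j => n j m < V).card : ℝ) / c m) := by
      intro V m
      rw [abs_div, Nat.abs_cast, ← mul_div_assoc, ← add_div]
      gcongr
      refine (Finset.abs_sum_le_sum_abs _ _).trans ?_
      rw [mul_comm, ← nsmul_eq_mul, ← Finset.sum_const, Finset.sum_filter, ← Finset.sum_add_distrib]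
      refine Finset.sum_le_sum fun j _ => ?_
      split_ifs with h
      · linarith [hB j (n j m), hD0 V j]
      · linarith [hD V j _ (not_lt.1 h)]
    rw [Metric.tendsto_atTop]
    intro ε hε
    obtain ⟨V, hV⟩ := (hd.eventually_lt_const (half_pos hε)).exists
    have hlim := ((hDd V).comp hc).add ((hr V).const_mul B)
    rw [mul_zero, add_zero] at hlim
    obtain ⟨m₀, hm₀⟩ := eventually_atTop.1 (hlim.eventually_lt_const (hV.trans (half_lt_self hε)))
    refine ⟨m₀, fun m hm => ?_⟩
    rw [Real.dist_eq, sub_zero]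
    exact (hbound V m).trans_lt (hm₀ m hm)
  have := hdiff.add (hg.comp hc)
  rw [zero_add] at this
  refine this.congr fun m => ?_
  simp only [Function.comp_apply]
  rw [← add_div, ← Finset.sum_add_distrib]
  congr 1
  exact Finset.sum_congr rfl fun j _ => by ring

lemma tendsto_spawnProb {εz : ℝ} (h : εz < 0) : Tendsto (spawnProb εz) atTop (𝓝 0) := by
  have h1 := (tendsto_rpow_neg_atTop (neg_pos.2 h)).comp
    (tendsto_natCast_atTop_atTop.atTop_add (tendsto_const_nhds (x := (1 : ℝ))))
  simp only [neg_neg, Function.comp_def] at h1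
  exact h1

/-! ### Convergence of expectations at the root. -/

section Convergence

variable {X A Z : Type*} [MeasurableSpace X] [Fintype A] [MeasurableSpace A] [MeasurableSpace Z]
  [MeasurableSingletonClass A] [DecidableEq A] {M : POMDP X A Z} {π : Policy A Z}
  (S : Sampler M π) (ρ : Rollout A Z)

omit [DecidableEq A] [MeasurableSingletonClass A] in
lemma Sampler.measurable_sampleMeas_section (h : Hist A Z) (a : A) :
    Measurable (S.sampleMeas h a) := by
  have := S.measurable_sampleMeas (n := h.length) (s := fun _ : ℝ => h.get) measurable_const a
    measurable_id
  simpa [List.ofFn_get] using this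

omit [DecidableEq A] in
lemma Sampler.measurable_selectAction_section (h : Hist A Z) : Measurable (S.selectAction h) := by
  have := S.measurable_selectAction (n := h.length) (s := fun _ : ℝ => h.get) measurable_const
    measurable_id
  simpa [List.ofFn_get] using this

-- The sampled measurement follows the predictive law, under which degenerate posteriors have
-- probability zero. This keeps the induction inside the histories with a proper belief, the only
-- ones for which the sampler is tied to the predictive law.
omit [DecidableEq A] [MeasurableSingletonClass A] in
lemma Sampler.ae_belief_prob (h : Hist A Z) (hh : IsProbabilityMeasure (M.belief h)) (a : A) :
    ∀ᵐ r ∂unif, IsProbabilityMeasure (M.belief ((a, S.sampleMeas h a r) :: h)) := by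
  have h1 := M.belief_cons_prob h a hh
  rw [← S.sampleMeas_law h a (M.predict_prob h a hh)] at h1
  exact ae_of_ae_map (S.measurable_sampleMeas_section h a).aemeasurable h1

lemma Sampler.ae_tendsto_actCount (hπ : ∀ h a, 0 < π.prob h a) (h : Hist A Z) (a : A) :
    ∀ᵐ u ∂(callLaw A), Tendsto (S.actCount h u a) atTop atTop := by
  have h1 : ∀ᵐ u ∂(callLaw A), ∀ n, ∃ k ≥ n,
      u (Call.action [] k) ∈ {r | S.selectAction h r = a} := by
    refine ae_frequently_mem (φ := fun k => Call.action [] k) (fun k k' hk => by simpa using hk)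
      (S.measurable_selectAction_section h (measurableSet_singleton a)) ?_
    rw [S.selectAction_law]
    exact_mod_cast (hπ h a).ne'
  filter_upwards [h1] with u hu
  exact tendsto_card_filter_range hu

/-- The expectation of `f` over an episode that is run on the tree converges to the one under the
policy as the number of visits grows. -/
theorem Sampler.ae_tendsto_treeInt {εz : ℝ} (hε : εz < 0) (hε' : -1 ≤ εz)
    (hπ : ∀ h a, 0 < π.prob h a) (T : ℕ) : ∀ (h : Hist A Z), IsProbabilityMeasure (M.belief h) →
      ∀ {f : Steps A Z T → ℝ}, Measurable f → ∀ {B : ℝ}, 0 ≤ B → (∀ e, |f e| ≤ B) →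
        ∀ᵐ u ∂(callLaw A), Tendsto (fun v => S.treeInt ρ εz T h v u f) atTop
          (𝓝 (M.polInt π T h f)) := by
  induction T with
  | zero => exact fun h _ f _ B _ _ => ae_of_all _ fun u => tendsto_const_nhds
  | succ T ih =>
    intro h hh f hf B hB0 hB
    have hs : List.ofFn h.get = h := List.ofFn_get h
    have hmz : ∀ a, Measurable (S.sampleMeas h a) := S.measurable_sampleMeas_section h
    -- `Ψ a v` is the tree expectation below a branch with `v` visits as a function of the block of
    -- that branch; `Γ a` is its expected limit, a function of the measurement alone.
    set Ψ : A → ℕ → ℝ × (Call A → ℝ) → ℝ := fun a v x =>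
      S.treeInt ρ εz T ((a, S.sampleMeas h a x.1) :: h) v x.2
        (fun e => f (Fin.cons (a, Sum.inl (S.sampleMeas h a x.1)) e)) with hΨ
    set Γ : A → Z → ℝ := fun a z => M.polInt π T ((a, z) :: h)
      (fun e => f (Fin.cons (a, Sum.inl z) e)) with hΓ
    have hΓm : ∀ a, Measurable (Γ a) := by
      intro a
      have h1 := M.measurable_polInt π (Y := Unit) T (n := h.length + 1)
        (f := fun q e => f (Fin.cons ((q.1 0).1, Sum.inl (q.1 0).2) e)) (by
          refine hf.comp (measurable_finCons ?_ measurable_snd)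
          exact Measurable.prodMk (by fun_prop) (measurable_inl.comp (by fun_prop)))
      have h2 := h1.comp (f := fun z : Z =>
        ((Fin.cons (a, z) h.get : Fin (h.length + 1) → A × Z), ()))
        ((measurable_finCons (measurable_const.prodMk measurable_id) measurable_const).prodMk
          measurable_const)
      simpa [List.ofFn_succ, Function.comp_def] using h2
    have hΨm : ∀ a v, Measurable (Ψ a v) := by
      intro a v
      have hz : Measurable fun x : ℝ × (Call A → ℝ) => S.sampleMeas h a x.1 :=
        (hmz a).comp measurable_fst
      have h1 := S.measurable_treeInt ρ εz T (n := h.length + 1)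
        (s := fun x : ℝ × (Call A → ℝ) => Fin.cons (a, S.sampleMeas h a x.1) h.get)
        (measurable_finCons (measurable_const.prodMk hz) measurable_const)
        (measurable_const (a := v)) measurable_snd
        (f := fun x e => f (Fin.cons (a, Sum.inl (S.sampleMeas h a x.1)) e))
        (hf.comp (measurable_finCons (measurable_const.prodMk
          (measurable_inl.comp (hz.comp measurable_fst))) measurable_snd))
      simpa [List.ofFn_succ] using h1
    have hΨb : ∀ a v x, |Ψ a v x| ≤ B := fun a v x =>
      S.abs_treeInt_le ρ hε T _ _ _ hB0 fun e => hB _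
    have hΓb : ∀ a z, |Γ a z| ≤ B := fun a z => M.abs_polInt_le π T _ hB0 fun e => hB _
    -- The supremum over all visit counts from `V` on removes the actual random count. What is left
    -- is a function of the block alone, to which the strong law applies.
    set D : A → ℕ → ℝ × (Call A → ℝ) → ℝ := fun a V x =>
      ⨆ v : ℕ, |Ψ a (V + v) x - Γ a (S.sampleMeas h a x.1)| with hD
    have hdiff : ∀ a v x, |Ψ a v x - Γ a (S.sampleMeas h a x.1)| ≤ 2 * B := by
      intro a v x
      refine (abs_sub _ _).trans ?_
      linarith [hΨb a v x, hΓb a (S.sampleMeas h a x.1)]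
    have hDm : ∀ a V, Measurable (D a V) := fun a V => Measurable.iSup fun v =>
      ((hΨm a (V + v)).sub ((hΓm a).comp ((hmz a).comp measurable_fst))).abs
    have hbdd : ∀ a V x, BddAbove (Set.range fun v : ℕ =>
        |Ψ a (V + v) x - Γ a (S.sampleMeas h a x.1)|) := by
      rintro a V x
      exact ⟨2 * B, by rintro _ ⟨v, rfl⟩; exact hdiff a _ x⟩
    have hD0 : ∀ a V x, 0 ≤ D a V x := fun a V x => Real.iSup_nonneg fun _ => abs_nonneg _
    have hDle : ∀ a V x, D a V x ≤ 2 * B := fun a V x => ciSup_le fun v => hdiff a _ x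
    have hDv : ∀ a V x, ∀ v ≥ V, |Ψ a v x - Γ a (S.sampleMeas h a x.1)| ≤ D a V x := by
      intro a V x v hv
      have := le_ciSup (hbdd a V x) (v - V)
      simpa [Nat.add_sub_cancel' hv] using this
    -- The induction hypothesis holds for each fixed history with a proper belief; Fubini turns this
    -- into a statement about almost every block.
    have hconv : ∀ a, ∀ᵐ x ∂(unif.prod (callLaw A)),
        Tendsto (fun v => Ψ a v x - Γ a (S.sampleMeas h a x.1)) atTop (𝓝 0) := by
      intro a
      have hms : MeasurableSet {x : ℝ × (Call A → ℝ) |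
          Tendsto (fun v => Ψ a v x - Γ a (S.sampleMeas h a x.1)) atTop (𝓝 0)} :=
        measurableSet_tendsto _ fun v =>
          (hΨm a v).sub ((hΓm a).comp ((hmz a).comp measurable_fst))
      rw [Measure.ae_prod_iff_ae_ae hms]
      filter_upwards [S.ae_belief_prob h hh a] with r hr
      filter_upwards [ih _ hr (f := fun e => f (Fin.cons (a, Sum.inl (S.sampleMeas h a r)) e))
        (hf.comp (measurable_cons_step _)) hB0 fun e => hB _] with u hu
      exact tendsto_sub_nhds_zero_iff.2 hu
    have hDint : ∀ a, Tendsto (fun V => ∫ x, D a V x ∂(unif.prod (callLaw A))) atTop (𝓝 0) := by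
      intro a
      rw [← integral_zero (ℝ × (Call A → ℝ)) ℝ (μ := unif.prod (callLaw A))]
      refine tendsto_integral_of_dominated_convergence (fun _ => 2 * B)
        (fun V => (hDm a V).aestronglyMeasurable) (integrable_const _)
        (fun V => ae_of_all _ fun x => ?_) ?_
      · rw [Real.norm_eq_abs, abs_of_nonneg (hD0 a V x)]
        exact hDle a V x
      · filter_upwards [hconv a] with x hx
        rw [Metric.tendsto_atTop] at hx ⊢
        intro ε hεp
        obtain ⟨N, hN⟩ := hx (ε / 2) (half_pos hεp)
        refine ⟨N, fun V hV => ?_⟩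
        rw [Real.dist_eq, sub_zero, abs_of_nonneg (hD0 a V x)]
        refine lt_of_le_of_lt (ciSup_le fun v => ?_) (half_lt_self hεp)
        have := (hN (V + v) (by omega)).le
        rwa [Real.dist_eq, sub_zero] at this
    have hΓint : ∀ a, ∫ x, Γ a (S.sampleMeas h a x.1) ∂(unif.prod (callLaw A)) =
        ∫ z, Γ a z ∂(M.predict h a) := by
      intro a
      rw [← S.sampleMeas_law h a (M.predict_prob h a hh),
        integral_map (hmz a).aemeasurable (hΓm a).aestronglyMeasurable]
      have := integral_fun_fst (μ := unif) (ν := callLaw A) (fun r => Γ a (S.sampleMeas h a r))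
      simpa using this
    have hall : ∀ a, ∀ᵐ u ∂(callLaw A),
        (∀ V, Tendsto (fun n : ℕ => (∑ j ∈ Finset.range n, D a V (block a j u)) / n) atTop
          (𝓝 (∫ x, D a V x ∂(unif.prod (callLaw A))))) ∧
        Tendsto (fun n : ℕ => (∑ j ∈ Finset.range n, Γ a (S.sampleMeas h a (block a j u).1)) / n)
          atTop (𝓝 (∫ z, Γ a z ∂(M.predict h a))) := by
      intro a
      have h1 : ∀ᵐ u ∂(callLaw A), ∀ V,
          Tendsto (fun n : ℕ => (∑ j ∈ Finset.range n, D a V (block a j u)) / n) atTop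
            (𝓝 (∫ x, D a V x ∂(unif.prod (callLaw A)))) := by
        rw [ae_all_iff]
        intro V
        refine ae_tendsto_block_average a (hDm a V) (B := 2 * B) fun x => ?_
        rw [abs_of_nonneg (hD0 a V x)]
        exact hDle a V x
      have h2 := ae_tendsto_block_average a (g := fun x => Γ a (S.sampleMeas h a x.1))
        ((hΓm a).comp ((hmz a).comp measurable_fst)) fun x => hΓb a _
      rw [hΓint] at h2
      filter_upwards [h1, h2] with u hu1 hu2 using ⟨hu1, hu2⟩
    have hfin : ∀ᵐ u ∂(callLaw A), ∀ a : A, Tendsto (fun v =>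
        spawnProb εz (branches εz u [] a (S.actCount h u a v)) * M.leafInt ρ h a f +
        (1 - spawnProb εz (branches εz u [] a (S.actCount h u a v))) /
            branches εz u [] a (S.actCount h u a v) *
          ∑ j ∈ Finset.range (branches εz u [] a (S.actCount h u a v)),
            Ψ a (pickCount εz u [] a j (S.actCount h u a v)) (block a j u)) atTop
        (𝓝 (∫ z, Γ a z ∂(M.predict h a))) := by
      rw [ae_all_iff]
      intro a
      filter_upwards [hall a, ae_tendsto_branches hε [] a, ae_tendsto_rarely_picked hε hε' [] a,
        S.ae_tendsto_actCount hπ h a] with u hu hbr hrare hact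
      have havg := tendsto_average_of_rarely hbr
        (n := fun j m => pickCount εz u [] a j m)
        (y := fun j v => Ψ a v (block a j u))
        (g := fun j => Γ a (S.sampleMeas h a (block a j u).1))
        (D := fun V j => D a V (block a j u))
        (fun j v => hdiff a v _) (fun V j => hD0 a V _) (fun V j v hv => hDv a V _ v hv)
        hu.1 (hDint a) hu.2 hrare
      -- The weight of fresh leaves tends to zero, so the rollout policy has no influence on the
      -- limit.
      have hsp := (tendsto_spawnProb hε).comp hbr
      have hlim := ((hsp.mul_const (M.leafInt ρ h a f)).add
        (((tendsto_const_nhds (x := (1 : ℝ))).sub hsp).mul havg)).comp hact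
      rw [zero_mul, sub_zero, one_mul, zero_add] at hlim
      refine hlim.congr fun v => ?_
      simp only [Function.comp_apply]
      ring
    filter_upwards [hfin] with u hu
    simp only [Sampler.treeInt, POMDP.polInt]
    exact tendsto_finsetSum _ fun a _ => (hu a).const_mul _

end Convergence

/-! ### The law of an episode, and its actions and measurements step by step. -/

section EpisodeLaws

variable {X A Z : Type*} [MeasurableSpace X] [Fintype A] [MeasurableSpace A] [MeasurableSpace Z]
variable (M : POMDP X A Z) (π : Policy A Z)

lemma POMDP.stepsLaw_subMarkov (T : ℕ) : ∀ n : ℕ,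
    SubMarkov fun p : (Fin n → A × Z) × X => M.stepsLaw π T (List.ofFn p.1) p.2 := by
  induction T with
  | zero => exact fun n => SubMarkov.dirac measurable_const
  | succ T ih =>
    intro n
    simp only [POMDP.stepsLaw]
    refine SubMarkov.weighted_sum (fun a => ?_) (fun a => π.measurable_prob measurable_fst a)
      fun p => (π.sum_one _).le
    have h1 : SubMarkov fun q : (((Fin n → A × Z) × X) × X) × Z =>
        M.stepsLaw π T ((a, q.2) :: List.ofFn q.1.1.1) q.1.2 := by
      have h2 := (ih (n + 1)).comp (g := fun q : (((Fin n → A × Z) × X) × X) × Z =>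
        ((Fin.cons (a, q.2) q.1.1.1 : Fin (n + 1) → A × Z), q.1.2)) (by
          refine Measurable.prodMk (measurable_finCons ?_ ?_) (by fun_prop)
          · exact measurable_const.prodMk measurable_snd
          · fun_prop)
      simpa [List.ofFn_succ] using h2
    have h2 := h1.map (g := fun q s => (Fin.cons (a, q.1.2, q.2) s : Fin (T + 1) → A × X × Z)) (by
      refine measurable_finCons ?_ measurable_snd
      exact measurable_const.prodMk (by fun_prop))
    have h3 := (M.measLaw_subMarkov.comp (g := fun q : ((Fin n → A × Z) × X) × X => q.2)
      measurable_snd).bind (η := fun q z => (M.stepsLaw π T ((a, z) :: List.ofFn q.1.1) q.2).map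
        fun s => (Fin.cons (a, q.2, z) s : Fin (T + 1) → A × X × Z)) h2
    exact (M.trans_subMarkov.comp (g := fun p : (Fin n → A × Z) × X => (p.2, a)) (by fun_prop)).bind
      (η := fun p x' => (M.measLaw x').bind fun z => (M.stepsLaw π T ((a, z) :: List.ofFn p.1) x').map
        fun s => (Fin.cons (a, x', z) s : Fin (T + 1) → A × X × Z)) h3

lemma POMDP.stepsLaw_section (T : ℕ) (h : Hist A Z) :
    SubMarkov fun x => M.stepsLaw π T h x := by
  have := (M.stepsLaw_subMarkov π T h.length).comp (g := fun x : X => (h.get, x)) (by fun_prop)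
  simpa [List.ofFn_get] using this

lemma POMDP.stepsLaw_cons_section (T : ℕ) (h : Hist A Z) (a : A) :
    SubMarkov fun q : X × Z => M.stepsLaw π T ((a, q.2) :: h) q.1 := by
  have := (M.stepsLaw_subMarkov π T (h.length + 1)).comp (g := fun q : X × Z =>
    ((Fin.cons (a, q.2) h.get : Fin (h.length + 1) → A × Z), q.1)) (by
      exact Measurable.prodMk (measurable_finCons (measurable_const.prodMk measurable_snd)
        measurable_const) measurable_fst)
  simpa [List.ofFn_succ, List.ofFn_get] using this

lemma measurable_finCons_const {E : Type*} [MeasurableSpace E] {n : ℕ} (b : E) :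
    Measurable fun s : Fin n → E => (Fin.cons b s : Fin (n + 1) → E) :=
  measurable_finCons measurable_const measurable_id

lemma POMDP.lintegral_stepsLaw_succ (T : ℕ) (h : Hist A Z) (x : X)
    {F : (Fin (T + 1) → A × X × Z) → ℝ≥0∞} (hF : Measurable F) :
    ∫⁻ s, F s ∂(M.stepsLaw π (T + 1) h x) = ∑ a, (π.prob h a : ℝ≥0∞) *
      ∫⁻ x', ∫⁻ z, ∫⁻ s, F (Fin.cons (a, x', z) s) ∂(M.stepsLaw π T ((a, z) :: h) x')
        ∂(M.measLaw x') ∂(M.trans (x, a)) := by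
  simp only [POMDP.stepsLaw, lintegral_finsetSum_measure, lintegral_smul_measure, smul_eq_mul]
  refine Finset.sum_congr rfl fun a _ => ?_
  have h2 : SubMarkov fun q : X × Z => (M.stepsLaw π T ((a, q.2) :: h) q.1).map
      fun s => (Fin.cons (a, q.1, q.2) s : Fin (T + 1) → A × X × Z) :=
    (M.stepsLaw_cons_section π T h a).map
      (g := fun q s => (Fin.cons (a, q.1, q.2) s : Fin (T + 1) → A × X × Z))
      (measurable_finCons (measurable_const.prodMk measurable_fst) measurable_snd)
  have h3 : SubMarkov fun x' : X => (M.measLaw x').bind fun z =>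
      (M.stepsLaw π T ((a, z) :: h) x').map
        fun s => (Fin.cons (a, x', z) s : Fin (T + 1) → A × X × Z) :=
    M.measLaw_subMarkov.bind (η := fun x' z => (M.stepsLaw π T ((a, z) :: h) x').map
      fun s => (Fin.cons (a, x', z) s : Fin (T + 1) → A × X × Z)) h2
  congr 1
  rw [Measure.lintegral_bind h3.measurable.aemeasurable hF.aemeasurable]
  refine lintegral_congr fun x' => ?_
  have h4 : Measurable fun z => (M.stepsLaw π T ((a, z) :: h) x').map
      fun s => (Fin.cons (a, x', z) s : Fin (T + 1) → A × X × Z) :=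
    h2.measurable.comp measurable_prodMk_left
  rw [Measure.lintegral_bind h4.aemeasurable hF.aemeasurable]
  refine lintegral_congr fun z => ?_
  rw [lintegral_map hF (measurable_finCons_const _)]

lemma POMDP.stepsLaw_prob (T : ℕ) : ∀ (h : Hist A Z) (x : X),
    IsProbabilityMeasure (M.stepsLaw π T h x) := by
  induction T with
  | zero =>
    intro h x
    simp only [POMDP.stepsLaw]
    infer_instance
  | succ T ih =>
    intro h x
    refine ⟨?_⟩
    rw [← lintegral_one, M.lintegral_stepsLaw_succ π T h x measurable_const]
    have := M.measLaw_prob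
    simp only [lintegral_const, measure_univ, mul_one]
    exact_mod_cast π.sum_one h

lemma POMDP.lintegral_episodeLaw (T : ℕ) (h : Hist A Z)
    {F : X × (Fin T → A × X × Z) → ℝ≥0∞} (hF : Measurable F) :
    ∫⁻ q, F q ∂(M.episodeLaw π T h) =
      ∫⁻ x, ∫⁻ s, F (x, s) ∂(M.stepsLaw π T h x) ∂(M.belief h) := by
  have h1 : SubMarkov fun x => (M.stepsLaw π T h x).map (Prod.mk x) :=
    (M.stepsLaw_section π T h).map (g := Prod.mk) measurable_id
  rw [POMDP.episodeLaw, Measure.lintegral_bind h1.measurable.aemeasurable hF.aemeasurable]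
  exact lintegral_congr fun x => lintegral_map hF measurable_prodMk_left

lemma POMDP.episodeLaw_prob (T : ℕ) (h : Hist A Z) (hh : IsProbabilityMeasure (M.belief h)) :
    IsProbabilityMeasure (M.episodeLaw π T h) := by
  refine ⟨?_⟩
  have := M.stepsLaw_prob π T h
  rw [← lintegral_one, M.lintegral_episodeLaw π T h measurable_const]
  simp

/-- The actions and measurements of an episode. -/
def observed {T : ℕ} (s : Fin T → A × X × Z) : Steps A Z T :=
  fun i => ((s i).1, Sum.inl (s i).2.2)

omit [Fintype A] in
lemma measurable_observed {T : ℕ} :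
    Measurable fun s : Fin T → A × X × Z => (observed s : Steps A Z T) :=
  measurable_pi_lambda _ fun i => Measurable.prodMk (by fun_prop) (measurable_inl.comp (by fun_prop))

omit [Fintype A] [MeasurableSpace X] [MeasurableSpace A] [MeasurableSpace Z] in
lemma observed_cons {T : ℕ} (b : A × X × Z) (s : Fin T → A × X × Z) :
    (observed (Fin.cons b s : Fin (T + 1) → A × X × Z) : Steps A Z (T + 1)) =
      Fin.cons (b.1, Sum.inl b.2.2) (observed s) := by
  funext i
  refine Fin.cases ?_ (fun j => ?_) i <;> simp [observed]

lemma POMDP.lintegral_policyLaw (T : ℕ) (h : Hist A Z) {F : Steps A Z T → ℝ≥0∞}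
    (hF : Measurable F) :
    ∫⁻ e, F e ∂(M.policyLaw π T h) =
      ∫⁻ x, ∫⁻ s, F (observed s) ∂(M.stepsLaw π T h x) ∂(M.belief h) := by
  have h1 : Measurable fun q : X × (Fin T → A × X × Z) => (observed q.2 : Steps A Z T) :=
    measurable_observed.comp measurable_snd
  rw [POMDP.policyLaw]
  refine (lintegral_map hF h1).trans ?_
  exact M.lintegral_episodeLaw π T h (hF.comp h1)

lemma POMDP.policyLaw_prob (T : ℕ) (h : Hist A Z) (hh : IsProbabilityMeasure (M.belief h)) :
    IsProbabilityMeasure (M.policyLaw π T h) := by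
  refine ⟨?_⟩
  have := M.stepsLaw_prob π T h
  rw [← lintegral_one, M.lintegral_policyLaw π T h measurable_const]
  simp

omit [Fintype A] in
lemma POMDP.belief_cons_section (h : Hist A Z) (a : A) :
    SubMarkov fun z => M.belief ((a, z) :: h) := by
  have := (M.belief_subMarkov (h.length + 1)).comp
    (g := fun z : Z => (Fin.cons (a, z) h.get : Fin (h.length + 1) → A × Z))
    (measurable_finCons (measurable_const.prodMk measurable_id) measurable_const)
  simpa [List.ofFn_succ, List.ofFn_get] using this

lemma POMDP.policyLaw_cons_section (T : ℕ) (h : Hist A Z) (a : A) :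
    SubMarkov fun z => M.policyLaw π T ((a, z) :: h) := by
  have h1 : SubMarkov fun z => M.episodeLaw π T ((a, z) :: h) :=
    (M.belief_cons_section h a).bind
      (η := fun z x => (M.stepsLaw π T ((a, z) :: h) x).map (Prod.mk x))
      (((M.stepsLaw_cons_section π T h a).comp measurable_swap).map (g := fun q => Prod.mk q.2)
        (Measurable.prodMk (by fun_prop) measurable_snd))
  exact h1.map (g := fun _ q => observed q.2)
    (measurable_observed.comp (measurable_snd.comp measurable_snd))

/-- The law of the actions and measurements of an episode, step by step. -/
lemma POMDP.policyLaw_succ (T : ℕ) (h : Hist A Z) (hh : IsProbabilityMeasure (M.belief h)) :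
    M.policyLaw π (T + 1) h = ∑ a, (π.prob h a : ℝ≥0∞) • (M.predict h a).bind fun z =>
      (M.policyLaw π T ((a, z) :: h)).map
        fun e => (Fin.cons (a, Sum.inl z) e : Steps A Z (T + 1)) := by
  refine Measure.ext_of_lintegral _ fun F hF => ?_
  rw [M.lintegral_policyLaw π (T + 1) h hF]
  simp_rw [fun x => M.lintegral_stepsLaw_succ π T h x (F := fun s => F (observed s))
    (hF.comp measurable_observed)]
  have hin : ∀ a, Measurable fun q : X × Z =>
      ∫⁻ s, F (observed (Fin.cons (a, q.1, q.2) s : Fin (T + 1) → A × X × Z))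
        ∂(M.stepsLaw π T ((a, q.2) :: h) q.1) := fun a =>
    (M.stepsLaw_cons_section π T h a).measurable_lintegral
      (f := fun q s => F (observed (Fin.cons (a, q.1, q.2) s : Fin (T + 1) → A × X × Z)))
      (hF.comp (measurable_observed.comp
        (measurable_finCons (measurable_const.prodMk measurable_fst) measurable_snd)))
  have hin2 : ∀ a, Measurable fun x' => ∫⁻ z,
      ∫⁻ s, F (observed (Fin.cons (a, x', z) s : Fin (T + 1) → A × X × Z))
        ∂(M.stepsLaw π T ((a, z) :: h) x') ∂(M.measLaw x') := fun a =>
    M.measLaw_subMarkov.measurable_lintegral (f := fun x' z =>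
      ∫⁻ s, F (observed (Fin.cons (a, x', z) s : Fin (T + 1) → A × X × Z))
        ∂(M.stepsLaw π T ((a, z) :: h) x')) (hin a)
  have htr : ∀ a, Measurable fun x => ∫⁻ x', ∫⁻ z,
      ∫⁻ s, F (observed (Fin.cons (a, x', z) s : Fin (T + 1) → A × X × Z))
        ∂(M.stepsLaw π T ((a, z) :: h) x') ∂(M.measLaw x') ∂(M.trans (x, a)) := fun a =>
    (M.trans_subMarkov.comp (g := fun x : X => (x, a)) (by fun_prop)).measurable_lintegral
      ((hin2 a).comp measurable_snd)
  simp only [lintegral_finsetSum_measure, lintegral_smul_measure, smul_eq_mul]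
  rw [lintegral_finsetSum _ fun a _ => (htr a).const_mul _]
  refine Finset.sum_congr rfl fun a _ => ?_
  rw [lintegral_const_mul _ (htr a)]
  congr 1
  -- The belief and the transition are merged into the predicted state law, so that Bayes' rule can
  -- exchange the sampling order of next state and measurement.
  rw [← Measure.lintegral_bind (m := M.belief h) (μ := fun x => M.trans (x, a))
    (M.trans_section_measurable a).aemeasurable (hin2 a).aemeasurable]
  refine (M.lintegral_predict_belief h a hh (F := fun x' z =>
    ∫⁻ s, F (observed (Fin.cons (a, x', z) s : Fin (T + 1) → A × X × Z))
      ∂(M.stepsLaw π T ((a, z) :: h) x')) (hin a)).symm.trans ?_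
  have hmap : SubMarkov fun z => (M.policyLaw π T ((a, z) :: h)).map
      fun e => (Fin.cons (a, Sum.inl z) e : Steps A Z (T + 1)) :=
    (M.policyLaw_cons_section π T h a).map
      (g := fun z e => (Fin.cons (a, Sum.inl z) e : Steps A Z (T + 1)))
      (measurable_finCons (measurable_const.prodMk (measurable_inl.comp measurable_fst))
        measurable_snd)
  rw [Measure.lintegral_bind hmap.measurable.aemeasurable hF.aemeasurable]
  refine lintegral_congr fun z => ?_
  rw [lintegral_map hF (measurable_finCons_const _),
    M.lintegral_policyLaw π T _ (F := fun e => F (Fin.cons (a, Sum.inl z) e))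
      (hF.comp (measurable_finCons_const _))]
  simp only [observed_cons]

/-- Identifies the state-based law of an episode with the recursion through predictive laws, the
form that the tree reproduces. The recursion requires proper beliefs, which persist after almost
every measurement. -/
lemma POMDP.integral_policyLaw (T : ℕ) : ∀ (h : Hist A Z), IsProbabilityMeasure (M.belief h) →
    ∀ {f : Steps A Z T → ℝ}, Measurable f → ∀ {B : ℝ}, (∀ e, |f e| ≤ B) →
      ∫ e, f e ∂(M.policyLaw π T h) = M.polInt π T h f := by
  induction T with
  | zero =>
    intro h hh f hf B hB
    have := M.policyLaw_prob π 0 h hh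
    have hc : ∀ e, f e = f Fin.elim0 := fun e => by congr 1; exact Subsingleton.elim _ _
    simp only [POMDP.polInt]
    rw [integral_congr_ae (ae_of_all _ hc)]
    simp
  | succ T ih =>
    intro h hh f hf B hB
    have hmap : ∀ a, SubMarkov fun z => (M.policyLaw π T ((a, z) :: h)).map
        fun e => (Fin.cons (a, Sum.inl z) e : Steps A Z (T + 1)) := fun a =>
      (M.policyLaw_cons_section π T h a).map
        (g := fun z e => (Fin.cons (a, Sum.inl z) e : Steps A Z (T + 1)))
        (measurable_finCons (measurable_const.prodMk (measurable_inl.comp measurable_fst))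
          measurable_snd)
    have hpred : ∀ a, IsProbabilityMeasure (M.predict h a) := fun a => M.predict_prob h a hh
    have hint : ∀ a, Integrable f ((M.predict h a).bind fun z =>
        (M.policyLaw π T ((a, z) :: h)).map
          fun e => (Fin.cons (a, Sum.inl z) e : Steps A Z (T + 1))) := fun a => by
      have : IsProbabilityMeasure ((M.predict h a).bind fun z =>
          (M.policyLaw π T ((a, z) :: h)).map
            fun e => (Fin.cons (a, Sum.inl z) e : Steps A Z (T + 1))) := by
        refine bind_univ_of_prob (hmap a).measurable ?_
        filter_upwards [M.belief_cons_prob h a hh] with z hz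
        have := M.policyLaw_prob π T _ hz
        exact Measure.isProbabilityMeasure_map (measurable_finCons_const _).aemeasurable
      exact integrable_of_abs_le hf hB
    rw [M.policyLaw_succ π T h hh,
      integral_finsetSum_measure fun a _ => (hint a).smul_measure ENNReal.coe_ne_top]
    simp only [POMDP.polInt]
    refine Finset.sum_congr rfl fun a _ => ?_
    rw [integral_smul_measure, ENNReal.coe_toReal, smul_eq_mul,
      integral_bind_of_integrable (hmap a).measurable (hint a)]
    congr 1
    refine integral_congr_ae ?_
    filter_upwards [M.belief_cons_prob h a hh] with z hz
    rw [integral_map (measurable_finCons_const _).aemeasurable hf.aestronglyMeasurable]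
    exact ih _ hz (hf.comp (measurable_finCons_const _)) fun e => hB _

end EpisodeLaws

/-! ### From the root to every node of the tree. -/

section Nodes

variable {X A Z : Type*} [MeasurableSpace X] [Fintype A] [MeasurableSpace A] [MeasurableSpace Z]
  [MeasurableSingletonClass A] [DecidableEq A] {M : POMDP X A Z} {π : Policy A Z}
  (S : Sampler M π) (ρ : Rollout A Z)

-- Only measurement calls at strictly shallower nodes enter the history; this is the source of its
-- independence from the numbers below the node.
omit [MeasurableSingletonClass A] [DecidableEq A] in
lemma Sampler.hist_congr {u u' : Call A → ℝ} : ∀ {w : Node A},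
    (∀ c : Call A, c.depth < w.length → u c = u' c) → S.hist u w = S.hist u' w
  | [], _ => rfl
  | (a, j) :: w, h => by
    have h1 : S.hist u w = S.hist u' w :=
      Sampler.hist_congr fun c hc => h c (hc.trans (by simp))
    simp only [Sampler.hist, h1, h (.meas w a j) (by simp [Call.depth])]

omit [MeasurableSingletonClass A] [DecidableEq A] in
lemma Sampler.exists_measurable_hist : ∀ w : Node A,
    ∃ σ : (Call A → ℝ) → Fin w.length → A × Z, Measurable σ ∧ ∀ u, S.hist u w = List.ofFn (σ u)
  | [] => ⟨fun _ => Fin.elim0, measurable_const, fun _ => by simp [Sampler.hist]⟩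
  | (a, j) :: w => by
    obtain ⟨σ, hσ, hh⟩ := Sampler.exists_measurable_hist w
    refine ⟨fun u => Fin.cons (a, S.sampleMeas (List.ofFn (σ u)) a (u (.meas w a j))) (σ u),
      measurable_finCons (measurable_const.prodMk (S.measurable_sampleMeas hσ a
        (measurable_pi_apply _))) hσ, fun u => ?_⟩
    rw [Sampler.hist, hh]
    exact (List.ofFn_cons _ _).symm

omit [MeasurableSingletonClass A] [DecidableEq A] in
/-- The history at a node is independent of the random numbers used below it, so that a property
that holds almost surely for every history holds at the node. -/
lemma Sampler.ae_of_forall_hist (w : Node A)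
    (hw : ∀ᵐ u ∂(callLaw A), IsProbabilityMeasure (M.belief (S.hist u w)))
    {p : Hist A Z → (Call A → ℝ) → Prop}
    (hp : ∀ n, MeasurableSet {q : (Fin n → A × Z) × (Call A → ℝ) | p (List.ofFn q.1) q.2})
    (h : ∀ h, IsProbabilityMeasure (M.belief h) → ∀ᵐ u ∂(callLaw A), p h u) :
    ∀ᵐ u ∂(callLaw A), p (S.hist u w) (below w u) := by
  classical
  obtain ⟨σ, hσ, hh⟩ := S.exists_measurable_hist w
  have hind : IndepFun σ (below w) (callLaw A) := by
    -- Extension by zero exhibits `σ` as a measurable function of the shallow calls alone. Calls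
    -- below `w` have depth at least `w.length`, so the two index sets are disjoint.
    let ext : ({c : Call A // c.depth < w.length} → ℝ) → Call A → ℝ :=
      fun x c => if hc : c.depth < w.length then x ⟨c, hc⟩ else 0
    have hext : Measurable ext := by
      refine measurable_pi_lambda _ fun c => ?_
      by_cases hc : c.depth < w.length
      · simp only [ext, hc, dite_true]
        exact measurable_pi_apply _
      · simp only [ext, hc, dite_false]
        exact measurable_const
    have h1 : IndepFun (fun (u : Call A → ℝ) (c : {c : Call A // c.depth < w.length}) => u c)
        (below w) (callLaw A) :=
      indepFun_infinitePi_of_disjoint unif (φ := Subtype.val) (ψ := Call.shift w) fun c c' hcc => by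
        have := c.2
        rw [hcc, Call.depth_shift] at this
        omega
    have h2 := h1.comp (hσ.comp hext) measurable_id
    have h3 : (σ ∘ ext) ∘ (fun (u : Call A → ℝ) (c : {c : Call A // c.depth < w.length}) => u c) =
        σ := by
      funext u
      refine List.ofFn_injective ?_
      simp only [Function.comp_apply]
      rw [← hh, ← hh]
      refine S.hist_congr fun c hc => ?_
      simp [ext, hc]
    rwa [h3] at h2
  have hlaw := (indepFun_iff_map_prod_eq_prod_map_map hσ.aemeasurable
    (measurable_below w).aemeasurable).1 hind
  rw [map_below] at hlaw
  have hgood : ∀ᵐ s ∂((callLaw A).map σ), IsProbabilityMeasure (M.belief (List.ofFn s)) := by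
    have hms : MeasurableSet {s : Fin w.length → A × Z |
        IsProbabilityMeasure (M.belief (List.ofFn s))} := by
      have : {s : Fin w.length → A × Z | IsProbabilityMeasure (M.belief (List.ofFn s))} =
          {s | M.belief (List.ofFn s) Set.univ = 1} := by
        ext s
        exact isProbabilityMeasure_iff
      rw [this]
      exact ((Measure.measurable_coe MeasurableSet.univ).comp
        (M.belief_subMarkov w.length).measurable) (measurableSet_singleton 1)
    rw [ae_map_iff hσ.aemeasurable hms]
    exact hw.mono fun u hu => by rwa [hh] at hu
  have hall : ∀ᵐ q ∂((callLaw A).map fun u => (σ u, below w u)), p (List.ofFn q.1) q.2 := by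
    rw [hlaw, Measure.ae_prod_iff_ae_ae (hp _)]
    exact hgood.mono fun s hs => h _ hs
  have := ae_of_ae_map (hσ.prodMk (measurable_below w)).aemeasurable hall
  exact this.mono fun u hu => by rwa [hh]

-- Induction along the path: given a proper belief at the parent, the measurement on the new branch
-- leads almost surely to a proper posterior. Countability of the set of nodes gives one null set
-- for all of them.
omit [MeasurableSingletonClass A] [DecidableEq A] in
lemma Sampler.ae_belief_hist_prob :
    ∀ᵐ u ∂(callLaw A), ∀ w : Node A, IsProbabilityMeasure (M.belief (S.hist u w)) := by
  rw [ae_all_iff]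
  intro w
  induction w with
  | nil => exact ae_of_all _ fun u => M.b0_prob
  | cons b w ih =>
    obtain ⟨a, j⟩ := b
    refine S.ae_of_forall_hist w ih (p := fun h u =>
      IsProbabilityMeasure (M.belief ((a, S.sampleMeas h a (u (.meas [] a j))) :: h))) ?_ ?_
    · intro n
      have hm := (M.belief_subMarkov (n + 1)).comp
        (g := fun q : (Fin n → A × Z) × (Call A → ℝ) =>
          (Fin.cons (a, S.sampleMeas (List.ofFn q.1) a (q.2 (.meas [] a j))) q.1 :
            Fin (n + 1) → A × Z))
        (measurable_finCons (measurable_const.prodMk (S.measurable_sampleMeas measurable_fst a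
          ((measurable_pi_apply _).comp measurable_snd))) measurable_fst)
      have : {q : (Fin n → A × Z) × (Call A → ℝ) | IsProbabilityMeasure (M.belief
          ((a, S.sampleMeas (List.ofFn q.1) a (q.2 (.meas [] a j))) :: List.ofFn q.1))} =
          {q | M.belief (List.ofFn (Fin.cons (a, S.sampleMeas (List.ofFn q.1) a
            (q.2 (.meas [] a j))) q.1 : Fin (n + 1) → A × Z)) Set.univ = 1} := by
        ext q
        rw [Set.mem_ofPred_eq, Set.mem_ofPred_eq, List.ofFn_cons]
        exact isProbabilityMeasure_iff
      rw [this]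
      exact ((Measure.measurable_coe MeasurableSet.univ).comp hm.measurable)
        (measurableSet_singleton 1)
    · intro h hh
      have h1 := S.ae_belief_prob h hh a
      rw [← Measure.infinitePi_map_eval (fun _ : Call A => unif) (.meas [] a j)] at h1
      exact ae_of_ae_map (measurable_pi_apply _).aemeasurable h1

/-- Every node of the tree is visited infinitely often. -/
lemma Sampler.ae_tendsto_visits {εz : ℝ} (hε : εz < 0) (hε' : -1 ≤ εz)
    (hπ : ∀ h a, 0 < π.prob h a) :
    ∀ᵐ u ∂(callLaw A), ∀ w : Node A, Tendsto (S.visits εz u w) atTop atTop := by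
  rw [ae_all_iff]
  intro w
  induction w with
  | nil => exact ae_of_all _ fun u => tendsto_id
  | cons b w ih =>
    obtain ⟨a, j⟩ := b
    have hact := S.ae_of_forall_hist w (ae_all_iff.1 S.ae_belief_hist_prob w)
      (p := fun h u => Tendsto (S.actCount h u a) atTop atTop)
      (fun n => measurableSet_tendsto _ fun v =>
        S.measurable_actCount measurable_fst measurable_snd a measurable_const)
      fun h _ => S.ae_tendsto_actCount hπ h a
    filter_upwards [ih, hact, ae_below w (ae_tendsto_pickCount hε hε' [] a)] with u h1 h2 h3
    -- Visits of a child are picks of its branch, counted in selections of its action, counted in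
    -- visits of the parent; all three counters diverge.
    have h4 := ((h3 j).comp h2).comp h1
    refine h4.congr fun N => ?_
    simp only [Function.comp_apply]
    rw [S.visits_cons, S.actCount_below]

/-- The expectations under the tree converge to those under the policy at every node, for a
function of the next steps that may depend on the history at the node. -/
theorem Sampler.ae_tendsto_integral_treeLaw {εz : ℝ} (hε : εz < 0) (hε' : -1 ≤ εz)
    (hπ : ∀ h a, 0 < π.prob h a) {T : ℕ} {f : Hist A Z → Steps A Z T → ℝ}
    (hf : ∀ n, Measurable fun q : (Fin n → A × Z) × Steps A Z T => f (List.ofFn q.1) q.2)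
    {B : ℝ} (hB0 : 0 ≤ B) (hB : ∀ h e, |f h e| ≤ B) :
    ∀ᵐ u ∂(callLaw A), ∀ w : Node A,
      Tendsto (fun N => ∫ e, f (S.hist u w) e ∂(S.treeLaw ρ εz u N T w)) atTop
        (𝓝 (∫ e, f (S.hist u w) e ∂(M.policyLaw π T (S.hist u w)))) := by
  have hsec : ∀ h, Measurable (f h) := by
    intro h
    have := (hf h.length).comp (measurable_prodMk_left (x := h.get))
    simpa [List.ofFn_get, Function.comp_def] using this
  have hnode : ∀ᵐ u ∂(callLaw A), ∀ w : Node A,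
      Tendsto (fun v => S.treeInt ρ εz T (S.hist u w) v (below w u) (f (S.hist u w))) atTop
        (𝓝 (M.polInt π T (S.hist u w) (f (S.hist u w)))) := by
    rw [ae_all_iff]
    intro w
    refine S.ae_of_forall_hist w (ae_all_iff.1 S.ae_belief_hist_prob w)
      (p := fun h u => Tendsto (fun v => S.treeInt ρ εz T h v u (f h)) atTop
        (𝓝 (M.polInt π T h (f h)))) (fun n => ?_)
      fun h hh => S.ae_tendsto_treeInt ρ hε hε' hπ T h hh (hsec h) hB0 (hB h)
    have h1 : ∀ v : ℕ, Measurable fun q : (Fin n → A × Z) × (Call A → ℝ) =>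
        S.treeInt ρ εz T (List.ofFn q.1) v q.2 (f (List.ofFn q.1)) := fun v =>
      S.measurable_treeInt ρ εz T measurable_fst measurable_const measurable_snd
        ((hf n).comp (Measurable.prodMk (by fun_prop) measurable_snd))
    have h2 : Measurable fun q : (Fin n → A × Z) × (Call A → ℝ) =>
        M.polInt π T (List.ofFn q.1) (f (List.ofFn q.1)) :=
      M.measurable_polInt π T (f := fun q : (Fin n → A × Z) × (Call A → ℝ) => f (List.ofFn q.1))
        ((hf n).comp (Measurable.prodMk (by fun_prop) measurable_snd))
    have : {q : (Fin n → A × Z) × (Call A → ℝ) |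
        Tendsto (fun v => S.treeInt ρ εz T (List.ofFn q.1) v q.2 (f (List.ofFn q.1))) atTop
          (𝓝 (M.polInt π T (List.ofFn q.1) (f (List.ofFn q.1))))} =
        {q | Tendsto (fun v => S.treeInt ρ εz T (List.ofFn q.1) v q.2 (f (List.ofFn q.1)) -
          M.polInt π T (List.ofFn q.1) (f (List.ofFn q.1))) atTop (𝓝 0)} := by
      ext q
      exact tendsto_sub_nhds_zero_iff.symm
    rw [this]
    exact measurableSet_tendsto _ fun v => (h1 v).sub h2
  filter_upwards [hnode, S.ae_tendsto_visits hε hε' hπ, S.ae_belief_hist_prob] with u h1 h2 h3 w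
  rw [M.integral_policyLaw π T _ (h3 w) (hsec _) (hB _)]
  refine ((h1 w).comp (h2 w)).congr fun N => ?_
  exact (S.integral_treeLaw ρ hε u N T w (hsec _) (hB _)).symm

end Nodes

/-! ### Forward-simulated trajectories and measurement densities. -/

section Trajectories

variable {X A Z : Type*} [MeasurableSpace X] [MeasurableSpace A] [MeasurableSpace Z]
variable (M : POMDP X A Z)

lemma POMDP.trajLaw_subMarkov (T : ℕ) :
    SubMarkov fun p : (Fin T → A) × X => M.trajLaw T p.1 p.2 := by
  induction T with
  | zero => exact SubMarkov.dirac (measurable_pi_lambda _ fun _ => measurable_snd)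
  | succ T ih =>
    simp only [POMDP.trajLaw]
    have h1 : SubMarkov fun q : ((Fin (T + 1) → A) × X) × X =>
        (M.trajLaw T (Fin.tail q.1.1) q.2).map
          fun s : Fin (T + 1) → X => (Fin.cons q.1.2 s : Fin (T + 2) → X) :=
      (ih.comp (g := fun q : ((Fin (T + 1) → A) × X) × X => (Fin.tail q.1.1, q.2))
        (Measurable.prodMk (measurable_pi_lambda _ fun _ => by unfold Fin.tail; fun_prop)
          measurable_snd)).map
        (g := fun q s => (Fin.cons q.1.2 s : Fin (T + 2) → X))
        (measurable_finCons (by fun_prop) measurable_snd)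
    exact (M.trans_subMarkov.comp (g := fun p : (Fin (T + 1) → A) × X => (p.2, p.1 0))
      (by fun_prop)).bind
      (η := fun p x' => (M.trajLaw T (Fin.tail p.1) x').map
        fun s : Fin (T + 1) → X => (Fin.cons p.2 s : Fin (T + 2) → X)) h1

lemma POMDP.trajLaw_section (T : ℕ) (u : Fin T → A) : SubMarkov fun x => M.trajLaw T u x :=
  (M.trajLaw_subMarkov T).comp (g := fun x : X => (u, x)) (by fun_prop)

lemma POMDP.lintegral_trajLaw_succ (T : ℕ) (u : Fin (T + 1) → A) (x : X)
    {G : (Fin (T + 2) → X) → ℝ≥0∞} (hG : Measurable G) :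
    ∫⁻ y, G y ∂(M.trajLaw (T + 1) u x) =
      ∫⁻ x', ∫⁻ y, G (Fin.cons x y) ∂(M.trajLaw T (Fin.tail u) x') ∂(M.trans (x, u 0)) := by
  have h1 : SubMarkov fun x' => (M.trajLaw T (Fin.tail u) x').map
      fun s : Fin (T + 1) → X => (Fin.cons x s : Fin (T + 2) → X) :=
    (M.trajLaw_section T (Fin.tail u)).map (g := fun _ s => (Fin.cons x s : Fin (T + 2) → X))
      (measurable_finCons measurable_const measurable_snd)
  simp only [POMDP.trajLaw]
  rw [Measure.lintegral_bind h1.measurable.aemeasurable hG.aemeasurable]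
  exact lintegral_congr fun x' => lintegral_map hG (measurable_finCons_const _)

lemma POMDP.trajLaw_prob (T : ℕ) : ∀ (u : Fin T → A) (x : X),
    IsProbabilityMeasure (M.trajLaw T u x) := by
  induction T with
  | zero =>
    intro u x
    simp only [POMDP.trajLaw]
    infer_instance
  | succ T ih =>
    intro u x
    refine ⟨?_⟩
    rw [← lintegral_one, M.lintegral_trajLaw_succ T u x measurable_const]
    simp

lemma POMDP.forwardLaw_subMarkov (n T : ℕ) :
    SubMarkov fun p : (Fin n → A × Z) × (Fin T → A) => M.forwardLaw (List.ofFn p.1) p.2 :=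
  ((M.belief_subMarkov n).comp measurable_fst).bind
    (η := fun p x => M.trajLaw T p.2 x)
    ((M.trajLaw_subMarkov T).comp
      (g := fun q : ((Fin n → A × Z) × (Fin T → A)) × X => (q.1.2, q.2)) (by fun_prop))

lemma POMDP.forwardLaw_section (h : Hist A Z) (T : ℕ) :
    SubMarkov fun u : Fin T → A => M.forwardLaw h u := by
  have := (M.forwardLaw_subMarkov h.length T).comp (g := fun u : Fin T → A => (h.get, u))
    (by fun_prop)
  simpa [List.ofFn_get] using this

lemma POMDP.forwardLaw_prob (h : Hist A Z) (hh : IsProbabilityMeasure (M.belief h)) {T : ℕ}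
    (u : Fin T → A) : IsProbabilityMeasure (M.forwardLaw h u) :=
  bind_univ_of_prob (M.trajLaw_section T u).measurable (ae_of_all _ fun x => M.trajLaw_prob T u x)

lemma POMDP.lintegral_forwardLaw (h : Hist A Z) {T : ℕ} (u : Fin T → A)
    {G : (Fin (T + 1) → X) → ℝ≥0∞} (hG : Measurable G) :
    ∫⁻ y, G y ∂(M.forwardLaw h u) = ∫⁻ x, ∫⁻ y, G y ∂(M.trajLaw T u x) ∂(M.belief h) :=
  Measure.lintegral_bind (M.trajLaw_section T u).measurable.aemeasurable hG.aemeasurable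

lemma lintegral_pi_succ {E : Type*} [MeasurableSpace E] (μ : Measure E) [SigmaFinite μ] (n : ℕ)
    {f : (Fin (n + 1) → E) → ℝ≥0∞} (hf : Measurable f) :
    ∫⁻ z, f z ∂(Measure.pi fun _ : Fin (n + 1) => μ) =
      ∫⁻ z₀, ∫⁻ z, f (Fin.cons z₀ z) ∂(Measure.pi fun _ : Fin n => μ) ∂μ := by
  have h1 := (measurePreserving_piFinSuccAbove (fun _ : Fin (n + 1) => μ) 0).symm
  rw [← h1.lintegral_comp hf, lintegral_prod (fun q => f ((MeasurableEquiv.piFinSuccAbove (fun _ => E) 0).symm q))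
    (hf.comp h1.measurable).aemeasurable]
  refine lintegral_congr fun x => lintegral_congr fun y => congrArg f ?_
  simp [MeasurableEquiv.piFinSuccAbove_symm_apply, Fin.insertNthEquiv]

/-- The product of the measurement densities along a trajectory. -/
def POMDP.density {T : ℕ} (y : Fin (T + 1) → X) (z : Fin T → Z) : ℝ≥0∞ :=
  ∏ i, (M.obs (y i.succ) (z i) : ℝ≥0∞)

lemma POMDP.measurable_density {Y : Type*} [MeasurableSpace Y] {T : ℕ} {f : Y → Fin (T + 1) → X}
    (hf : Measurable f) {g : Y → Fin T → Z} (hg : Measurable g) :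
    Measurable fun q => M.density (f q) (g q) :=
  Finset.measurable_prod _ fun _ _ => (M.measurable_obs ((measurable_pi_apply _).comp hf)
    ((measurable_pi_apply _).comp hg)).coe_nnreal_ennreal

lemma POMDP.density_cons {T : ℕ} (x : X) (y : Fin (T + 1) → X) (z₀ : Z) (z : Fin T → Z) :
    M.density (Fin.cons x y : Fin (T + 2) → X) (Fin.cons z₀ z : Fin (T + 1) → Z) =
      M.obs (y 0) z₀ * M.density y z := by
  simp [POMDP.density, Fin.prod_univ_succ]

/-- The steps with given actions, states and measurements. -/
def mkSteps {T : ℕ} (u : Fin T → A) (y : Fin (T + 1) → X) (z : Fin T → Z) : Fin T → A × X × Z :=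
  fun i => (u i, y i.succ, z i)

omit [MeasurableSpace X] [MeasurableSpace A] [MeasurableSpace Z] in
lemma mkSteps_cons {T : ℕ} (a : A) (u : Fin T → A) (x : X) (y : Fin (T + 1) → X) (z₀ : Z)
    (z : Fin T → Z) : mkSteps (Fin.cons a u : Fin (T + 1) → A) (Fin.cons x y : Fin (T + 2) → X)
      (Fin.cons z₀ z : Fin (T + 1) → Z) = Fin.cons (a, y 0, z₀) (mkSteps u y z) := by
  funext i
  refine Fin.cases ?_ (fun j => ?_) i <;> simp [mkSteps]

lemma measurable_mkSteps {Y : Type*} [MeasurableSpace Y] {T : ℕ} (u : Fin T → A)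
    {f : Y → Fin (T + 1) → X} (hf : Measurable f) {g : Y → Fin T → Z} (hg : Measurable g) :
    Measurable fun q => mkSteps u (f q) (g q) :=
  measurable_pi_lambda _ fun _ => measurable_const.prodMk
    (((measurable_pi_apply _).comp hf).prodMk ((measurable_pi_apply _).comp hg))

end Trajectories

/-! ### Factorisation of an episode into policy weights, likelihoods and simulated states. -/

section Density

variable {X A Z : Type*} [MeasurableSpace X] [Fintype A] [MeasurableSpace A] [MeasurableSpace Z]
variable (M : POMDP X A Z) (π : Policy A Z)

/-- The probability that the policy takes the actions `u`, given the measurements `z`. -/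
def Policy.weight (π : Policy A Z) :
    (T : ℕ) → Hist A Z → (Fin T → A) → (Fin T → Z) → ℝ≥0∞
  | 0, _, _, _ => 1
  | T + 1, h, u, z =>
    π.prob h (u 0) * π.weight T ((u 0, z 0) :: h) (Fin.tail u) (Fin.tail z)

lemma Policy.measurable_weight (T : ℕ) : ∀ {n : ℕ} (u : Fin T → A),
    Measurable fun p : (Fin n → A × Z) × (Fin T → Z) => π.weight T (List.ofFn p.1) u p.2 := by
  induction T with
  | zero => exact fun _ => measurable_const
  | succ T ih =>
    intro n u
    refine (π.measurable_prob measurable_fst (u 0)).coe_nnreal_ennreal.mul ?_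
    have := (ih (n := n + 1) (Fin.tail u)).comp
      (f := fun p : (Fin n → A × Z) × (Fin (T + 1) → Z) =>
        ((Fin.cons (u 0, p.2 0) p.1 : Fin (n + 1) → A × Z), (Fin.tail p.2 : Fin T → Z)))
      (Measurable.prodMk (measurable_finCons (by fun_prop) measurable_fst)
        (measurable_pi_lambda _ fun _ => by unfold Fin.tail; fun_prop))
    simpa [List.ofFn_succ, Function.comp_def] using this

lemma Policy.measurable_weight_section {T : ℕ} (h : Hist A Z) (u : Fin T → A) :
    Measurable fun z : Fin T → Z => π.weight T h u z := by
  have := (π.measurable_weight T (n := h.length) u).comp (f := fun z : Fin T → Z => (h.get, z))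
    (by fun_prop)
  simpa [List.ofFn_get, Function.comp_def] using this

lemma Policy.weight_cons (T : ℕ) (h : Hist A Z) (a : A) (u : Fin T → A) (z₀ : Z) (z : Fin T → Z) :
    π.weight (T + 1) h (Fin.cons a u : Fin (T + 1) → A) (Fin.cons z₀ z : Fin (T + 1) → Z) =
      π.prob h a * π.weight T ((a, z₀) :: h) u z := by
  simp [Policy.weight]

omit [MeasurableSpace A] in
lemma sum_fin_succ {T : ℕ} [DecidableEq A] (f : (Fin (T + 1) → A) → ℝ≥0∞) :
    ∑ u, f u = ∑ a, ∑ u : Fin T → A, f (Fin.cons a u : Fin (T + 1) → A) := by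
  rw [← Fintype.sum_prod_type']
  exact (Fintype.sum_equiv (Fin.consEquiv fun _ : Fin (T + 1) => A) _ _ fun _ => rfl).symm

/-- The joint density of actions, measurements and states, from a given state. -/
lemma POMDP.lintegral_stepsLaw_eq_sum [DecidableEq A] (T : ℕ) : ∀ (h : Hist A Z) (x : X)
    {F : X × (Fin T → A × X × Z) → ℝ≥0∞}, Measurable F →
      ∫⁻ s, F (x, s) ∂(M.stepsLaw π T h x) = ∑ u, ∫⁻ z, π.weight T h u z *
        ∫⁻ y, M.density y z * F (y 0, mkSteps u y z) ∂(M.trajLaw T u x)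
          ∂(Measure.pi fun _ : Fin T => M.ref) := by
  induction T with
  | zero =>
    intro h x F hF
    have hs : ∀ s : Fin 0 → A × X × Z, s = Fin.elim0 := fun s => Subsingleton.elim _ _
    have h1 : ∫⁻ s, F (x, s) ∂(M.stepsLaw π 0 h x) = F (x, Fin.elim0) := by
      have := M.stepsLaw_prob π 0 h x
      have hc : ∀ s, F (x, s) = F (x, Fin.elim0) := fun s => by rw [hs s]
      simp_rw [hc]
      simp
    have h2 : ∀ (u : Fin 0 → A) (z : Fin 0 → Z),
        ∫⁻ y, M.density y z * F (y 0, mkSteps u y z) ∂(M.trajLaw 0 u x) = F (x, Fin.elim0) := by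
      intro u z
      have hm : Measurable fun y : Fin 1 → X => M.density y z * F (y 0, mkSteps u y z) :=
        (M.measurable_density measurable_id measurable_const).mul
          (hF.comp ((measurable_pi_apply 0).prodMk
            (measurable_mkSteps u measurable_id measurable_const)))
      simp only [POMDP.trajLaw]
      rw [lintegral_dirac' _ hm]
      rw [hs (mkSteps u (fun _ => x) z)]
      simp [POMDP.density]
    rw [h1]
    simp_rw [h2]
    simp [Policy.weight]
  | succ T ih =>
    intro h x F hF
    have hFs : Measurable fun s => F (x, s) := hF.comp measurable_prodMk_left
    rw [M.lintegral_stepsLaw_succ π T h x (F := fun s => F (x, s)) hFs, sum_fin_succ]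
    refine Finset.sum_congr rfl fun a _ => ?_
    -- the contribution of the trajectories that start with `a`
    let G : (Fin T → A) → (Fin (T + 1) → Z) → (Fin (T + 1) → X) → ℝ≥0∞ := fun u z y =>
      M.obs (y 0) (z 0) * M.density y (Fin.tail z) *
        F (x, Fin.cons (a, y 0, z 0) (mkSteps u y (Fin.tail z)))
    have htail : Measurable fun z : Fin (T + 1) → Z => (Fin.tail z : Fin T → Z) :=
      measurable_pi_lambda _ fun i => by unfold Fin.tail; fun_prop
    have hG : ∀ u, Measurable fun q : (Fin (T + 1) → Z) × (Fin (T + 1) → X) => G u q.1 q.2 := by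
      intro u
      have h0 : Measurable fun q : (Fin (T + 1) → Z) × (Fin (T + 1) → X) => q.2 0 := by fun_prop
      have h1 : Measurable fun q : (Fin (T + 1) → Z) × (Fin (T + 1) → X) => q.1 0 := by fun_prop
      have h2 : Measurable fun q : (Fin (T + 1) → Z) × (Fin (T + 1) → X) =>
        (Fin.tail q.1 : Fin T → Z) := htail.comp measurable_fst
      refine ((M.measurable_obs h0 h1).coe_nnreal_ennreal.mul
        (M.measurable_density measurable_snd h2)).mul (hF.comp (measurable_const.prodMk
          (measurable_finCons (measurable_const.prodMk (h0.prodMk h1))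
            (measurable_mkSteps u measurable_snd h2))))
    have hJ : ∀ u, Measurable fun q : (Fin (T + 1) → Z) × X =>
        ∫⁻ y, G u q.1 y ∂(M.trajLaw T u q.2) := fun u =>
      ((M.trajLaw_section T u).comp measurable_snd).measurable_lintegral
        (f := fun (q : (Fin (T + 1) → Z) × X) y => G u q.1 y)
        ((hG u).comp (by fun_prop : Measurable fun p : ((Fin (T + 1) → Z) × X) × (Fin (T + 1) → X) =>
          (p.1.1, p.2)))
    have hw : ∀ u : Fin T → A, Measurable fun z : Fin (T + 1) → Z =>
        π.weight (T + 1) h (Fin.cons a u : Fin (T + 1) → A) z := fun u =>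
      π.measurable_weight_section h _
    -- The first transition is pulled in front of the integral over measurements, to match the order
    -- of integration in the law of the steps.
    have hR : ∀ u : Fin T → A,
        (∫⁻ z, π.weight (T + 1) h (Fin.cons a u : Fin (T + 1) → A) z *
          ∫⁻ y, M.density y z * F (y 0, mkSteps (Fin.cons a u : Fin (T + 1) → A) y z)
            ∂(M.trajLaw (T + 1) (Fin.cons a u : Fin (T + 1) → A) x)
          ∂(Measure.pi fun _ : Fin (T + 1) => M.ref)) =
        ∫⁻ x', ∫⁻ z, π.weight (T + 1) h (Fin.cons a u : Fin (T + 1) → A) z *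
          ∫⁻ y, G u z y ∂(M.trajLaw T u x') ∂(Measure.pi fun _ : Fin (T + 1) => M.ref)
            ∂(M.trans (x, a)) := by
      intro u
      have h1 : ∀ z : Fin (T + 1) → Z,
          ∫⁻ y, M.density y z * F (y 0, mkSteps (Fin.cons a u : Fin (T + 1) → A) y z)
            ∂(M.trajLaw (T + 1) (Fin.cons a u : Fin (T + 1) → A) x) =
          ∫⁻ x', ∫⁻ y, G u z y ∂(M.trajLaw T u x') ∂(M.trans (x, a)) := by
        intro z
        have hm : Measurable fun y : Fin (T + 2) → X =>
            M.density y z * F (y 0, mkSteps (Fin.cons a u : Fin (T + 1) → A) y z) :=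
          (M.measurable_density measurable_id measurable_const).mul
            (hF.comp ((measurable_pi_apply 0).prodMk
              (measurable_mkSteps _ measurable_id measurable_const)))
        rw [M.lintegral_trajLaw_succ T _ x hm]
        simp only [Fin.cons_zero, Fin.tail_cons]
        refine lintegral_congr fun x' => lintegral_congr fun y => ?_
        have hz : z = Fin.cons (z 0) (Fin.tail z) := (Fin.cons_self_tail z).symm
        conv_lhs => rw [hz, M.density_cons, mkSteps_cons]
      simp_rw [h1]
      rw [lintegral_lintegral_swap]
      · refine lintegral_congr fun z => ?_
        rw [lintegral_const_mul]
        exact (hJ u).comp measurable_prodMk_left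
      · exact (((hw u).comp measurable_snd).mul ((hJ u).comp measurable_swap)).aemeasurable
    simp_rw [hR]
    have hmz : ∀ u, Measurable fun x' => ∫⁻ z, π.weight (T + 1) h (Fin.cons a u : Fin (T + 1) → A) z *
          ∫⁻ y, G u z y ∂(M.trajLaw T u x') ∂(Measure.pi fun _ : Fin (T + 1) => M.ref) := fun u =>
      Measurable.lintegral_prod_right'
        (f := fun q : X × (Fin (T + 1) → Z) =>
          π.weight (T + 1) h (Fin.cons a u : Fin (T + 1) → A) q.2 *
            ∫⁻ y, G u q.2 y ∂(M.trajLaw T u q.1))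
        (((hw u).comp measurable_snd).mul ((hJ u).comp measurable_swap))
    rw [← lintegral_finsetSum _ fun u _ => hmz u]
    rw [← lintegral_const_mul]
    swap
    · exact M.measLaw_subMarkov.measurable_lintegral
        (f := fun x' z => ∫⁻ s, F (x, Fin.cons (a, x', z) s) ∂(M.stepsLaw π T ((a, z) :: h) x'))
        ((M.stepsLaw_cons_section π T h a).measurable_lintegral
          (f := fun q s => F (x, Fin.cons (a, q.1, q.2) s))
          (hFs.comp (measurable_finCons (measurable_const.prodMk measurable_fst) measurable_snd)))
    refine lintegral_congr fun x' => ?_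
    have hsx : Measurable fun z => ∫⁻ s, F (x, Fin.cons (a, x', z) s)
        ∂(M.stepsLaw π T ((a, z) :: h) x') :=
      ((M.stepsLaw_cons_section π T h a).comp (measurable_prodMk_left
        (x := x'))).measurable_lintegral (f := fun z s => F (x, Fin.cons (a, x', z) s))
        (hFs.comp (measurable_finCons (measurable_const.prodMk
          (measurable_const.prodMk measurable_fst)) measurable_snd))
    have hox : Measurable fun z => (M.obs x' z : ℝ≥0∞) :=
      (M.measurable_obs measurable_const measurable_id).coe_nnreal_ennreal
    have hGx : ∀ u, Measurable fun z : Fin (T + 1) → Z =>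
        π.weight (T + 1) h (Fin.cons a u : Fin (T + 1) → A) z *
          ∫⁻ y, G u z y ∂(M.trajLaw T u x') := fun u =>
      (hw u).mul ((hJ u).comp measurable_prodMk_right)
    have hoxs : Measurable fun z => (M.obs x' z : ℝ≥0∞) *
        ∫⁻ s, F (x, Fin.cons (a, x', z) s) ∂(M.stepsLaw π T ((a, z) :: h) x') := hox.mul hsx
    rw [M.lintegral_measLaw x' hsx, ← lintegral_const_mul _ hoxs]
    simp_rw [fun u => lintegral_pi_succ M.ref T (hGx u)]
    rw [← lintegral_finsetSum]
    swap
    · intro u _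
      exact Measurable.lintegral_prod_right'
        (f := fun q : Z × (Fin T → Z) =>
          π.weight (T + 1) h (Fin.cons a u : Fin (T + 1) → A) (Fin.cons q.1 q.2 : Fin (T + 1) → Z) *
            ∫⁻ y, G u (Fin.cons q.1 q.2) y ∂(M.trajLaw T u x'))
        ((hGx u).comp (measurable_finCons measurable_fst measurable_snd))
    refine lintegral_congr fun z₀ => ?_
    -- The density of the first measurement depends on the state reached, which is the initial state
    -- of the remaining steps. It is absorbed into the test function, which is why test functions
    -- take the initial state as an argument.
    have hF' : Measurable fun q : X × (Fin T → A × X × Z) =>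
        (M.obs q.1 z₀ : ℝ≥0∞) * F (x, Fin.cons (a, q.1, z₀) q.2) :=
      (M.measurable_obs measurable_fst measurable_const).coe_nnreal_ennreal.mul
        (hFs.comp (measurable_finCons (measurable_const.prodMk
          (measurable_fst.prodMk measurable_const)) measurable_snd))
    have hFx : Measurable fun s => F (x, Fin.cons (a, x', z₀) s) :=
      hFs.comp (measurable_finCons_const _)
    rw [← lintegral_const_mul _ hFx, ih ((a, z₀) :: h) x' hF', Finset.mul_sum]
    refine Finset.sum_congr rfl fun u _ => ?_
    rw [← lintegral_const_mul' _ _ ENNReal.coe_ne_top]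
    refine lintegral_congr fun z => ?_
    rw [π.weight_cons, mul_assoc]
    congr 2
    refine lintegral_congr fun y => ?_
    simp only [G, Fin.cons_zero, Fin.tail_cons]
    ring

/-- The joint density of actions, measurements and states of an episode. -/
lemma POMDP.lintegral_episodeLaw_eq_sum [DecidableEq A] (T : ℕ) (h : Hist A Z)
    {F : X × (Fin T → A × X × Z) → ℝ≥0∞} (hF : Measurable F) :
    ∫⁻ q, F q ∂(M.episodeLaw π T h) = ∑ u, ∫⁻ z, π.weight T h u z *
      ∫⁻ y, M.density y z * F (y 0, mkSteps u y z) ∂(M.forwardLaw h u)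
        ∂(Measure.pi fun _ : Fin T => M.ref) := by
  have := M.belief_isFinite h
  have hm : ∀ u, Measurable fun q : (Fin T → Z) × (Fin (T + 1) → X) =>
      M.density q.2 q.1 * F (q.2 0, mkSteps u q.2 q.1) := fun u =>
    (M.measurable_density measurable_snd measurable_fst).mul
      (hF.comp (Measurable.prodMk (by fun_prop) (measurable_mkSteps u measurable_snd measurable_fst)))
  have hJ : ∀ u, Measurable fun q : (Fin T → Z) × X =>
      ∫⁻ y, M.density y q.1 * F (y 0, mkSteps u y q.1) ∂(M.trajLaw T u q.2) := fun u =>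
    ((M.trajLaw_section T u).comp measurable_snd).measurable_lintegral
      (f := fun (q : (Fin T → Z) × X) y => M.density y q.1 * F (y 0, mkSteps u y q.1))
      ((hm u).comp (by fun_prop : Measurable fun p : ((Fin T → Z) × X) × (Fin (T + 1) → X) =>
        (p.1.1, p.2)))
  have hw : ∀ u, Measurable fun q : X × (Fin T → Z) => π.weight T h u q.2 *
      ∫⁻ y, M.density y q.2 * F (y 0, mkSteps u y q.2) ∂(M.trajLaw T u q.1) := fun u =>
    ((π.measurable_weight_section h u).comp measurable_snd).mul ((hJ u).comp measurable_swap)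
  rw [M.lintegral_episodeLaw π T h hF]
  simp_rw [fun x => M.lintegral_stepsLaw_eq_sum π T h x hF]
  rw [lintegral_finsetSum _ fun u _ => Measurable.lintegral_prod_right' (hw u)]
  refine Finset.sum_congr rfl fun u _ => ?_
  rw [lintegral_lintegral_swap (hw u).aemeasurable]
  refine lintegral_congr fun z => ?_
  have hJz : Measurable fun x =>
      ∫⁻ y, M.density y z * F (y 0, mkSteps u y z) ∂(M.trajLaw T u x) :=
    (hJ u).comp measurable_prodMk_left
  have hmz : Measurable fun y => M.density y z * F (y 0, mkSteps u y z) :=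
    (hm u).comp measurable_prodMk_left
  dsimp only
  rw [lintegral_const_mul _ hJz, M.lintegral_forwardLaw h u hmz]

end Density

/-! ### Measurability and bounds for the estimate, the evidence and the posterior mean. -/

section Estimates

variable {X A Z : Type*} [MeasurableSpace X] [MeasurableSpace A] [MeasurableSpace Z]
variable {Y : Type*} [MeasurableSpace Y] (M : POMDP X A Z)

lemma POMDP.measurable_elim {f : Y → X} (hf : Measurable f) {g : Y → Z ⊕ Unit}
    (hg : Measurable g) :
    Measurable fun y => (Sum.elim (fun z => (M.obs (f y) z : ℝ)) (fun _ => 1) (g y) : ℝ) := by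
  have h1 : Measurable fun p : X × (Z ⊕ Unit) =>
      (Sum.elim (fun z => (M.obs p.1 z : ℝ)) (fun _ => 1) p.2 : ℝ) := by
    have h2 : Measurable fun q : (X × Z) ⊕ (X × Unit) =>
        (Sum.elim (fun r : X × Z => (M.obs r.1 r.2 : ℝ)) (fun _ => 1) q : ℝ) :=
      measurable_fun_sum (M.measurable_obs measurable_fst measurable_snd).coe_nnreal_real
        measurable_const
    -- A case distinction on the sum type is measurable on each summand; distributing the product
    -- over the sum makes this applicable jointly with the state.
    have h3 := h2.comp (MeasurableEquiv.prodSumDistrib X Z Unit).measurable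
    convert h3 using 1
    funext p
    obtain ⟨x, z | _⟩ := p <;> rfl
  exact h1.comp (hf.prodMk hg)

lemma POMDP.measurable_likelihood {T : ℕ} {f : Y → Fin (T + 1) → X} (hf : Measurable f)
    {g : Y → Steps A Z T} (hg : Measurable g) :
    Measurable fun y => M.likelihood (f y) (g y) :=
  Finset.measurable_prod _ fun _ _ => M.measurable_elim ((measurable_pi_apply _).comp hf)
    (measurable_snd.comp ((measurable_pi_apply _).comp hg))

lemma POMDP.likelihood_nonneg {T : ℕ} (x : Fin (T + 1) → X) (e : Steps A Z T) :
    0 ≤ M.likelihood x e := by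
  refine Finset.prod_nonneg fun i _ => ?_
  rcases (e i).2 with z | _ <;> simp

lemma POMDP.measurable_ret {T : ℕ} {f : Y → Fin (T + 1) → X} (hf : Measurable f)
    {g : Y → Fin T → A} (hg : Measurable g) : Measurable fun y => M.ret (f y) (g y) :=
  Finset.measurable_sum _ fun _ _ => measurable_const.mul (M.reward_measurable.comp
    (((measurable_pi_apply _).comp hf).prodMk (((measurable_pi_apply _).comp hg).prodMk
      ((measurable_pi_apply _).comp hf))))

/-- A bound for the returns of `T` steps. -/
def POMDP.retBound (M : POMDP X A Z) (T : ℕ) : ℝ := ∑ i : Fin T, M.disc ^ (i : ℕ) * |M.rmax|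

lemma POMDP.retBound_nonneg (T : ℕ) : 0 ≤ M.retBound T :=
  Finset.sum_nonneg fun _ _ => mul_nonneg (pow_nonneg M.disc_pos.le _) (abs_nonneg _)

lemma POMDP.abs_ret_le {T : ℕ} (x : Fin (T + 1) → X) (u : Fin T → A) :
    |M.ret x u| ≤ M.retBound T := by
  refine (Finset.abs_sum_le_sum_abs _ _).trans (Finset.sum_le_sum fun i _ => ?_)
  rw [abs_mul, abs_of_nonneg (pow_nonneg M.disc_pos.le _)]
  exact mul_le_mul_of_nonneg_left ((M.reward_bounded _ _ _).trans (le_abs_self _))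
    (pow_nonneg M.disc_pos.le _)

lemma measurable_acts {T : ℕ} : Measurable fun e : Steps A Z T => acts e :=
  measurable_pi_lambda _ fun _ => measurable_fst.comp (measurable_pi_apply _)

lemma POMDP.measurable_estimate {T K : ℕ} {f : Y → Fin K → Fin (T + 1) → X} (hf : Measurable f)
    {g : Y → Steps A Z T} (hg : Measurable g) : Measurable fun y => M.estimate (g y) (f y) := by
  have hfi : ∀ i, Measurable fun y => f y i := fun i => (measurable_pi_apply i).comp hf
  refine Measurable.div ?_ ?_
  · exact Finset.measurable_sum _ fun i _ => (M.measurable_likelihood (hfi i) hg).mul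
      (M.measurable_ret (hfi i) (measurable_acts.comp hg))
  · exact Finset.measurable_sum _ fun i _ => M.measurable_likelihood (hfi i) hg

/-- The estimate is a weighted average of returns with nonnegative weights, or zero when all the
weights vanish. -/
lemma POMDP.abs_estimate_le {T K : ℕ} (e : Steps A Z T) (x : Fin K → Fin (T + 1) → X) :
    |M.estimate e x| ≤ M.retBound T := by
  have h0 : 0 ≤ ∑ i, M.likelihood (x i) e := Finset.sum_nonneg fun i _ => M.likelihood_nonneg _ _
  rw [POMDP.estimate, abs_div, abs_of_nonneg h0]
  refine div_le_of_le_mul₀ h0 (M.retBound_nonneg T) ?_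
  rw [Finset.mul_sum]
  refine (Finset.abs_sum_le_sum_abs _ _).trans (Finset.sum_le_sum fun i _ => ?_)
  rw [abs_mul, abs_of_nonneg (M.likelihood_nonneg _ _), mul_comm]
  exact mul_le_mul_of_nonneg_right (M.abs_ret_le _ _) (M.likelihood_nonneg _ _)

lemma POMDP.forwardLaw_acts_subMarkov (n T : ℕ) :
    SubMarkov fun q : (Fin n → A × Z) × Steps A Z T => M.forwardLaw (List.ofFn q.1) (acts q.2) :=
  (M.forwardLaw_subMarkov n T).comp
    (g := fun q : (Fin n → A × Z) × Steps A Z T => (q.1, acts q.2))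
    (measurable_fst.prodMk (measurable_acts.comp measurable_snd))

lemma POMDP.measurable_meanEstimate (n T K : ℕ) :
    Measurable fun q : (Fin n → A × Z) × Steps A Z T =>
      M.meanEstimate (List.ofFn q.1) K q.2 :=
  ((M.forwardLaw_acts_subMarkov n T).pi K).measurable_integral
    (f := fun q x => M.estimate q.2 x)
    (M.measurable_estimate measurable_snd (measurable_snd.comp measurable_fst))

lemma POMDP.abs_meanEstimate_le (h : Hist A Z) {T : ℕ} (K : ℕ) (e : Steps A Z T) :
    |M.meanEstimate h K e| ≤ M.retBound T :=
  abs_integral_le_of_abs_le (((M.forwardLaw_section h T).pi K).mass_le (acts e))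
    (M.retBound_nonneg T) fun x => M.abs_estimate_le e x

/-- The probability density of the measurements of `e`, given its actions. -/
def POMDP.evidence (M : POMDP X A Z) (h : Hist A Z) {T : ℕ} (e : Steps A Z T) : ℝ≥0∞ :=
  ∫⁻ y, ENNReal.ofReal (M.likelihood y e) ∂(M.forwardLaw h (acts e))

/-- The posterior expectation of the return, given the actions and measurements `e`. -/
def POMDP.postMean (M : POMDP X A Z) (h : Hist A Z) {T : ℕ} (e : Steps A Z T) : ℝ :=
  (∫ y, M.likelihood y e * M.ret y (acts e) ∂(M.forwardLaw h (acts e))) /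
    ∫ y, M.likelihood y e ∂(M.forwardLaw h (acts e))

lemma POMDP.measurable_evidence (n T : ℕ) :
    Measurable fun q : (Fin n → A × Z) × Steps A Z T => M.evidence (List.ofFn q.1) q.2 :=
  (M.forwardLaw_acts_subMarkov n T).measurable_lintegral
    (f := fun q y => ENNReal.ofReal (M.likelihood y q.2))
    (M.measurable_likelihood measurable_snd (measurable_snd.comp measurable_fst)).ennreal_ofReal

lemma POMDP.measurable_postMean (n T : ℕ) :
    Measurable fun q : (Fin n → A × Z) × Steps A Z T => M.postMean (List.ofFn q.1) q.2 := by
  have hl : Measurable fun p : ((Fin n → A × Z) × Steps A Z T) × (Fin (T + 1) → X) =>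
      M.likelihood p.2 p.1.2 :=
    M.measurable_likelihood measurable_snd (measurable_snd.comp measurable_fst)
  refine Measurable.div ?_ ?_
  · exact (M.forwardLaw_acts_subMarkov n T).measurable_integral
      (f := fun q y => M.likelihood y q.2 * M.ret y (acts q.2))
      (hl.mul (M.measurable_ret measurable_snd
        (measurable_acts.comp (measurable_snd.comp measurable_fst))))
  · exact (M.forwardLaw_acts_subMarkov n T).measurable_integral
      (f := fun q y => M.likelihood y q.2) hl

lemma POMDP.measurable_ofReal_likelihood {T : ℕ} (e : Steps A Z T) :
    Measurable fun y => ENNReal.ofReal (M.likelihood y e) :=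
  (M.measurable_likelihood measurable_id measurable_const).ennreal_ofReal

/-- Measurability in the steps follows from joint measurability in the history and the steps. -/
lemma measurable_of_hist {T : ℕ} {β : Type*} [MeasurableSpace β] {f : Hist A Z → Steps A Z T → β}
    (hf : ∀ n, Measurable fun q : (Fin n → A × Z) × Steps A Z T => f (List.ofFn q.1) q.2)
    (h : Hist A Z) : Measurable (f h) := by
  have := (hf h.length).comp (measurable_prodMk_left (x := h.get))
  simpa [Function.comp_def, List.ofFn_get] using this

lemma POMDP.measurable_evidence_section (h : Hist A Z) (T : ℕ) :
    Measurable fun e : Steps A Z T => M.evidence h e :=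
  measurable_of_hist (f := fun h e => M.evidence h e) (fun n => M.measurable_evidence n T) h

lemma POMDP.measurable_postMean_section (h : Hist A Z) (T : ℕ) :
    Measurable fun e : Steps A Z T => M.postMean h e :=
  measurable_of_hist (f := fun h e => M.postMean h e) (fun n => M.measurable_postMean n T) h

lemma POMDP.abs_postMean_le (h : Hist A Z) {T : ℕ} (e : Steps A Z T) :
    |M.postMean h e| ≤ M.retBound T := by
  have h0 : 0 ≤ ∫ y, M.likelihood y e ∂(M.forwardLaw h (acts e)) :=
    integral_nonneg fun y => M.likelihood_nonneg _ _
  by_cases hi : Integrable (fun y => M.likelihood y e) (M.forwardLaw h (acts e))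
  · rw [POMDP.postMean, abs_div, abs_of_nonneg h0]
    refine div_le_of_le_mul₀ h0 (M.retBound_nonneg T) ?_
    rw [← integral_const_mul]
    refine (abs_integral_le_integral_abs).trans (integral_mono_of_nonneg
      (ae_of_all _ fun y => abs_nonneg _) (hi.const_mul _) (ae_of_all _ fun y => ?_))
    simp only
    rw [abs_mul, abs_of_nonneg (M.likelihood_nonneg _ _), mul_comm]
    exact mul_le_mul_of_nonneg_right (M.abs_ret_le _ _) (M.likelihood_nonneg _ _)
  -- A non-integrable likelihood makes the denominator zero by convention, and then the quotient is
  -- zero.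
  · rw [POMDP.postMean, integral_undef hi]
    simpa using M.retBound_nonneg T

lemma POMDP.integrable_likelihood {h : Hist A Z} {T : ℕ} {e : Steps A Z T}
    (he : M.evidence h e ≠ ∞) :
    Integrable (fun y => M.likelihood y e) (M.forwardLaw h (acts e)) := by
  refine ⟨(M.measurable_likelihood measurable_id measurable_const).aestronglyMeasurable, ?_⟩
  rw [hasFiniteIntegral_iff_ofReal (ae_of_all _ fun y => M.likelihood_nonneg _ _)]
  exact he.lt_top

lemma POMDP.integrable_likelihood_mul_ret {h : Hist A Z} {T : ℕ} {e : Steps A Z T}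
    (he : M.evidence h e ≠ ∞) :
    Integrable (fun y => M.likelihood y e * M.ret y (acts e)) (M.forwardLaw h (acts e)) :=
  (M.integrable_likelihood he).mul_bdd (c := M.retBound T)
    (M.measurable_ret measurable_id measurable_const).aestronglyMeasurable
    (ae_of_all _ fun _ => M.abs_ret_le _ _)

lemma POMDP.integral_likelihood_pos {h : Hist A Z} {T : ℕ} {e : Steps A Z T}
    (he0 : M.evidence h e ≠ 0) (he : M.evidence h e ≠ ∞) :
    0 < ∫ y, M.likelihood y e ∂(M.forwardLaw h (acts e)) := by
  rw [integral_eq_lintegral_of_nonneg_ae (ae_of_all _ fun y => M.likelihood_nonneg _ _)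
    (M.integrable_likelihood he).aestronglyMeasurable]
  exact ENNReal.toReal_pos he0 he

/-- The posterior expectation of the shifted, nonnegative return. -/
lemma POMDP.ofReal_postMean_add {h : Hist A Z} {T : ℕ} {e : Steps A Z T}
    (he0 : M.evidence h e ≠ 0) (he : M.evidence h e ≠ ∞) :
    M.evidence h e * ENNReal.ofReal (M.postMean h e + M.retBound T) =
      ∫⁻ y, ENNReal.ofReal (M.likelihood y e) * ENNReal.ofReal (M.ret y (acts e) + M.retBound T)
        ∂(M.forwardLaw h (acts e)) := by
  have hpos := M.integral_likelihood_pos he0 he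
  have hl := M.integrable_likelihood he
  have hlr := M.integrable_likelihood_mul_ret he
  have hn : ∀ y, 0 ≤ M.likelihood y e * (M.ret y (acts e) + M.retBound T) := fun y =>
    mul_nonneg (M.likelihood_nonneg _ _) (by linarith [neg_le_of_abs_le (M.abs_ret_le y (acts e))])
  simp_rw [← ENNReal.ofReal_mul (M.likelihood_nonneg _ e)]
  have hsum : Integrable (fun y => M.likelihood y e * (M.ret y (acts e) + M.retBound T))
      (M.forwardLaw h (acts e)) := by
    simp_rw [mul_add]
    exact hlr.add (hl.mul_const _)
  rw [← ofReal_integral_eq_lintegral_ofReal hsum (ae_of_all _ hn)]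
  have hq : M.evidence h e = ENNReal.ofReal (∫ y, M.likelihood y e ∂(M.forwardLaw h (acts e))) :=
    (ofReal_integral_eq_lintegral_ofReal hl (ae_of_all _ fun y => M.likelihood_nonneg _ _)).symm
  rw [hq, ← ENNReal.ofReal_mul hpos.le]
  congr 1
  simp_rw [mul_add]
  rw [integral_add hlr (hl.mul_const _), integral_mul_const, POMDP.postMean]
  field_simp

end Estimates

/-! ### The value as the average of posterior means. -/

section PosteriorMean

variable {X A Z : Type*} [MeasurableSpace X] [Fintype A] [MeasurableSpace A] [MeasurableSpace Z]
variable (M : POMDP X A Z) (π : Policy A Z)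

omit [Fintype A] in
lemma POMDP.ofReal_likelihood_observed {T : ℕ} (u : Fin T → A) (y y' : Fin (T + 1) → X)
    (z : Fin T → Z) :
    ENNReal.ofReal (M.likelihood y (observed (mkSteps u y' z))) = M.density y z := by
  simp [POMDP.likelihood, POMDP.density, observed, mkSteps,
    ENNReal.ofReal_prod_of_nonneg]

/-- The actions `u` with the measurements `z`. -/
def obsSteps {T : ℕ} (u : Fin T → A) (z : Fin T → Z) : Steps A Z T := fun i => (u i, Sum.inl (z i))

omit [Fintype A] in
lemma measurable_obsSteps {T : ℕ} (u : Fin T → A) : Measurable fun z : Fin T → Z => obsSteps u z :=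
  measurable_pi_lambda _ fun _ => measurable_const.prodMk
    (measurable_inl.comp (measurable_pi_apply _))

/-- Only measurements of finite evidence are weighted. -/
lemma POMDP.ae_weight_mul_evidence [DecidableEq A] (T : ℕ) (h : Hist A Z)
    (hh : IsProbabilityMeasure (M.belief h)) (u : Fin T → A) :
    ∀ᵐ z ∂(Measure.pi fun _ : Fin T => M.ref), π.weight T h u z * M.evidence h (obsSteps u z) < ∞ := by
  have := M.episodeLaw_prob π T h hh
  have h1 := M.lintegral_episodeLaw_eq_sum π T h (F := fun _ => 1) measurable_const
  simp only [lintegral_const, measure_univ, mul_one] at h1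
  have hev : ∀ u z, M.evidence h (obsSteps u z : Steps A Z T) =
      ∫⁻ y, M.density y z ∂(M.forwardLaw h u) := fun u z =>
    lintegral_congr fun y => M.ofReal_likelihood_observed u y y z
  simp_rw [← hev] at h1
  refine ae_lt_top ((π.measurable_weight_section h u).mul
    ((M.measurable_evidence_section h T).comp (measurable_obsSteps u))) ?_
  refine ne_top_of_le_ne_top ENNReal.one_ne_top (le_of_le_of_eq ?_ h1.symm)
  exact Finset.single_le_sum (f := fun u => ∫⁻ z, π.weight T h u z * M.evidence h (obsSteps u z)
    ∂(Measure.pi fun _ : Fin T => M.ref)) (fun _ _ => zero_le) (Finset.mem_univ u)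

/-- The density of the actions and measurements of an episode. -/
lemma POMDP.lintegral_policyLaw_eq_sum [DecidableEq A] (T : ℕ) (h : Hist A Z)
    {F : Steps A Z T → ℝ≥0∞} (hF : Measurable F) :
    ∫⁻ e, F e ∂(M.policyLaw π T h) = ∑ u, ∫⁻ z, π.weight T h u z *
      (M.evidence h (obsSteps u z) * F (obsSteps u z)) ∂(Measure.pi fun _ : Fin T => M.ref) := by
  have h1 : Measurable fun q : X × (Fin T → A × X × Z) => (observed q.2 : Steps A Z T) :=
    measurable_observed.comp measurable_snd
  rw [POMDP.policyLaw]
  refine (lintegral_map hF h1).trans ?_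
  refine (M.lintegral_episodeLaw_eq_sum π T h (hF.comp h1)).trans ?_
  refine Finset.sum_congr rfl fun u _ => lintegral_congr fun z => ?_
  congr 1
  rw [POMDP.evidence, ← lintegral_mul_const _ (M.measurable_ofReal_likelihood _)]
  refine lintegral_congr fun y => ?_
  rw [← M.ofReal_likelihood_observed u y y z]
  rfl

/-- The evidence is a factor of the density, so it is nonzero almost surely. It is finite almost
surely because its product with the weight has finite integral, so that infinite evidence can only
occur with zero weight. -/
lemma POMDP.ae_evidence [DecidableEq A] (T : ℕ) (h : Hist A Z)
    (hh : IsProbabilityMeasure (M.belief h)) :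
    ∀ᵐ e ∂(M.policyLaw π T h), M.evidence h e ≠ 0 ∧ M.evidence h e ≠ ∞ := by
  have hm := M.measurable_evidence_section h T
  have hs : MeasurableSet {e : Steps A Z T | ¬(M.evidence h e ≠ 0 ∧ M.evidence h e ≠ ∞)} :=
    ((hm (measurableSet_singleton 0)).compl.inter (hm (measurableSet_singleton ∞)).compl).compl
  rw [ae_iff, ← lintegral_indicator_one hs,
    M.lintegral_policyLaw_eq_sum π T h (measurable_one.indicator hs)]
  refine Finset.sum_eq_zero fun u _ => ?_
  rw [lintegral_congr_ae (g := fun _ => 0), lintegral_zero]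
  filter_upwards [M.ae_weight_mul_evidence π T h hh u] with z hz
  by_cases h0 : M.evidence h (obsSteps u z) = 0
  · simp [h0]
  by_cases h1 : M.evidence h (obsSteps u z) = ∞
  · have : π.weight T h u z = 0 := by
      by_contra hw
      rw [h1, ENNReal.mul_top hw] at hz
      exact lt_irrefl _ hz
    simp [this]
  · simp [h0, h1]

/-- The value is the average of the posterior expectation of the return. -/
lemma POMDP.value_eq_integral_postMean [DecidableEq A] (T : ℕ) (h : Hist A Z)
    (hh : IsProbabilityMeasure (M.belief h)) :
    M.value π T h = ∫ e, M.postMean h e ∂(M.policyLaw π T h) := by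
  have hpE := M.episodeLaw_prob π T h hh
  have hpP := M.policyLaw_prob π T h hh
  have hpm := M.measurable_postMean_section h T
  let R : X × (Fin T → A × X × Z) → ℝ := fun S =>
    M.ret (Fin.cons S.1 fun i => (S.2 i).2.1 : Fin (T + 1) → X) (fun i => (S.2 i).1)
  have hR : Measurable R := M.measurable_ret
    (measurable_finCons measurable_fst (by fun_prop)) (by fun_prop)
  have hRb : ∀ S, |R S| ≤ M.retBound T := fun S => M.abs_ret_le _ _
  have hR0 : ∀ S, 0 ≤ R S + M.retBound T := fun S => by linarith [neg_le_of_abs_le (hRb S)]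
  have hP0 : ∀ e : Steps A Z T, 0 ≤ M.postMean h e + M.retBound T := fun e => by
    linarith [neg_le_of_abs_le (M.abs_postMean_le h e)]
  -- Shifting by `retBound` makes the returns nonnegative, so the density formulas for Lebesgue
  -- integrals apply; the shift is subtracted at the end because both laws have mass 1.
  have key : ∫⁻ S, ENNReal.ofReal (R S + M.retBound T) ∂(M.episodeLaw π T h) =
      ∫⁻ e, ENNReal.ofReal (M.postMean h e + M.retBound T) ∂(M.policyLaw π T h) := by
    rw [M.lintegral_episodeLaw_eq_sum π T h (hR.add_const _).ennreal_ofReal,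
      M.lintegral_policyLaw_eq_sum π T h (hpm.add_const _).ennreal_ofReal]
    refine Finset.sum_congr rfl fun u _ => lintegral_congr_ae ?_
    have hcons : ∀ (y : Fin (T + 1) → X) (z : Fin T → Z),
        R (y 0, mkSteps u y z) = M.ret y u := fun y z => by
      simp only [R, mkSteps]
      congr 1
      exact Fin.cons_self_tail y
    filter_upwards [M.ae_weight_mul_evidence π T h hh u] with z hz
    simp_rw [hcons]
    have hlik : ∀ y, M.density y z = ENNReal.ofReal (M.likelihood y (obsSteps u z)) := fun y =>
      (M.ofReal_likelihood_observed u y y z).symm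
    simp_rw [hlik]
    by_cases h1 : M.evidence h (obsSteps u z) = ∞
    · have : π.weight T h u z = 0 := by
        by_contra hw
        rw [h1, ENNReal.mul_top hw] at hz
        exact lt_irrefl _ hz
      simp [this]
    by_cases h0 : M.evidence h (obsSteps u z) = 0
    · have h2 : (fun y => ENNReal.ofReal (M.likelihood y (obsSteps u z)))
          =ᵐ[M.forwardLaw h u] 0 := by
        rwa [POMDP.evidence, lintegral_eq_zero_iff (M.measurable_ofReal_likelihood _)] at h0
      rw [h0, zero_mul, lintegral_congr_ae (g := fun _ => 0), lintegral_zero]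
      filter_upwards [h2] with y hy
      rw [hy]
      simp
    · rw [M.ofReal_postMean_add h0 h1]
      rfl
  have hRi := integrable_of_abs_le (μ := M.episodeLaw π T h) hR hRb
  have hPi := integrable_of_abs_le (μ := M.policyLaw π T h) hpm (M.abs_postMean_le h)
  have h1 : ∫ S, (R S + M.retBound T) ∂(M.episodeLaw π T h) =
      ∫ e, (M.postMean h e + M.retBound T) ∂(M.policyLaw π T h) := by
    rw [integral_eq_lintegral_of_nonneg_ae (ae_of_all _ hR0) (hR.add_const _).aestronglyMeasurable,
      integral_eq_lintegral_of_nonneg_ae (ae_of_all _ hP0) (hpm.add_const _).aestronglyMeasurable,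
      key]
  rw [integral_add hRi (integrable_const _), integral_add hPi (integrable_const _)] at h1
  simp only [integral_const, probReal_univ, one_smul, add_left_inj] at h1
  exact h1

end PosteriorMean

/-! ### Consistency of self-normalised importance sampling. -/

section LargeNumbers

variable {X A Z : Type*} [MeasurableSpace X] [MeasurableSpace A] [MeasurableSpace Z]
variable (M : POMDP X A Z)

/-- The strong law of large numbers for a function of independent random variables of the same
law. -/
lemma ae_tendsto_average {Ω E : Type*} [MeasurableSpace Ω] [MeasurableSpace E] {Q : Measure Ω}
    {Y : ℕ → Ω → E} (hY : ∀ i, Measurable (Y i)) (hi : iIndepFun Y Q) {ν : Measure E}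
    (hν : ∀ i, Q.map (Y i) = ν) {f : E → ℝ} (hf : Measurable f) (hfi : Integrable f ν) :
    ∀ᵐ ω ∂Q, Tendsto (fun n : ℕ => (∑ i : Fin n, f (Y i ω)) / n) atTop (𝓝 (∫ y, f y ∂ν)) := by
  have h0 : ∫ ω, f (Y 0 ω) ∂Q = ∫ y, f y ∂ν := by
    rw [← hν 0, integral_map (hY 0).aemeasurable hf.aestronglyMeasurable]
  have h1 := strong_law_ae_real (μ := Q) (fun i ω => f (Y i ω)) (by
      rw [← hν 0] at hfi
      exact hfi.comp_measurable (hY 0))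
    (fun i j hij => (hi.indepFun hij).comp hf hf)
    (fun i => (IdentDistrib.mk (hY i).aemeasurable (hY 0).aemeasurable
      ((hν i).trans (hν 0).symm)).comp hf)
  filter_upwards [h1] with ω hω
  rw [← h0]
  simpa only [Finset.sum_range] using hω

/-- Strong law for numerator and denominator separately; the factors `1/K` cancel. Positive evidence
keeps the limit of the denominator away from zero, and finite evidence gives integrability. -/
lemma POMDP.ae_tendsto_estimate {h : Hist A Z} {T : ℕ} {e : Steps A Z T}
    (he0 : M.evidence h e ≠ 0) (he : M.evidence h e ≠ ∞) {Ω : Type*} [MeasurableSpace Ω]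
    {Q : Measure Ω} {Y : ℕ → Ω → Fin (T + 1) → X} (hY : ∀ i, Measurable (Y i))
    (hi : iIndepFun Y Q) (hν : ∀ i, Q.map (Y i) = M.forwardLaw h (acts e)) :
    ∀ᵐ ω ∂Q, Tendsto (fun K : ℕ => M.estimate e fun i : Fin K => Y i ω) atTop
      (𝓝 (M.postMean h e)) := by
  have hl : Measurable fun y => M.likelihood y e :=
    M.measurable_likelihood measurable_id measurable_const
  have hr : Measurable fun y => M.ret y (acts e) := M.measurable_ret measurable_id measurable_const
  filter_upwards [ae_tendsto_average hY hi hν hl (M.integrable_likelihood he),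
    ae_tendsto_average hY hi hν (hl.mul hr) (M.integrable_likelihood_mul_ret he)] with ω h1 h2
  refine (h2.div h1 (M.integral_likelihood_pos he0 he).ne').congr' ?_
  filter_upwards [eventually_gt_atTop 0] with K hK
  exact div_div_div_cancel_right₀ (by positivity) _ _

/-- The samples for all `K` are realised as initial segments of one i.i.d. sequence, so that the
almost sure limit and the uniform bound on the estimate allow dominated convergence. -/
lemma POMDP.tendsto_meanEstimate {h : Hist A Z} (hh : IsProbabilityMeasure (M.belief h)) {T : ℕ}
    {e : Steps A Z T} (he0 : M.evidence h e ≠ 0) (he : M.evidence h e ≠ ∞) :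
    Tendsto (fun K => M.meanEstimate h K e) atTop (𝓝 (M.postMean h e)) := by
  have hp := M.forwardLaw_prob h hh (acts e)
  let Q : Measure (ℕ → Fin (T + 1) → X) := Measure.infinitePi fun _ => M.forwardLaw h (acts e)
  have hi : iIndepFun (fun (i : ℕ) (ξ : ℕ → Fin (T + 1) → X) => ξ i) Q :=
    iIndepFun_infinitePi (X := fun _ => id) fun _ => measurable_id
  have hν : ∀ i, Q.map (fun ξ => ξ i) = M.forwardLaw h (acts e) := fun i =>
    Measure.infinitePi_map_eval _ i
  have hres : ∀ K : ℕ, Measurable fun (ξ : ℕ → Fin (T + 1) → X) (i : Fin K) => ξ i := fun K =>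
    measurable_pi_lambda _ fun i => measurable_pi_apply (i : ℕ)
  have hest : ∀ K : ℕ, Measurable fun ξ : ℕ → Fin (T + 1) → X =>
      M.estimate e fun i : Fin K => ξ i := fun K =>
    M.measurable_estimate (hres K) measurable_const
  have hK : ∀ K : ℕ, M.meanEstimate h K e = ∫ ξ, M.estimate e (fun i : Fin K => ξ i) ∂Q := by
    intro K
    have h1 : Q.map (fun ξ (i : Fin K) => ξ i) = Measure.pi fun _ : Fin K => M.forwardLaw h (acts e) := by
      have := (iIndepFun_iff_map_fun_eq_pi_map (μ := Q)
        (f := fun (i : Fin K) (ξ : ℕ → Fin (T + 1) → X) => ξ i)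
        fun i => (measurable_pi_apply _).aemeasurable).1 (hi.precomp Fin.val_injective)
      simpa only [hν] using this
    rw [POMDP.meanEstimate, ← h1]
    exact integral_map (hres K).aemeasurable
      (M.measurable_estimate measurable_id measurable_const).aestronglyMeasurable
  have hae := M.ae_tendsto_estimate he0 he (fun i => measurable_pi_apply i) hi hν
  have hlim := tendsto_integral_of_dominated_convergence (μ := Q)
    (F := fun (K : ℕ) ξ => M.estimate e fun i : Fin K => ξ i) (f := fun _ => M.postMean h e)
    (fun _ => M.retBound T)
    (fun K => (hest K).aestronglyMeasurable)
    (integrable_const _) (fun K => ae_of_all _ fun ξ => M.abs_estimate_le _ _)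
    hae
  simp_rw [hK]
  simpa using hlim

/-- The distance of the mean estimate from its limit, for at least `K₀` trajectories. -/
def POMDP.tailError (M : POMDP X A Z) (K₀ : ℕ) (h : Hist A Z) {T : ℕ} (e : Steps A Z T) : ℝ :=
  ⨆ k : ℕ, |M.meanEstimate h (K₀ + k) e - M.postMean h e|

lemma POMDP.abs_meanEstimate_sub_le (K : ℕ) (h : Hist A Z) {T : ℕ} (e : Steps A Z T) :
    |M.meanEstimate h K e - M.postMean h e| ≤ 2 * M.retBound T := by
  have h1 := abs_le.1 (M.abs_meanEstimate_le h K e)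
  have h2 := abs_le.1 (M.abs_postMean_le h e)
  rw [abs_le]
  constructor <;> linarith

lemma POMDP.le_tailError {K₀ K : ℕ} (hK : K₀ ≤ K) (h : Hist A Z) {T : ℕ} (e : Steps A Z T) :
    |M.meanEstimate h K e - M.postMean h e| ≤ M.tailError K₀ h e := by
  obtain ⟨k, rfl⟩ := Nat.exists_eq_add_of_le hK
  exact le_ciSup (f := fun k : ℕ => |M.meanEstimate h (K₀ + k) e - M.postMean h e|)
    ⟨2 * M.retBound T, by rintro _ ⟨k, rfl⟩; exact M.abs_meanEstimate_sub_le _ h e⟩ k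

lemma POMDP.tailError_nonneg (K₀ : ℕ) (h : Hist A Z) {T : ℕ} (e : Steps A Z T) :
    0 ≤ M.tailError K₀ h e :=
  (abs_nonneg _).trans (M.le_tailError le_rfl h e)

lemma POMDP.abs_tailError_le (K₀ : ℕ) (h : Hist A Z) {T : ℕ} (e : Steps A Z T) :
    |M.tailError K₀ h e| ≤ 2 * M.retBound T := by
  rw [abs_of_nonneg (M.tailError_nonneg K₀ h e)]
  exact ciSup_le fun k => M.abs_meanEstimate_sub_le _ h e

lemma POMDP.measurable_tailError (K₀ n T : ℕ) :
    Measurable fun q : (Fin n → A × Z) × Steps A Z T => M.tailError K₀ (List.ofFn q.1) q.2 :=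
  Measurable.iSup fun _ =>
    ((M.measurable_meanEstimate n T _).sub (M.measurable_postMean n T)).abs

lemma POMDP.tendsto_tailError {h : Hist A Z} (hh : IsProbabilityMeasure (M.belief h)) {T : ℕ}
    {e : Steps A Z T} (he0 : M.evidence h e ≠ 0) (he : M.evidence h e ≠ ∞) :
    Tendsto (fun K₀ => M.tailError K₀ h e) atTop (𝓝 0) := by
  rw [Metric.tendsto_atTop]
  intro ε hε
  obtain ⟨K₁, hK₁⟩ := Metric.tendsto_atTop.1 (M.tendsto_meanEstimate hh he0 he) (ε / 2) (half_pos hε)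
  refine ⟨K₁, fun K₀ hK₀ => ?_⟩
  rw [Real.dist_0_eq_abs, abs_of_nonneg (M.tailError_nonneg K₀ h e)]
  refine (ciSup_le fun k => ?_).trans_lt (half_lt_self hε)
  exact (hK₁ (K₀ + k) (by omega)).le

end LargeNumbers

/-! ### Joint and successive limits on the search tree. -/

section SearchTree

variable {X A Z : Type*} [MeasurableSpace X] [Fintype A] [DecidableEq A] [MeasurableSpace A]
  [MeasurableSingletonClass A] [MeasurableSpace Z] {M : POMDP X A Z} {π : Policy A Z}

variable (M π) in
omit [MeasurableSingletonClass A] in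
lemma POMDP.tendsto_integral_tailError (T : ℕ) {h : Hist A Z}
    (hh : IsProbabilityMeasure (M.belief h)) :
    Tendsto (fun K₀ => ∫ e, M.tailError K₀ h e ∂(M.policyLaw π T h)) atTop (𝓝 0) := by
  have := M.policyLaw_prob π T h hh
  have h1 := tendsto_integral_of_dominated_convergence (μ := M.policyLaw π T h)
    (F := fun K₀ e => M.tailError K₀ h e) (f := fun _ => 0) (fun _ => 2 * M.retBound T)
    (fun K₀ => (measurable_of_hist (f := fun h e => M.tailError K₀ h e)
      (fun n => M.measurable_tailError K₀ n T) h).aestronglyMeasurable)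
    (integrable_const _) (fun K₀ => ae_of_all _ fun e => M.abs_tailError_le K₀ h e)
    ((M.ae_evidence π T h hh).mono fun e he => M.tendsto_tailError hh he.1 he.2)
  simpa using h1

/-- Three error terms. The tree integral of the posterior mean converges to the value. For all `K ≥
K₀` the estimation error is at most the tree integral of `tailError K₀`, which approaches its
integral under the policy law and hence can be made small by fixing `K₀` first. Only countably many
integrands occur, so one null set suffices. -/
theorem Sampler.ae_tendsto_integral_meanEstimate (S : Sampler M π) (ρ : Rollout A Z) {εz : ℝ}
    (hε : εz < 0) (hε' : -1 ≤ εz) (hπ : ∀ h a, 0 < π.prob h a) (T : ℕ) :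
    ∀ᵐ u ∂(callLaw A), ∀ w : Node A,
      Tendsto (fun p : ℕ × ℕ => ∫ e, M.meanEstimate (S.hist u w) p.2 e ∂(S.treeLaw ρ εz u p.1 T w))
        atTop (𝓝 (M.value π T (S.hist u w))) := by
  have h1 := S.ae_tendsto_integral_treeLaw ρ hε hε' hπ (T := T)
    (f := fun h e => M.postMean h e) (fun n => M.measurable_postMean n T) (M.retBound_nonneg T)
    fun h e => M.abs_postMean_le h e
  have h2 := fun K₀ => S.ae_tendsto_integral_treeLaw ρ hε hε' hπ (T := T)
    (f := fun h e => M.tailError K₀ h e) (fun n => M.measurable_tailError K₀ n T)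
    (mul_nonneg zero_le_two (M.retBound_nonneg T)) fun h e => M.abs_tailError_le K₀ h e
  filter_upwards [S.ae_belief_hist_prob, h1, ae_all_iff.2 h2] with u hu hm ht w
  set h := S.hist u w
  have hsec : Measurable fun e : Steps A Z T => M.postMean h e := M.measurable_postMean_section h T
  have hmean : ∀ K, Measurable fun e : Steps A Z T => M.meanEstimate h K e := fun K =>
    measurable_of_hist (f := fun h e => M.meanEstimate h K e)
      (fun n => M.measurable_meanEstimate n T K) h
  have htail : ∀ K, Measurable fun e : Steps A Z T => M.tailError K h e := fun K =>
    measurable_of_hist (f := fun h e => M.tailError K h e)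
      (fun n => M.measurable_tailError K n T) h
  rw [M.value_eq_integral_postMean π T h (hu w), Metric.tendsto_atTop]
  intro ε hε0
  have hε3 : 0 < ε / 3 := by positivity
  obtain ⟨K₀, hK₀⟩ := (((M.tendsto_integral_tailError π T (hu w)).eventually_lt_const hε3)).exists
  obtain ⟨N₁, hN₁⟩ := eventually_atTop.1 ((ht K₀ w).eventually_lt_const hK₀)
  obtain ⟨N₂, hN₂⟩ := Metric.tendsto_atTop.1 (hm w) (ε / 3) hε3
  refine ⟨(max N₁ N₂, K₀), fun p hp => ?_⟩
  obtain ⟨hpN, hpK⟩ := hp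
  have hb1 := hN₁ p.1 ((le_max_left _ _).trans hpN)
  have hb2 := hN₂ p.1 ((le_max_right _ _).trans hpN)
  have hfin := S.treeLaw_isFinite ρ hε u p.1 T w
  have hb3 : |∫ e, M.meanEstimate h p.2 e ∂(S.treeLaw ρ εz u p.1 T w) -
      ∫ e, M.postMean h e ∂(S.treeLaw ρ εz u p.1 T w)| ≤
      ∫ e, M.tailError K₀ h e ∂(S.treeLaw ρ εz u p.1 T w) := by
    rw [← integral_sub (integrable_of_abs_le (hmean p.2) (M.abs_meanEstimate_le h p.2))
      (integrable_of_abs_le hsec (M.abs_postMean_le h))]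
    refine abs_integral_le_integral_abs.trans (integral_mono
      (integrable_of_abs_le ((hmean p.2).sub hsec) (M.abs_meanEstimate_sub_le p.2 h)).abs
      (integrable_of_abs_le (htail K₀) (M.abs_tailError_le K₀ h)) fun e => ?_)
    exact M.le_tailError hpK h e
  rw [Real.dist_eq] at hb2 ⊢
  calc _ ≤ |∫ e, M.meanEstimate h p.2 e ∂(S.treeLaw ρ εz u p.1 T w) -
        ∫ e, M.postMean h e ∂(S.treeLaw ρ εz u p.1 T w)| +
        |∫ e, M.postMean h e ∂(S.treeLaw ρ εz u p.1 T w) -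
          ∫ e, M.postMean h e ∂(M.policyLaw π T h)| := abs_sub_le _ _ _
    _ < ε := by linarith

omit [DecidableEq A] in
lemma measurable_apply_acts {E : Type*} [MeasurableSpace E] {T : ℕ} :
    Measurable fun q : Steps A Z T × ((Fin T → A) → E) => q.2 (acts q.1) := by
  have h1 : Measurable fun q : (Fin T → A) × ((Fin T → A) → E) => q.2 q.1 :=
    measurable_from_prod_countable_right fun v => measurable_pi_apply v
  exact h1.comp ((measurable_acts.comp measurable_fst).prodMk measurable_snd)

/-- For fixed trajectories the estimate is one bounded function of the steps. It is measurable for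
any choice of `ξ` because there are only finitely many action sequences. -/
theorem Sampler.ae_tendsto_integral_estimate (S : Sampler M π) (ρ : Rollout A Z) {εz : ℝ}
    (hε : εz < 0) (hε' : -1 ≤ εz) (hπ : ∀ h a, 0 < π.prob h a) {T K : ℕ}
    (ξ : (Fin T → A) → Fin K → Fin (T + 1) → X) :
    ∀ᵐ u ∂(callLaw A), ∀ w : Node A,
      Tendsto (fun N => ∫ e, M.estimate e (ξ (acts e)) ∂(S.treeLaw ρ εz u N T w)) atTop
        (𝓝 (∫ e, M.estimate e (ξ (acts e)) ∂(M.policyLaw π T (S.hist u w)))) :=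
  S.ae_tendsto_integral_treeLaw ρ hε hε' hπ (T := T)
    (f := fun _ e => M.estimate e (ξ (acts e)))
    (fun _ => M.measurable_estimate
      ((measurable_of_countable ξ).comp (measurable_acts.comp measurable_snd)) measurable_snd)
    (M.retBound_nonneg T) fun _ e => M.abs_estimate_le e _

-- For almost every sequence the estimate converges for almost every sample. Fubini exchanges the
-- two, so that for almost every sample dominated convergence applies under the policy law. No
-- independence between samples for different action sequences is needed.
variable (M π) in
theorem POMDP.ae_tendsto_integral_estimate (T : ℕ) {h : Hist A Z}
    (hh : IsProbabilityMeasure (M.belief h))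
    (Q : Measure ((Fin T → A) → ℕ → Fin (T + 1) → X)) [IsProbabilityMeasure Q]
    (hQ : ∀ v : Fin T → A, iIndepFun (fun (i : ℕ) ξ => ξ v i) Q ∧
      ∀ i, Q.map (fun ξ => ξ v i) = M.forwardLaw h v) :
    ∀ᵐ ξ ∂Q, Tendsto (fun K : ℕ =>
        ∫ e, M.estimate e (fun i : Fin K => ξ (acts e) i) ∂(M.policyLaw π T h))
      atTop (𝓝 (M.value π T h)) := by
  have := M.policyLaw_prob π T h hh
  have hm : ∀ K : ℕ, Measurable fun q : Steps A Z T × ((Fin T → A) → ℕ → Fin (T + 1) → X) =>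
      M.estimate q.1 fun i : Fin K => q.2 (acts q.1) i := fun K =>
    M.measurable_estimate (measurable_pi_lambda _ fun i =>
      (measurable_pi_apply (i : ℕ)).comp measurable_apply_acts) measurable_fst
  have hpm : Measurable fun e : Steps A Z T => M.postMean h e := M.measurable_postMean_section h T
  have hset : MeasurableSet {q : Steps A Z T × ((Fin T → A) → ℕ → Fin (T + 1) → X) |
      Tendsto (fun K : ℕ => M.estimate q.1 fun i : Fin K => q.2 (acts q.1) i) atTop
        (𝓝 (M.postMean h q.1))} :=
    measurableSet_tendsto_fun (fun K => hm K) (hpm.comp measurable_fst)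
  have hae : ∀ᵐ e ∂(M.policyLaw π T h), ∀ᵐ ξ ∂Q,
      Tendsto (fun K : ℕ => M.estimate e fun i : Fin K => ξ (acts e) i) atTop
        (𝓝 (M.postMean h e)) := by
    filter_upwards [M.ae_evidence π T h hh] with e he
    have hYm : ∀ i : ℕ, Measurable fun ξ : (Fin T → A) → ℕ → Fin (T + 1) → X => ξ (acts e) i :=
      fun i => (measurable_pi_apply i).comp (measurable_pi_apply (acts e))
    have h1 := M.ae_tendsto_estimate he.1 he.2 hYm (hQ (acts e)).1 (hQ (acts e)).2
    exact h1
  filter_upwards [(Measure.ae_ae_comm hset).1 hae] with ξ hξ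
  rw [M.value_eq_integral_postMean π T h hh]
  exact tendsto_integral_of_dominated_convergence (fun _ => M.retBound T)
    (fun K => ((hm K).comp measurable_prodMk_right).aestronglyMeasurable) (integrable_const _)
    (fun K => ae_of_all _ fun e => M.abs_estimate_le e _) hξ

end SearchTree

/-! ### The infinite-horizon value. -/

section Horizon

variable {X A Z : Type*} [MeasurableSpace X] [Fintype A] [MeasurableSpace A] [MeasurableSpace Z]
variable (M : POMDP X A Z) (π : Policy A Z)

lemma measurable_finInit {E : Type*} [MeasurableSpace E] {n : ℕ} :
    Measurable fun s : Fin (n + 1) → E => (Fin.init s : Fin n → E) :=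
  measurable_pi_lambda _ fun i => measurable_pi_apply i.castSucc

/-- The first `T` of `T + 1` steps follow the law of `T` steps. -/
lemma POMDP.lintegral_stepsLaw_init (T : ℕ) : ∀ (h : Hist A Z) (x : X)
    {F : (Fin T → A × X × Z) → ℝ≥0∞}, Measurable F →
      ∫⁻ s, F (Fin.init s) ∂(M.stepsLaw π (T + 1) h x) = ∫⁻ s, F s ∂(M.stepsLaw π T h x) := by
  induction T with
  | zero =>
    intro h x F hF
    have h0 := M.stepsLaw_prob π 0 h x
    have h1 := M.stepsLaw_prob π 1 h x
    have hc : ∀ s, F s = F Fin.elim0 := fun s => congrArg F (Subsingleton.elim _ _)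
    simp_rw [hc]
    simp
  | succ T ih =>
    intro h x F hF
    rw [M.lintegral_stepsLaw_succ π (T + 1) h x (F := fun s => F (Fin.init s))
      (hF.comp measurable_finInit), M.lintegral_stepsLaw_succ π T h x hF]
    refine Finset.sum_congr rfl fun a _ => ?_
    congr 1
    refine lintegral_congr fun x' => lintegral_congr fun z => ?_
    rw [← ih ((a, z) :: h) x' (F := fun s => F (Fin.cons (a, x', z) s))
      (hF.comp (measurable_finCons_const _))]
    refine lintegral_congr fun s => congrArg F (funext fun i => ?_)
    refine Fin.cases rfl (fun j => ?_) i
    simp only [Fin.init, Fin.cons_succ]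
    rw [← Fin.succ_castSucc, Fin.cons_succ]

lemma POMDP.episodeLaw_map_init (T : ℕ) (h : Hist A Z) :
    (M.episodeLaw π (T + 1) h).map (fun q => (q.1, (Fin.init q.2 : Fin T → A × X × Z))) =
      M.episodeLaw π T h := by
  have hm : Measurable fun q : X × (Fin (T + 1) → A × X × Z) =>
      (q.1, (Fin.init q.2 : Fin T → A × X × Z)) :=
    measurable_fst.prodMk (measurable_finInit.comp measurable_snd)
  refine Measure.ext_of_lintegral _ fun F hF => ?_
  rw [lintegral_map hF hm, M.lintegral_episodeLaw π T h hF]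
  refine (M.lintegral_episodeLaw π (T + 1) h (hF.comp hm)).trans ?_
  exact lintegral_congr fun x =>
    M.lintegral_stepsLaw_init π T h x (F := fun s => F (x, s)) (hF.comp measurable_prodMk_left)

lemma POMDP.episodeLaw_mass_le (T : ℕ) (h : Hist A Z) :
    M.episodeLaw π T h Set.univ ≤ 1 := by
  have := M.stepsLaw_prob π T h
  rw [← lintegral_one, M.lintegral_episodeLaw π T h measurable_const]
  simpa using M.belief_mass_le h

/-- The discounted summation of rewards in an episode. -/
def POMDP.episodeRet (M : POMDP X A Z) {T : ℕ} (S : X × (Fin T → A × X × Z)) : ℝ :=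
  M.ret (Fin.cons S.1 fun i => (S.2 i).2.1 : Fin (T + 1) → X) fun i => (S.2 i).1

omit [Fintype A] in
lemma POMDP.measurable_episodeRet (T : ℕ) :
    Measurable fun S : X × (Fin T → A × X × Z) => M.episodeRet S :=
  M.measurable_ret (measurable_finCons measurable_fst (by fun_prop)) (by fun_prop)

omit [Fintype A] in
lemma POMDP.abs_episodeRet_sub_le (T : ℕ) (S : X × (Fin (T + 1) → A × X × Z)) :
    |M.episodeRet (S.1, (Fin.init S.2 : Fin T → A × X × Z)) - M.episodeRet S| ≤
      M.rmax * M.disc ^ T := by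
  have hc : ∀ i : Fin (T + 1),
      (Fin.cons S.1 (fun i => (S.2 i).2.1) : Fin (T + 2) → X) i.castSucc =
        (Fin.cons S.1 (fun i => (Fin.init S.2 i).2.1) : Fin (T + 1) → X) i := fun i => by
    refine Fin.cases rfl (fun j => ?_) i
    rw [← Fin.succ_castSucc]
    rfl
  have h1 : M.episodeRet S = M.episodeRet (S.1, (Fin.init S.2 : Fin T → A × X × Z)) +
      M.disc ^ T * M.reward
        ((Fin.cons S.1 (fun i => (S.2 i).2.1) : Fin (T + 2) → X) (Fin.last T).castSucc)
        (S.2 (Fin.last T)).1 (S.2 (Fin.last T)).2.1 := by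
    simp only [POMDP.episodeRet, POMDP.ret]
    rw [Fin.sum_univ_castSucc]
    simp only [hc, Fin.cons_succ, Fin.val_castSucc, Fin.val_last]
    rfl
  rw [h1, sub_add_cancel_left, abs_neg, abs_mul, abs_of_nonneg (pow_nonneg M.disc_pos.le _),
    mul_comm]
  exact mul_le_mul_of_nonneg_right (M.reward_bounded _ _ _) (pow_nonneg M.disc_pos.le _)


-- Needed for the sign of `rmax`: without actions the reward bound would be vacuous.
omit [MeasurableSpace X] in
lemma Policy.nonempty_actions (π : Policy A Z) : Nonempty A := by
  by_contra hA
  rw [not_nonempty_iff] at hA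
  simpa using π.sum_one []

omit [Fintype A] in
lemma POMDP.rmax_nonneg [Nonempty A] : 0 ≤ M.rmax := by
  obtain ⟨x⟩ := nonempty_of_isProbabilityMeasure M.b0
  exact (abs_nonneg _).trans (M.reward_bounded x (Classical.arbitrary A) x)

/-- By consistency of the episode laws both values are integrals over the law of `T + 1` steps, and
the integrands differ by the last discounted reward. Since every belief has mass at most 1, this
holds for every history. -/
lemma POMDP.dist_value_succ_le (T : ℕ) (h : Hist A Z) :
    dist (M.value π T h) (M.value π (T + 1) h) ≤ M.rmax * M.disc ^ T := by
  have hmass := M.episodeLaw_mass_le π (T + 1) h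
  have hfin : IsFiniteMeasure (M.episodeLaw π (T + 1) h) := ⟨hmass.trans_lt ENNReal.one_lt_top⟩
  have hm : Measurable fun q : X × (Fin (T + 1) → A × X × Z) =>
      (q.1, (Fin.init q.2 : Fin T → A × X × Z)) :=
    measurable_fst.prodMk (measurable_finInit.comp measurable_snd)
  have h1 : M.value π T h = ∫ S, M.episodeRet (S.1, (Fin.init S.2 : Fin T → A × X × Z))
      ∂(M.episodeLaw π (T + 1) h) := by
    rw [POMDP.value, ← M.episodeLaw_map_init π T h]
    exact integral_map hm.aemeasurable (M.measurable_episodeRet T).aestronglyMeasurable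
  have h2 : M.value π (T + 1) h = ∫ S, M.episodeRet S ∂(M.episodeLaw π (T + 1) h) := rfl
  have := π.nonempty_actions
  have hi : Integrable (fun S : X × (Fin (T + 1) → A × X × Z) =>
      M.episodeRet (S.1, (Fin.init S.2 : Fin T → A × X × Z))) (M.episodeLaw π (T + 1) h) :=
    integrable_of_abs_le ((M.measurable_episodeRet T).comp hm) fun _ => M.abs_ret_le _ _
  rw [h1, h2, Real.dist_eq, ← integral_sub hi (integrable_of_abs_le (M.measurable_episodeRet (T + 1)) fun _ => M.abs_ret_le _ _)]
  exact abs_integral_le_of_abs_le hmass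
    (mul_nonneg M.rmax_nonneg (pow_nonneg M.disc_pos.le _)) fun S =>
      M.abs_episodeRet_sub_le T S

theorem POMDP.exists_tendsto_value (h : Hist A Z) :
    ∃ V : ℝ, Tendsto (fun T => M.value π T h) atTop (𝓝 V) ∧
      ∀ T, |M.value π T h - V| ≤ M.rmax * M.disc ^ T / (1 - M.disc) := by
  have hd := fun T => M.dist_value_succ_le π T h
  obtain ⟨V, hV⟩ := cauchySeq_tendsto_of_complete
    (cauchySeq_of_le_geometric _ _ M.disc_lt_one hd)
  exact ⟨V, hV, dist_le_of_le_geometric_of_tendsto _ _ M.disc_lt_one hd hV⟩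

end Horizon

end POMCPpp

end

/-! ### The theorem for an arbitrary source of independent uniform random numbers. -/

theorem lemma3 {X A Z : Type*} [MeasurableSpace X] [Fintype A] [DecidableEq A]
    [MeasurableSpace A] [MeasurableSingletonClass A] [MeasurableSpace Z]
    (M : POMCPpp.POMDP X A Z) (π : POMCPpp.Policy A Z) (S : POMCPpp.Sampler M π)
    (ρ : POMCPpp.Rollout A Z)
    (εa εz : ℝ) (hεa : 0 < εa ∧ εa < 1) (hεz : -1 ≤ εz ∧ εz < 0)
    (hπ : ∀ h a, εa / Fintype.card A ≤ (π.prob h a : ℝ))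
    {Ω : Type*} [MeasurableSpace Ω] (P : Measure Ω) [IsProbabilityMeasure P]
    (U : POMCPpp.Call A → Ω → ℝ) (hUm : ∀ c, Measurable (U c))
    (hUi : iIndepFun U P) (hUu : ∀ c, P.map (U c) = POMCPpp.unif) :
    -- the return of an episode is asymptotically unbiased at every belief node
    (∀ T : ℕ, ∀ᵐ ω ∂P, ∀ w : POMCPpp.Node A,
      Tendsto (fun p : ℕ × ℕ =>
          ∫ e, M.meanEstimate (S.hist (U · ω) w) p.2 e ∂(S.treeLaw ρ εz (U · ω) p.1 T w))
        atTop (𝓝 (M.value π T (S.hist (U · ω) w)))) ∧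
    -- first `N → ∞`, for given state trajectories of the particles
    (∀ (T K : ℕ) (ξ : (Fin T → A) → Fin K → Fin (T + 1) → X), ∀ᵐ ω ∂P, ∀ w : POMCPpp.Node A,
      Tendsto (fun N : ℕ =>
          ∫ e, M.estimate e (ξ (POMCPpp.acts e)) ∂(S.treeLaw ρ εz (U · ω) N T w))
        atTop (𝓝 (∫ e, M.estimate e (ξ (POMCPpp.acts e))
          ∂(M.policyLaw π T (S.hist (U · ω) w))))) ∧
    -- then `K → ∞`, almost surely for forward-simulated independent trajectories
    (∀ T : ℕ, ∀ᵐ ω ∂P, ∀ w : POMCPpp.Node A,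
      ∀ Q : Measure ((Fin T → A) → ℕ → Fin (T + 1) → X), IsProbabilityMeasure Q →
        (∀ v : Fin T → A, iIndepFun (fun (i : ℕ) ξ => ξ v i) Q ∧
          ∀ i, Q.map (fun ξ => ξ v i) = M.forwardLaw (S.hist (U · ω) w) v) →
        ∀ᵐ ξ ∂Q, Tendsto (fun K : ℕ =>
            ∫ e, M.estimate e (fun i : Fin K => ξ (POMCPpp.acts e) i)
              ∂(M.policyLaw π T (S.hist (U · ω) w)))
          atTop (𝓝 (M.value π T (S.hist (U · ω) w)))) ∧
    -- the values with finite horizon converge to the value with infinite horizon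
    (∀ h : POMCPpp.Hist A Z, ∃ V : ℝ, Tendsto (fun T => M.value π T h) atTop (𝓝 V) ∧
      ∀ T, |M.value π T h - V| ≤ M.rmax * M.disc ^ T / (1 - M.disc)) := by
  have hpos : ∀ h a, 0 < π.prob h a := fun h a => by
    have hA : 0 < Fintype.card A := Fintype.card_pos_iff.2 ⟨a⟩
    exact_mod_cast (div_pos hεa.1 (Nat.cast_pos.2 hA)).trans_le (hπ h a)
  -- Independence and the uniform marginals determine the joint law of all calls, so almost sure
  -- statements proved on the product space carry over to `P`.
  have hmap : P.map (fun ω c => U c ω) = POMCPpp.callLaw A := by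
    rw [hUi.map_fun_eq_infinitePi_map hUm]
    simp only [hUu]
  have transfer : ∀ {p : (POMCPpp.Call A → ℝ) → Prop}, (∀ᵐ u ∂(POMCPpp.callLaw A), p u) →
      ∀ᵐ ω ∂P, p (U · ω) := fun {p} hp =>
    ae_of_ae_map (f := fun ω c => U c ω) (measurable_pi_lambda _ hUm).aemeasurable (hmap ▸ hp)
  refine ⟨fun T => transfer
      (S.ae_tendsto_integral_meanEstimate ρ hεz.2 hεz.1 hpos T),
    fun T K ξ => transfer (S.ae_tendsto_integral_estimate ρ hεz.2 hεz.1 hpos ξ),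
    fun T => (transfer S.ae_belief_hist_prob).mono fun ω hω w Q hQ hξ =>
      M.ae_tendsto_integral_estimate π T (hω w) Q hξ,
    fun h => M.exists_tendsto_value π h⟩
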